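/- **Setting.** Fix an infinite set of names. Threads are $S ::= K\lfloor\tilde a\rfloor \mid \sum_{i\in I}\pi_i.S_i \mid \nu r.S$ ($I$ finite, $\pi ::= \overline a\langle b\rangle \mid a(x)\mid\tau$). A finite control process (FCP) specification consists of finitely many defining equations $K(\tilde f):=S$ and a process $$F=\nu\tilde r.(S_1\sigma_1\mid\dots\mid S_n\sigma_n),$$ where $S_1,\dots,S_n$ are threads and $\sigma_i$ is a substitution with domain $\mathrm{fn}(S_i)$. Let $\mathcal R$ be the set of names bound by restrictions (including $\tilde r$), $\mathcal I$ the set of names bound by inputs, $\mathcal F$ the set of formal parameters of the equations together with all names in $\mathrm{fn}(S_1),\dots,\mathrm{fn}(S_n)$, and $\mathcal P=\mathrm{fn}(F)$ the public names. Assume: a name is bound at most once and used at most once as a formal parameter (counting the $\mathrm{fn}(S_i)$ as parameter lists); $\mathcal R\cup\mathcal I$, $\mathcal F$, $\mathcal P$ are pairwise disjoint; different $S_i$ call, directly or through equations, different identifiers; no equation calls itself; calls have as many factual as formal parameters; $\mathrm{fn}(S)=\tilde f$ for every equation $K(\tilde f):=S$; each $S_i$ is a choice or a call; the empty choice $0$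 does not occur in the $S_i$ and the equations; whenever $a(y).S$ or $\nu r.S$ occurs in them, $y\in\mathrm{fn}(S)$ resp. $r\in\mathrm{fn}(S)$. $\mathcal T(F)$ is the transition system of the processes reachable from $F$ under the reaction relation, up to structural congruence $\equiv$ ($\alpha$-conversion; $\mid$ associative and commutative with neutral element $0$; reordering of summands; $\nu r.0\equiv0$; $\nu r.\nu r'.P\equiv\nu r'.\nu r.P$; $\nu r.(P\mid Q)\equiv P\mid\nu r.Q$ if $r\notin\mathrm{fn}(P)$). **The net $N(F)$.** Let $\mathcal N$ be a finite set of fresh values, disjoint from $\mathcal P$, with $|\mathcal N|\ge|\mathcal R|+|\mathcal I|+|\mathcal F|$. The substitution places are $[x=a]$ ($x\in\mathcal I\cup\mathcal F$, $a\in\mathcal P\cup\mathcal N$, or $x\in\mathcal R$, $a\in\mathcal N$), $[x\ne n]$ ($x\in\mathcal I\cup\mathcal F$, $n\in\mathcal N$) and $[r_*\ne n]$ ($n\in\mathcal N$). The control places of thread $i$ are the augmented processes $(S,\lambda)$ ($\lambda$ a list of forgotten names) reachable from $(S_i,\varepsilon)$ by the following transitions, written $\xrightarrow[\text{commands}]{\text{label}}$,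 for all $n\in\mathcal N$ and all $a,b$ such that the places $[x=a]$, $[y=b]$, $[x_m=a]$, $[f_m=a]$ mentioned by commands exist; $\lambda'$ lists $\mathrm{fn}(\text{choice})\setminus\mathrm{fn}(S)$ in a fixed order: * $(\nu r.S,\lambda)\xrightarrow[\mathrm{map}(r,n)]{\tau}(S,\lambda)$; * $(\tau.S+\dots,\lambda)\xrightarrow[\emptyset]{\tau}(S,\lambda\lambda')$; * $(\overline x\langle y\rangle.S+\dots,\lambda)\xrightarrow[\mathrm{test}[x=a],\,\mathrm{test}[y=b]]{\mathrm{send}(a,b)}(S,\lambda\lambda')$; * $(x(y).S+\dots,\lambda)\xrightarrow[\mathrm{test}[x=a],\,\mathrm{map}(y,b)]{\mathrm{rec}(a,b)}(S,\lambda\lambda')$; * for $K(f_1,\dots,f_k):=S$ and $m\ge1$: $(K\lfloor x_1,\dots,x_m\rfloor,\lambda)\xrightarrow[\mathrm{test}[x_m=a],\,\mathrm{map}(f_m,a)]{\tau}(K\lfloor x_1,\dots,x_{m-1}\rfloor,\lambda'')$ with $\lambda''=\lambda$ if $x_m\in\lambda$ and $\lambda''=\lambda x_m$ otherwise; $(K\lfloor-\rfloor,x\lambda)\xrightarrow[\mathrm{unmap}(x,a)]{\tau}(K\lfloor-\rfloor,\lambda)$;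 $(K\lfloor-\rfloor,\varepsilon)\xrightarrow[\emptyset]{\tau}(S,\varepsilon)$. A call that has not started yet is distinguished from the partially executed calls that these last transitions produce; for a parameterless $K$ the not yet started call $K\lfloor\,\rfloor$ has the same outgoing transitions as $K\lfloor-\rfloor$. The transitions of $N(F)$ are the $\tau$-transitions of the threads and, for each $\mathrm{send}(a,b)$-transition and $\mathrm{rec}(a,b)$-transition of two different threads, one joint transition carrying both command sets. Commands are implemented by arcs to the substitution places: $\mathrm{test}[x=a]$ reads $[x=a]$; $\mathrm{map}(x,a)$ with $x\in\mathcal I\cup\mathcal F$ produces on $[x=a]$ and, if $a\in\mathcal N$, consumes from $[x\ne a]$; $\mathrm{map}(r,n)$ with $r\in\mathcal R$ consumes from $[r_*\ne n]$, produces on $[r=n]$ and reads all $[x\ne n]$, $x\in\mathcal I\cup\mathcal F$; $\mathrm{unmap}(x,a)$ consumes from $[x=a]$ and, if $a\in\mathcal N$, produces on $[x\ne a]$ (on $[r_*\ne a]$ if $x\in\mathcal R$). A *substitution marking* satisfies $M[r_*\ne n]+\sum_{r\in\mathcal R}M[r=n]=1$ for $n\in\mathcal N$, $\sum_a M[x=a]\le1$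 for $x\in\mathcal I\cup\mathcal F\cup\mathcal R$, and $M[x=n]+M[x\ne n]=1$ for $x\in\mathcal I\cup\mathcal F$, $n\in\mathcal N$. It *corresponds* to a substitution $\sigma$, with domain contained in $\mathcal I\cup\mathcal F\cup\mathcal R$ and values in $\mathcal P\cup\tilde r'$, that maps the restricted names in its domain injectively into $\tilde r'$, if: $M[x=a]=0$ for all $a$ whenever $x\notin\mathrm{dom}(\sigma)$; $M[x=\sigma(x)]=1$ if $\sigma(x)\in\mathcal P$; $M[x=n]=1$ for some $n\in\mathcal N$ if $\sigma(x)\in\tilde r'$; and, if $\sigma(x),\sigma(y)\in\tilde r'$, then $\sigma(x)=\sigma(y)$ iff $M[x=n]=M[y=n]$ for all $n\in\mathcal N$. Initially there is one token on each $(S_i,\varepsilon)$, the other control places are empty, and the substitution places carry any substitution marking that corresponds to $\sigma_1\cup\dots\cup\sigma_n$ (with $\tilde r'=\tilde r$). $\mathcal T(N(F))$ is the transition system of all reachable markings. A marking is *stable* if in every thread it marks a place $(S,\lambda)$ where $S$ is a choice or a not yet started call. **The relation $R$.** For a state $[G]$ of $\mathcal T(F)$ and a stable reachable marking $M$, let $([G],M)\in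 R$ if there are a repetition-free list $\tilde r'$ of non-public names, choices or calls $S'_1,\dots,S'_n$, lists $\lambda_i$ and substitutions $\sigma'_i:\mathrm{fn}(S'_i)\cup\lambda_i\to\tilde r'\cup\mathcal P$ with $\mathrm{fn}(S'_i)\cap\lambda_i=\emptyset$, such that $G\equiv\nu\tilde r'.(S'_1\sigma'_1\mid\dots\mid S'_n\sigma'_n)$; each $(S'_i,\lambda_i)$ is reachable by the control transitions above from some $(S,\varepsilon)$, where $S$ is one of the $S_j$ or the body of an equation, with no call before the last augmented process; $\sigma'_1\cup\dots\cup\sigma'_n$ is a function to which the substitution part of $M$ corresponds; and $M(S'_i,\lambda_i)=1$ in the $i$-th control net, for all $i$. **Theorem 6.3.** $\mathcal T(F)\approx\mathcal T(N(F))$, with $R$ as a weak bisimulation, where the stable markings are the observed states of $N(F)$. That is, $R$ relates $[F]$ to the initial marking of $N(F)$, and whenever $(s,M)\in R$: 1. if $s\to s'$ in $\mathcal T(F)$, there is $M'$ with $M\to^+M'$ in $\mathcal T(N(F))$ and $(s',M')\in R$; 2. if $M\to^+M'$ in $\mathcal T(N(F))$ by an arbitrary transition sequence to a stable marking $M'$,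 there is $s'$ with $s\to^+s'$ in $\mathcal T(F)$ and $(s',M')\in R$; 3. if $M\to^*M'$ in $\mathcal T(N(F))$, stable or not, then $M'\to^*M''$ for some stable $M''$ (so that condition 2 accounts for every behaviour of the full transition system of $N(F)$). -/

import Mathlib

open Relation

universe u v w

/-! # Transition systems -/

/-- A transition system: states, an unlabelled transition relation, an initial state. -/
structure TransSys where
  State : Type u
  step : State → State → Prop
  init : State

/-- `R` is a weak bisimulation between `T₁` and `T₂`, where only the states of `T₂` that satisfy
`Stable` are observed: the states of `T₂` in between are passed through silently, so that
`R` relates states of `T₁` to stable states of `T₂` only.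
* The initial states are related.
* Every single transition of `T₁` is mimicked by a transition sequence of `T₂`.
* Every transition sequence of `T₂` that leads to a stable state, whatever unstable or stable
  states it passes through, is mimicked by a transition sequence of `T₁`.
* Every transition sequence of `T₂` can be prolonged to one that leads to a stable state,
  so that no behaviour of `T₂` escapes the preceding condition. -/
structure IsWeakBisimulation (T₁ : TransSys.{u}) (T₂ : TransSys.{v}) (Stable : T₂.State → Prop)
    (R : T₁.State → T₂.State → Prop) : Prop where
  init : R T₁.init T₂.init
  stable : ∀ s t, R s t → Stable t
  forth : ∀ s t, R s t → ∀ s', T₁.step s s' → ∃ t', TransGen T₂.step t t' ∧ R s' t'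
  back : ∀ s t, R s t → ∀ t', TransGen T₂.step t t' → Stable t' →
    ∃ s', TransGen T₁.step s s' ∧ R s' t'
  complete : ∀ s t, R s t → ∀ t', ReflTransGen T₂.step t t' →
    ∃ t'', ReflTransGen T₂.step t' t'' ∧ Stable t''

/-! # Petri nets -/

/-- A Petri net with places `P ⊆ X` and transitions `T ⊆ Y`. The flow relation is given by
presets and postsets. A marking is a function `X → ℕ` that vanishes outside `P`. -/
structure PetriNet (X : Type u) (Y : Type v) where
  P : Set X
  T : Set Y
  pre : Y → Set X
  post : Y → Set X
  M₀ : X → ℕ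

namespace PetriNet

variable {X : Type u} {Y : Type v}

/-- The firing relation `M [t⟩ M'`. -/
def Fires (W : PetriNet X Y) (M : X → ℕ) (t : Y) (M' : X → ℕ) : Prop :=
  t ∈ W.T ∧ (∀ p ∈ W.pre t, 0 < M p) ∧
    ∀ p, M' p = M p - (W.pre t).indicator 1 p + (W.post t).indicator 1 p

def Step (W : PetriNet X Y) (M M' : X → ℕ) : Prop := ∃ t, W.Fires M t M'

/-- The (full) transition system of a Petri net: all its reachable markings. -/
def ts (W : PetriNet X Y) : TransSys where
  State := {M : X → ℕ // ReflTransGen W.Step W.M₀ M}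
  step M M' := W.Step M.1 M'.1
  init := ⟨W.M₀, .refl⟩

end PetriNet

/-! # Processes -/

/-- Prefixes: output `a⟨b⟩`, input `a(x)`, silent action `τ`. -/
inductive Act (N : Type u) where
  | out (a b : N)
  | inp (a x : N)
  | tau

namespace Act

variable {N : Type u}

/-- The free names of `π.S`, given the free names `s` of `S`. -/
def fnUnder [DecidableEq N] : Act N → Finset N → Finset N
  | out a b, s => {a, b} ∪ s
  | inp a x, s => {a} ∪ s.erase x
  | tau, s => s

/-- The names bound by a prefix. -/
def binder : Act N → Multiset N
  | inp _ x => {x}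
  | _ => 0

end Act

/-- Process terms over names `N` and process identifiers `I`: calls `K⌊ã⌋`, choices
`∑ i, π i . P i` over `n` summands, restrictions `ν r. P`, parallel compositions `P | Q`. -/
inductive Proc (N : Type u) (I : Type v) where
  | call (K : I) (args : List N)
  | choice (n : ℕ) (act : Fin n → Act N) (cont : Fin n → Proc N I)
  | res (r : N) (P : Proc N I)
  | par (P Q : Proc N I)

namespace Proc

variable {N : Type u} {I : Type v}

/-- The process `0`: the empty choice. -/
def nil : Proc N I := choice 0 Fin.elim0 Fin.elim0

/-- `ν r₁. … ν rₖ. P` -/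
def resList (rs : List N) (P : Proc N I) : Proc N I := rs.foldr res P

/-- `P₁ | … | Pₙ` -/
def parList : List (Proc N I) → Proc N I
  | [] => nil
  | [P] => P
  | P :: Q :: l => par P (parList (Q :: l))

/-- Free names. -/
def fn [DecidableEq N] : Proc N I → Finset N
  | call _ args => args.toFinset
  | choice _ act cont => Finset.univ.biUnion fun i => (act i).fnUnder (fn (cont i))
  | res r P => (fn P).erase r
  | par P Q => fn P ∪ fn Q

/-- The names bound by restrictions, one copy for each binding occurrence. -/
def resNames : Proc N I → Multiset N
  | call _ _ => 0
  | choice _ _ cont => ∑ i, resNames (cont i)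
  | res r P => r ::ₘ resNames P
  | par P Q => resNames P + resNames Q

/-- The names bound by input prefixes, one copy for each binding occurrence. -/
def inpNames : Proc N I → Multiset N
  | call _ _ => 0
  | choice _ act cont => ∑ i, ((act i).binder + inpNames (cont i))
  | res _ P => inpNames P
  | par P Q => inpNames P + inpNames Q

/-- The identifiers called in a process. -/
def calls : Proc N I → Set I
  | call K _ => {K}
  | choice _ _ cont => ⋃ i, calls (cont i)
  | res _ P => calls P
  | par P Q => calls P ∪ calls Q

/-- Threads (sequential processes): no parallel composition occurs. -/
def IsThread : Proc N I → Prop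
  | call _ _ => True
  | choice _ _ cont => ∀ i, IsThread (cont i)
  | res _ P => IsThread P
  | par _ _ => False

/-- The process `0` does not occur. -/
def StopFree : Proc N I → Prop
  | call _ _ => True
  | choice n _ cont => n ≠ 0 ∧ ∀ i, StopFree (cont i)
  | res _ P => StopFree P
  | par P Q => StopFree P ∧ StopFree Q

/-- Whenever `a(y).S` or `ν r. S` occurs, `y` resp. `r` is free in `S`. -/
def BindersUsed [DecidableEq N] : Proc N I → Prop
  | call _ _ => True
  | choice _ act cont => ∀ i, (∀ a y, act i = .inp a y → y ∈ fn (cont i)) ∧ BindersUsed (cont i)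
  | res r P => r ∈ fn P ∧ BindersUsed P
  | par P Q => BindersUsed P ∧ BindersUsed Q

/-- Each call of `K` has `arity K` factual parameters. -/
def RespectsArity (arity : I → ℕ) : Proc N I → Prop
  | call K args => args.length = arity K
  | choice _ _ cont => ∀ i, RespectsArity arity (cont i)
  | res _ P => RespectsArity arity P
  | par P Q => RespectsArity arity P ∧ RespectsArity arity Q

def IsCall : Proc N I → Prop
  | call _ _ => True
  | _ => False

def IsChoice : Proc N I → Prop
  | choice _ _ _ => True
  | _ => False

section Substitution

variable [DecidableEq N] [Infinite N]

/-- The name `x` itself if it is not in `A`, and otherwise some name outside `A`. -/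
noncomputable def avoid (x : N) (A : Finset N) : N :=
  if x ∈ A then (Infinite.exists_notMem_finset A).choose else x

/-- The application `Pσ` of a substitution: simultaneous and capture-avoiding. A bound name
is renamed exactly if it would capture a substituted name. -/
noncomputable def subst : (N → N) → Proc N I → Proc N I
  | σ, call K args => call K (args.map σ)
  | σ, choice n act cont =>
      choice n
        (fun i => match act i with
          | .out a b => .out (σ a) (σ b)
          | .inp a x => .inp (σ a) (avoid x (((cont i).fn.erase x).image σ))
          | .tau => .tau)
        (fun i => subst
          (match act i with
            | .inp _ x => Function.update σ x (avoid x (((cont i).fn.erase x).image σ))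
            | _ => σ)
          (cont i))
  | σ, res r P =>
      res (avoid r ((P.fn.erase r).image σ))
        (subst (Function.update σ r (avoid r ((P.fn.erase r).image σ))) P)
  | σ, par P Q => par (subst σ P) (subst σ Q)

/-- `P{b/x}` -/
noncomputable def subst₁ (b x : N) (P : Proc N I) : Proc N I :=
  P.subst (Function.update id x b)

/-- `P{ã/x̃}` for lists of the same length, `x̃` without repetitions. -/
noncomputable def substList (as xs : List N) (P : Proc N I) : Proc N I :=
  P.subst fun y => ((xs.zip as).lookup y).getD y

/-- Structural congruence: the smallest congruence with alpha-conversion, `|` associative and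
commutative with neutral element `0`, choices independent of the order of summands,
and the laws for restriction. -/
inductive Cong : Proc N I → Proc N I → Prop
  | refl (P) : Cong P P
  | symm {P Q} : Cong P Q → Cong Q P
  | trans {P Q R} : Cong P Q → Cong Q R → Cong P R
  | choice_congr {n} {act : Fin n → Act N} {cont cont' : Fin n → Proc N I} :
      (∀ i, Cong (cont i) (cont' i)) → Cong (choice n act cont) (choice n act cont')
  | res_congr {r P P'} : Cong P P' → Cong (res r P) (res r P')
  | par_congr {P P' Q Q'} : Cong P P' → Cong Q Q' → Cong (par P Q) (par P' Q')
  | alpha_res {r r' P} : r' ∉ P.fn → Cong (res r P) (res r' (subst₁ r' r P))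
  | alpha_inp {n} {act : Fin n → Act N} {cont : Fin n → Proc N I} {i a x x'} :
      act i = .inp a x → x' ∉ (cont i).fn →
      Cong (choice n act cont)
        (choice n (Function.update act i (.inp a x'))
          (Function.update cont i (subst₁ x' x (cont i))))
  | choice_perm {n} {act : Fin n → Act N} {cont : Fin n → Proc N I} (e : Equiv.Perm (Fin n)) :
      Cong (choice n act cont) (choice n (act ∘ e) (cont ∘ e))
  | par_comm (P Q) : Cong (par P Q) (par Q P)
  | par_assoc (P Q R) : Cong (par (par P Q) R) (par P (par Q R))
  | par_nil (P) : Cong (par P nil) P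
  | res_nil (r) : Cong (res r nil) nil
  | res_comm (r r' P) : Cong (res r (res r' P)) (res r' (res r P))
  | res_par {r P Q} : r ∉ P.fn → Cong (res r (par P Q)) (par P (res r Q))

/-- The reaction relation, for the defining equations `K(params K) := body K`. -/
inductive React (params : I → List N) (body : I → Proc N I) : Proc N I → Proc N I → Prop
  | tau {n act cont} {i : Fin n} : act i = .tau →
      React params body (choice n act cont) (cont i)
  | const {K as} : as.length = (params K).length →
      React params body (call K as) (substList as (params K) (body K))
  | comm {n act cont m act' cont'} {i : Fin n} {j : Fin m} {x y z} :
      act i = .inp x y → act' j = .out x z →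
      React params body (par (choice n act cont) (choice m act' cont'))
        (par (subst₁ z y (cont i)) (cont' j))
  | par {P P' Q} : React params body P P' → React params body (par P Q) (par P' Q)
  | res {a P P'} : React params body P P' → React params body (res a P) (res a P')
  | struct {P P' Q Q'} : Cong P P' → React params body P' Q' → Cong Q' Q →
      React params body P Q

/-- Processes up to structural congruence. -/
def congSetoid (N : Type u) (I : Type v) [DecidableEq N] [Infinite N] : Setoid (Proc N I) where
  r := Cong
  iseqv := ⟨.refl, .symm, .trans⟩

end Substitution

end Proc

/-! # Substitutions with explicit domain -/

/-- A substitution as a partial function; its domain is the set of `x` with `σ x ≠ none`. -/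
abbrev PSub (N : Type u) := N → Option N

namespace PSub

variable {N : Type u}

/-- The substitution as a total function, the identity outside of its domain. -/
def app (σ : PSub N) (x : N) : N := (σ x).getD x

/-- `σ` is the union `σ₁ ∪ … ∪ σₙ`. -/
def IsUnion {ι : Type v} (σ : PSub N) (σs : ι → PSub N) : Prop :=
  ∀ x y, σ x = some y ↔ ∃ i, σs i x = some y

end PSub

/-! # Finite control processes -/

/-- An FCP specification `F = ν r̃. (S₁σ₁ | … | Sₙσₙ)` together with the defining equations
`K(params K) := body K` of the identifiers `K : I`. The threads `Sᵢ` are `thread i`. The free names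
of `Sᵢ` are the formal parameters of the artificial equation for the `i`-th thread. -/
structure FCPSpec (N : Type u) (I : Type v) where
  params : I → List N
  body : I → Proc N I
  n : ℕ
  rs : List N
  thread : Fin n → Proc N I
  sub : Fin n → PSub N

/-- The values to which names may be mapped: public names, and elements of `New`. -/
inductive Val (N : Type u) (New : Type w) where
  | pub (p : N)
  | new (n : New)

/-- The labels of the control flow nets. -/
inductive SyncLabel (N : Type u) (New : Type w) where
  | tau
  | send (a b : Val N New)
  | recv (a b : Val N New)

/-- The commands of the control flow nets. -/
inductive Cmd (N : Type u) (New : Type w) where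
  | map (x : N) (a : Val N New)
  | unmap (x : N) (a : Val N New)
  | test (x : N) (a : Val N New)

/-- The control part of an augmented process: either a thread, or a call of `K` under execution,
of which the factual parameters `xs` have still to be passed; `passing K []` is written `K⌊-⌋` in
the literature. Keeping the two apart matters for parameterless calls only: `K⌊ ⌋` not
yet started differs from `K⌊-⌋`. -/
inductive Ctl (N : Type u) (I : Type v) where
  | thread (S : Proc N I)
  | passing (K : I) (xs : List N)

namespace Ctl

variable {N : Type u} {I : Type v}

/-- `c` is a call of `K` with (remaining) factual parameters `xs`. -/
def IsCallOf (c : Ctl N I) (K : I) (xs : List N) : Prop :=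
  c = thread (.call K xs) ∨ c = passing K xs

def IsCall (c : Ctl N I) : Prop := ∃ K xs, c.IsCallOf K xs

/-- Choices, and calls with full parameter list. -/
def IsStable : Ctl N I → Prop
  | thread S => S.IsChoice ∨ S.IsCall
  | passing _ _ => False

end Ctl

/-- Augmented processes `(S, λ)`: the list `forgotten` holds the names that have been forgotten
and will eventually be unmapped. -/
structure CState (N : Type u) (I : Type v) where
  ctl : Ctl N I
  forgotten : List N

/-- The places of the substitution net: `[x = a]`, `[x ≠ n]` and `[r_* ≠ n]`. -/
inductive SPlace (N : Type u) (New : Type w) where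
  | eq (x : N) (a : Val N New)
  | ne (x : N) (n : New)
  | neStar (n : New)

/-- A control flow net: a Petri net whose transitions carry a label and a set of commands. -/
structure CFNet (N : Type u) (New : Type w) (X : Type*) (Y : Type*) extends PetriNet X Y where
  label : Y → SyncLabel N New
  cmds : Y → Set (Cmd N New)

namespace CFNet

variable {N : Type u} {New : Type w} {X Y : Type*}

/-- The parallel composition `W 1 ∥ … ∥ W n` (an associative and commutative operation, here for
all nets at once): the disjoint union of the nets, and a new `τ`-transition for every
`send(a, b)`-transition of one net and `recv(a, b)`-transition of another net. -/
def parallel {n : ℕ} (W : Fin n → CFNet N New X Y) :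
    CFNet N New (Fin n × X) ((Fin n × Y) ⊕ ((Fin n × Y) × (Fin n × Y))) where
  P := {p | p.2 ∈ (W p.1).P}
  T := {t | match t with
    | .inl (i, t) => t ∈ (W i).T
    | .inr ((i, t), (j, t')) => i ≠ j ∧ t ∈ (W i).T ∧ t' ∈ (W j).T ∧
        ∃ a b, (W i).label t = .send a b ∧ (W j).label t' = .recv a b}
  pre
    | .inl (i, t) => Prod.mk i '' (W i).pre t
    | .inr ((i, t), (j, t')) => Prod.mk i '' (W i).pre t ∪ Prod.mk j '' (W j).pre t'
  post
    | .inl (i, t) => Prod.mk i '' (W i).post t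
    | .inr ((i, t), (j, t')) => Prod.mk i '' (W i).post t ∪ Prod.mk j '' (W j).post t'
  M₀ p := (W p.1).M₀ p.2
  label
    | .inl (i, t) => (W i).label t
    | .inr _ => .tau
  cmds
    | .inl (i, t) => (W i).cmds t
    | .inr ((i, t), (j, t')) => (W i).cmds t ∪ (W j).cmds t'

/-- Hiding: all transitions with a label different from `τ` are removed. -/
def hide (W : CFNet N New X Y) : CFNet N New X Y :=
  { W with T := {t | t ∈ W.T ∧ W.label t = .tau} }

end CFNet

namespace FCPSpec

variable {N : Type u} {I : Type v} [DecidableEq N] [Infinite N] [Fintype I]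

/-- The process `ν r̃. (S₁σ₁ | … | Sₙσₙ)`. -/
noncomputable def proc (F : FCPSpec N I) : Proc N I :=
  .resList F.rs (.parList (.ofFn fun i => (F.thread i).subst (F.sub i).app))

/-- The transition system of `F`: reachable processes up to structural congruence. -/
noncomputable def ts (F : FCPSpec N I) : TransSys where
  State := {q : Quotient (Proc.congSetoid N I) //
    ∃ G, ReflTransGen (Proc.React F.params F.body) F.proc G ∧ q = Quotient.mk _ G}
  step q q' := ∃ G G', q.1 = Quotient.mk _ G ∧ q'.1 = Quotient.mk _ G' ∧
    Proc.React F.params F.body G G'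
  init := ⟨Quotient.mk _ F.proc, F.proc, .refl, rfl⟩

/-- The occurrences of names bound by restrictions in the specification. -/
def resOcc (F : FCPSpec N I) : Multiset N :=
  (F.rs : Multiset N) + ∑ i, (F.thread i).resNames + ∑ K, (F.body K).resNames

/-- The occurrences of names bound by input prefixes in the specification. -/
def inpOcc (F : FCPSpec N I) : Multiset N :=
  ∑ i, (F.thread i).inpNames + ∑ K, (F.body K).inpNames

/-- The occurrences of names in lists of formal parameters, where the free names of an initial
thread are the formal parameters of its artificial defining equation. -/
def frmOcc (F : FCPSpec N I) : Multiset N :=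
  ∑ i, (F.thread i).fn.val + ∑ K, (F.params K : Multiset N)

/-- Restricted names. -/
def RESTR (F : FCPSpec N I) : Finset N := F.resOcc.toFinset

/-- Input names. -/
def INP (F : FCPSpec N I) : Finset N := F.inpOcc.toFinset

/-- Formal parameters. -/
def FRM (F : FCPSpec N I) : Finset N := F.frmOcc.toFinset

/-- Public names. They are the free names of the process, as the defining
equations do not contain any others. -/
noncomputable def PUB (F : FCPSpec N I) : Finset N := F.proc.fn

/-- The identifiers called by the `i`-th thread, directly or through defining equations. -/
inductive CalledBy (F : FCPSpec N I) (i : Fin F.n) : I → Prop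
  | direct {K} : K ∈ (F.thread i).calls → CalledBy F i K
  | step {K L} : CalledBy F i K → L ∈ (F.body K).calls → CalledBy F i L

/-- The initial threads, and the bodies of the defining equations. -/
def IsBody (F : FCPSpec N I) (S : Proc N I) : Prop :=
  (∃ i, S = F.thread i) ∨ ∃ K, S = F.body K

/-- The well-formedness, no clash and normal form assumptions on a specification. -/
structure NormalForm (F : FCPSpec N I) : Prop where
  /-- Threads are sequential. -/
  isThread : ∀ S, F.IsBody S → S.IsThread
  /-- Calls have as many factual as formal parameters. -/
  arity : ∀ S, F.IsBody S → S.RespectsArity fun K => (F.params K).length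
  /-- The domain of `σᵢ` is the set of free names of the `i`-th thread. -/
  sub_dom : ∀ i x, (F.sub i x).isSome ↔ x ∈ (F.thread i).fn
  /-- A name is bound at most once. -/
  bound_nodup : (F.resOcc + F.inpOcc).Nodup
  /-- A name is used at most once as a formal parameter. -/
  formal_nodup : F.frmOcc.Nodup
  /-- Bound names and free names are disjoint. -/
  bound_free : Disjoint (F.RESTR ∪ F.INP) F.PUB
  /-- Bound names and formal parameters are disjoint. -/
  bound_formal : Disjoint (F.RESTR ∪ F.INP) F.FRM
  /-- Formal parameters and free names are disjoint. -/
  formal_free : Disjoint F.FRM F.PUB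
  /-- Different threads call different identifiers. -/
  calls_disjoint : ∀ i j K, F.CalledBy i K → F.CalledBy j K → i = j
  /-- No defining equation calls itself. -/
  no_self_call : ∀ K, K ∉ (F.body K).calls
  /-- The free names of a defining process are its formal parameters. -/
  fn_body : ∀ K, (F.body K).fn = (F.params K).toFinset
  /-- The initial threads are choices or calls. -/
  thread_stable : ∀ i, (F.thread i).IsChoice ∨ (F.thread i).IsCall
  /-- The process `0` does not occur. -/
  stopFree : ∀ S, F.IsBody S → S.StopFree
  /-- Bound names are used in their scopes. -/
  bindersUsed : ∀ S, F.IsBody S → S.BindersUsed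

/-! ## The substitution net -/

section Net

variable {New : Type w}

/-- The place `[x = a]` exists: an input name or formal parameter may have any value in
`PUB ∪ NEW`, and a restricted name any value in `NEW`. -/
def InDom (F : FCPSpec N I) (x : N) : Val N New → Prop
  | .pub p => p ∈ F.PUB ∧ x ∈ F.INP ∪ F.FRM
  | .new _ => x ∈ F.INP ∪ F.FRM ∪ F.RESTR

/-- The places of the substitution net. -/
def substPlaces (F : FCPSpec N I) : Set (SPlace N New) :=
  {p | match p with
    | .eq x a => F.InDom x a
    | .ne x _ => x ∈ F.INP ∪ F.FRM
    | .neStar _ => True}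

/-- Substitution markings. -/
structure IsSubstMarking [Fintype New] (F : FCPSpec N I) (M : SPlace N New → ℕ) : Prop where
  supp : ∀ p, p ∉ F.substPlaces → M p = 0
  restr : ∀ n, M (.neStar n) + ∑ r ∈ F.RESTR, M (.eq r (.new n)) = 1
  bind : ∀ x ∈ F.INP ∪ F.FRM ∪ F.RESTR,
    ∑ p ∈ F.PUB, M (.eq x (.pub p)) + ∑ n, M (.eq x (.new n)) ≤ 1
  compl : ∀ x ∈ F.INP ∪ F.FRM, ∀ n, M (.eq x (.new n)) + M (.ne x n) = 1

/-- The substitution marking `M` corresponds to the substitution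
`σ : (INP' ∪ FRM' → PUB ∪ r̃) ∪ (RESTR' → r̃)`, injective on `RESTR'`. -/
structure Corresponds [Fintype New] (F : FCPSpec N I) (rs : List N) (σ : PSub N)
    (M : SPlace N New → ℕ) : Prop where
  isSubstMarking : F.IsSubstMarking M
  dom : ∀ x, (σ x).isSome → x ∈ F.INP ∪ F.FRM ∪ F.RESTR
  cod : ∀ x y, σ x = some y → y ∈ F.PUB ∨ y ∈ rs
  cod_restr : ∀ x ∈ F.RESTR, ∀ y, σ x = some y → y ∈ rs
  inj_restr : ∀ x ∈ F.RESTR, ∀ x' ∈ F.RESTR, ∀ y, σ x = some y → σ x' = some y → x = x'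
  not_dom : ∀ x, σ x = none → ∀ a, M (.eq x a) = 0
  pub : ∀ x, ∀ p ∈ F.PUB, σ x = some p → M (.eq x (.pub p)) = 1
  rest : ∀ x, ∀ r ∈ rs, σ x = some r → ∃ n, M (.eq x (.new n)) = 1
  eq : ∀ x y, ∀ r ∈ rs, ∀ r' ∈ rs, σ x = some r → σ y = some r' →
    (r = r' ↔ ∀ n, M (.eq x (.new n)) = M (.eq y (.new n)))

/-- The substitution net, with initial marking `M`. It has no transitions. -/
def substNet (F : FCPSpec N I) (M : SPlace N New → ℕ) : PetriNet (SPlace N New) Empty where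
  P := F.substPlaces
  T := ∅
  pre _ := ∅
  post _ := ∅
  M₀ := M

/-! ## The control flow -/

/-- The names forgotten when `S` becomes `S'`, as a list in some fixed order. -/
noncomputable def forget (S S' : Proc N I) : List N := (S.fn \ S'.fn).toList

/-- The labelled transition relation on augmented processes. -/
inductive CStep (F : FCPSpec N I) :
    CState N I → SyncLabel N New → Set (Cmd N New) → CState N I → Prop
  | nu (r S l) (n : New) :
      CStep F ⟨.thread (.res r S), l⟩ .tau {.map r (.new n)} ⟨.thread S, l⟩
  | tau {n act cont} {i : Fin n} (l) : act i = .tau →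
      CStep F ⟨.thread (.choice n act cont), l⟩ .tau ∅
        ⟨.thread (cont i), l ++ forget (.choice n act cont) (cont i)⟩
  | snd {n act cont} {i : Fin n} {x y} (l) (a b : Val N New) : act i = .out x y →
      F.InDom x a → F.InDom y b →
      CStep F ⟨.thread (.choice n act cont), l⟩ (.send a b) {.test x a, .test y b}
        ⟨.thread (cont i), l ++ forget (.choice n act cont) (cont i)⟩
  | rcv {n act cont} {i : Fin n} {x y} (l) (a b : Val N New) : act i = .inp x y →
      F.InDom x a → F.InDom y b →
      CStep F ⟨.thread (.choice n act cont), l⟩ (.recv a b) {.test x a, .map y b}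
        ⟨.thread (cont i), l ++ forget (.choice n act cont) (cont i)⟩
  | call₁ {c K xs x f} (l) (a : Val N New) : c.IsCallOf K (xs ++ [x]) →
      (F.params K)[xs.length]? = some f → F.InDom x a → F.InDom f a →
      CStep F ⟨c, l⟩ .tau {.test x a, .map f a}
        ⟨.passing K xs, if x ∈ l then l else l ++ [x]⟩
  | call₂ {c K} (x l) (a : Val N New) : c.IsCallOf K [] → F.InDom x a →
      CStep F ⟨c, x :: l⟩ .tau {.unmap x a} ⟨.passing K [], l⟩
  | call₃ {c K} : c.IsCallOf K [] →
      CStep F ⟨c, []⟩ .tau ∅ ⟨.thread (F.body K), []⟩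

/-- Some transition leads from `s` to `s'`. -/
def CNext (New : Type w) (F : FCPSpec N I) (s s' : CState N I) : Prop :=
  ∃ (l : SyncLabel N New) (C : Set (Cmd N New)), F.CStep s l C s'

/-- The transitions of the control flow nets: source, label, commands, target. -/
structure CTrans (N : Type u) (I : Type v) (New : Type w) where
  src : CState N I
  label : SyncLabel N New
  cmds : Set (Cmd N New)
  tgt : CState N I

/-- The control flow net of a thread `S`. -/
noncomputable def threadNet (New : Type w) (F : FCPSpec N I) (S : Proc N I) :
    CFNet N New (CState N I) (CTrans N I New) where
  P := {s | ReflTransGen (F.CNext New) ⟨.thread S, []⟩ s}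
  T := {t | ReflTransGen (F.CNext New) ⟨.thread S, []⟩ t.src ∧ F.CStep t.src t.label t.cmds t.tgt}
  pre t := {t.src}
  post t := {t.tgt}
  M₀ := Set.indicator {⟨.thread S, []⟩} 1
  label := CTrans.label
  cmds := CTrans.cmds

/-! ## Implementation of commands -/

/-- The places of the substitution net from which a command consumes a token. -/
def cmdPre (F : FCPSpec N I) : Cmd N New → Set (SPlace N New)
  | .test x a => {.eq x a}
  | .map _ (.pub _) => ∅
  | .map x (.new n) =>
      if x ∈ F.RESTR then {.neStar n} ∪ {p | ∃ y ∈ F.INP ∪ F.FRM, p = .ne y n} else {.ne x n}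
  | .unmap x a => {.eq x a}

/-- The places of the substitution net on which a command produces a token. -/
def cmdPost (F : FCPSpec N I) : Cmd N New → Set (SPlace N New)
  | .test x a => {.eq x a}
  | .map x (.pub p) => {.eq x (.pub p)}
  | .map x (.new n) =>
      if x ∈ F.RESTR then {.eq x (.new n)} ∪ {p | ∃ y ∈ F.INP ∪ F.FRM, p = .ne y n}
      else {.eq x (.new n)}
  | .unmap _ (.pub _) => ∅
  | .unmap x (.new n) => if x ∈ F.RESTR then {.neStar n} else {.ne x n}

/-- The implementation operation: the commands at the transitions of `W₂` become arcs between
these transitions and the places of the substitution net `W₁`. -/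
def implement {X Y Y' : Type*} (F : FCPSpec N I) (W₁ : PetriNet (SPlace N New) Y')
    (W₂ : CFNet N New X Y) : PetriNet (SPlace N New ⊕ X) Y where
  P := Sum.inl '' W₁.P ∪ Sum.inr '' W₂.P
  T := W₂.T
  pre t := Sum.inl '' (⋃ c ∈ W₂.cmds t, F.cmdPre c) ∪ Sum.inr '' W₂.pre t
  post t := Sum.inl '' (⋃ c ∈ W₂.cmds t, F.cmdPost c) ∪ Sum.inr '' W₂.post t
  M₀ := Sum.elim W₁.M₀ W₂.M₀

/-- The net of `F`, where the substitution net is initially marked by `M`. -/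
noncomputable def net (F : FCPSpec N I) (M : SPlace N New → ℕ) :=
  F.implement (F.substNet M) (CFNet.parallel fun i => F.threadNet New (F.thread i)).hide

/-- The possible initial markings of the substitution net: the substitution markings that
correspond to `σ₁ ∪ … ∪ σₙ`. -/
def IsInitialMarking [Fintype New] (F : FCPSpec N I) (M : SPlace N New → ℕ) : Prop :=
  ∃ σ : PSub N, σ.IsUnion F.sub ∧ F.Corresponds F.rs σ M

/-! ## Stable markings and the bisimulation relation -/

/-- In every control flow net, a stable place is marked. -/
def IsStableMarking (F : FCPSpec N I) (M : SPlace N New ⊕ (Fin F.n × CState N I) → ℕ) : Prop :=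
  ∀ i, ∃ s : CState N I, s.ctl.IsStable ∧ 0 < M (.inr (i, s))

/-- `s` is derived from an initial thread or from the body of a defining equation, where no
process before `s` is a call. -/
def Derived (New : Type w) (F : FCPSpec N I) (s : CState N I) : Prop :=
  ∃ S, F.IsBody S ∧
    ReflTransGen (fun s s' => ¬ s.ctl.IsCall ∧ F.CNext New s s') ⟨.thread S, []⟩ s

/-- The relation between the states of the transition system of `F` and the reachable stable
markings of its net. -/
def Rel [Fintype New] (F : FCPSpec N I) (M₀ : SPlace N New → ℕ)
    (q : F.ts.State) (M : (F.net M₀).ts.State) : Prop :=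
  F.IsStableMarking M.1 ∧
  ∃ (rs : List N) (S : Fin F.n → Proc N I) (lam : Fin F.n → List N) (σs : Fin F.n → PSub N)
    (σ : PSub N),
    rs.Nodup ∧ (∀ r ∈ rs, r ∉ F.PUB) ∧
    (∀ i, (S i).IsChoice ∨ (S i).IsCall) ∧
    (∀ i, F.Derived New ⟨.thread (S i), lam i⟩) ∧
    (∀ i x, (σs i x).isSome ↔ x ∈ (S i).fn ∨ x ∈ lam i) ∧
    (∀ i, ∀ x ∈ (S i).fn, x ∉ lam i) ∧
    (∀ i x y, σs i x = some y → y ∈ rs ∨ y ∈ F.PUB) ∧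
    q.1 = Quotient.mk _ (.resList rs (.parList (.ofFn fun i => (S i).subst (σs i).app))) ∧
    σ.IsUnion σs ∧
    F.Corresponds rs σ (fun p => M.1 (.inl p)) ∧
    ∀ i, M.1 (.inr (i, ⟨.thread (S i), lam i⟩)) = 1

end Net

end FCPSpec

set_option linter.unusedSectionVars false

namespace Act

variable {N : Type u} [DecidableEq N] [Infinite N]

/-- The action of a substitution on the prefix of `π.S`, where `s` is the set of free names of `S`. -/
noncomputable def substUnder (σ : N → N) (s : Finset N) : Act N → Act N
  | out a b => out (σ a) (σ b)
  | inp a x => inp (σ a) (Proc.avoid x ((s.erase x).image σ))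
  | tau => tau

/-- The substitution to be applied to the continuation `S` of `π.S`. -/
noncomputable def envUnder (σ : N → N) (s : Finset N) : Act N → (N → N)
  | inp _ x => Function.update σ x (Proc.avoid x ((s.erase x).image σ))
  | _ => σ

end Act

namespace Proc

variable {N : Type u} {I : Type v} [DecidableEq N] [Infinite N]

theorem avoid_notMem (x : N) (A : Finset N) : avoid x A ∉ A := by
  unfold avoid
  split_ifs with h
  · exact (Infinite.exists_notMem_finset A).choose_spec
  · exact h

theorem avoid_of_notMem {x : N} {A : Finset N} (h : x ∉ A) : avoid x A = x := by
  simp [avoid, h]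

theorem subst_choice (σ : N → N) {n : ℕ} (act : Fin n → Act N) (cont : Fin n → Proc N I) :
    (choice n act cont).subst σ =
      choice n (fun i => (act i).substUnder σ (cont i).fn)
        (fun i => (cont i).subst ((act i).envUnder σ (cont i).fn)) := by
  rw [subst]
  congr 1

theorem subst_nil (σ : N → N) : (nil : Proc N I).subst σ = nil := by
  unfold nil
  rw [subst_choice]
  congr 1 <;> exact funext fun i => i.elim0

theorem fn_choice {n : ℕ} (act : Fin n → Act N) (cont : Fin n → Proc N I) :
    (choice n act cont).fn = Finset.univ.biUnion fun i => (act i).fnUnder (cont i).fn := rfl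

theorem fn_nil : (nil : Proc N I).fn = ∅ := by
  simp [nil, fn]

theorem image_update_erase {σ : N → N} {s : Finset N} {x z : N}
    (hz : z ∉ (s.erase x).image σ) :
    (s.image (Function.update σ x z)).erase z = (s.erase x).image σ := by
  ext y
  simp only [Finset.mem_erase, Finset.mem_image]
  constructor
  · rintro ⟨hy, w, hw, rfl⟩
    have hwx : w ≠ x := by rintro rfl; simp at hy
    exact ⟨w, ⟨hwx, hw⟩, by simp [hwx]⟩
  · rintro ⟨w, ⟨hwx, hw⟩, rfl⟩
    refine ⟨?_, w, hw, by simp [hwx]⟩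
    rintro rfl
    exact hz (Finset.mem_image.2 ⟨w, Finset.mem_erase.2 ⟨hwx, hw⟩, rfl⟩)

theorem fn_subst (P : Proc N I) : ∀ σ : N → N, (P.subst σ).fn = P.fn.image σ := by
  induction P with
  | call K as => intro σ; ext; simp [subst, fn]
  | choice n act cont ih =>
    intro σ
    rw [subst_choice, fn_choice, fn_choice, Finset.biUnion_image]
    congr 1
    funext i
    rw [ih i]
    cases act i with
    | out a b => simp [Act.fnUnder, Act.substUnder, Act.envUnder, Finset.image_insert]
    | tau => simp [Act.fnUnder, Act.substUnder, Act.envUnder]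
    | inp a x =>
      simp only [Act.fnUnder, Act.substUnder, Act.envUnder, Finset.image_union,
        Finset.image_singleton]
      rw [image_update_erase (avoid_notMem _ _)]
  | res r P ih =>
    intro σ
    simp only [subst, fn]
    rw [ih, image_update_erase (avoid_notMem _ _)]
  | par P Q ihP ihQ => intro σ; simp [subst, fn, ihP, ihQ, Finset.image_union]

theorem image_erase_congr {σ τ : N → N} {s : Finset N} {x : N}
    (h : ∀ y ∈ s.erase x, σ y = τ y) : (s.erase x).image σ = (s.erase x).image τ :=
  Finset.image_congr fun y hy => h y hy

theorem subst_congr (P : Proc N I) : ∀ {σ τ : N → N}, (∀ x ∈ P.fn, σ x = τ x) →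
    P.subst σ = P.subst τ := by
  induction P with
  | call K as =>
    intro σ τ h
    simp only [subst, fn, List.mem_toFinset] at h ⊢
    rw [List.map_congr_left h]
  | choice n act cont ih =>
    intro σ τ h
    rw [subst_choice, subst_choice]
    have h' : ∀ i, ∀ x ∈ (act i).fnUnder (cont i).fn, σ x = τ x := fun i x hx =>
      h x (Finset.mem_biUnion.2 ⟨i, Finset.mem_univ _, hx⟩)
    congr 1
    · funext i
      have := h' i
      revert this
      cases act i with
      | out a b => intro h; simp [Act.fnUnder] at h; simp [Act.substUnder, h]
      | tau => intro h; rfl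
      | inp a x =>
        intro h
        simp only [Act.substUnder]
        rw [h a (by simp [Act.fnUnder]), image_erase_congr fun y hy => h y (by
          simp only [Act.fnUnder, Finset.mem_union]; exact .inr hy)]
    · funext i
      have := h' i
      apply ih
      revert this
      cases act i with
      | out a b => intro h x hx; exact h x (by simp [Act.fnUnder, hx])
      | tau => intro h x hx; exact h x (by simp [Act.fnUnder, hx])
      | inp a x =>
        intro h y hy
        have h2 : ∀ y ∈ (cont i).fn.erase x, σ y = τ y := fun y hy => h y (by
          simp only [Act.fnUnder, Finset.mem_union]; exact .inr hy)
        simp only [Act.envUnder]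
        rw [image_erase_congr h2]
        by_cases hyx : y = x
        · subst hyx; simp
        · simp [hyx, h2 y (Finset.mem_erase.2 ⟨hyx, hy⟩)]
  | res r P ih =>
    intro σ τ h
    simp only [subst]
    rw [image_erase_congr h]
    congr 1
    apply ih
    intro y hy
    by_cases hyx : y = r
    · subst hyx; simp
    · simp [hyx, h y (Finset.mem_erase.2 ⟨hyx, hy⟩)]
  | par P Q ihP ihQ =>
    intro σ τ h
    simp only [subst]
    rw [ihP fun x hx => h x (by simp [fn, hx]), ihQ fun x hx => h x (by simp [fn, hx])]

theorem subst_id (P : Proc N I) : P.subst id = P := by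
  induction P with
  | call K as => simp [subst]
  | choice n act cont ih =>
    rw [subst_choice]
    congr 1
    · funext i
      cases act i <;> simp [Act.substUnder, avoid_of_notMem]
    · funext i
      have : (act i).envUnder id (cont i).fn = id := by
        cases act i <;> simp [Act.envUnder, avoid_of_notMem]
      rw [this, ih]
  | res r P ih =>
    simp only [subst]
    rw [avoid_of_notMem (by simp), show Function.update (id : N → N) r r = id from
      Function.update_eq_self r id, ih]
  | par P Q ihP ihQ => simp [subst, ihP, ihQ]

theorem subst_eq_self {P : Proc N I} {σ : N → N} (h : ∀ x ∈ P.fn, σ x = x) : P.subst σ = P := by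
  conv_rhs => rw [← subst_id P]
  exact subst_congr P h

/-- Equivalence of summands `π.P` and `π'.P'`: congruence of the continuations, up to the name of
the variable bound by `π`. -/
def SumEq (a : Act N) (P : Proc N I) (a' : Act N) (P' : Proc N I) : Prop :=
  (a = a' ∧ Cong P P') ∨
    ∃ c x x', a = .inp c x ∧ a' = .inp c x' ∧ x' ∉ P.fn ∧ Cong (subst₁ x' x P) P'

theorem Cong.choice_sumEq {n : ℕ} {act act' : Fin n → Act N} {cont cont' : Fin n → Proc N I}
    (h : ∀ i, SumEq (act i) (cont i) (act' i) (cont' i)) :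
    Cong (choice n act cont) (choice n act' cont') := by
  classical
  have key : ∀ s : Finset (Fin n), Cong (choice n act cont)
      (choice n (fun i => if i ∈ s then act' i else act i)
        (fun i => if i ∈ s then cont' i else cont i)) := by
    intro s
    induction s using Finset.induction_on with
    | empty => simpa using Cong.refl _
    | insert i s hi ih =>
      refine ih.trans ?_
      rcases h i with ⟨ha, hc⟩ | ⟨c, x, x', ha, ha', hx, hc⟩
      · have : (fun j => if j ∈ insert i s then act' j else act j) =
            fun j => if j ∈ s then act' j else act j := by
          funext j
          by_cases hj : j = i
          · subst hj; simp [hi, ha]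
          · simp [hj]
        rw [this]
        refine .choice_congr fun j => ?_
        by_cases hj : j = i
        · subst hj; simpa [hi] using hc
        · simp only [Finset.mem_insert, hj, false_or]; exact .refl _
      · refine (Cong.alpha_inp (i := i) (a := c) (x := x) (x' := x') (by simp [hi, ha])
          (by simpa [hi] using hx)).trans ?_
        have : (fun j => if j ∈ insert i s then act' j else act j) =
            Function.update (fun j => if j ∈ s then act' j else act j) i (.inp c x') := by
          funext j
          by_cases hj : j = i
          · subst hj; simp [ha']
          · simp [hj]
        rw [this]
        refine .choice_congr fun j => ?_
        by_cases hj : j = i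
        · subst hj; simpa [hi] using hc
        · simp only [Finset.mem_insert, hj, false_or, ne_eq, not_false_eq_true,
            Function.update_of_ne]
          exact .refl _
  simpa using key Finset.univ

theorem image_comp_update_erase {σ τ : N → N} {s : Finset N} {x z : N}
    (hz : z ∉ (s.erase x).image σ) :
    ((s.image (Function.update σ x z)).erase z).image τ = (s.erase x).image (τ ∘ σ) := by
  rw [image_update_erase hz, Finset.image_image]

/-- The composition law for substitutions under a binder `x`, which the first one renames to `z`
and the second one to `w`. -/
theorem subst_update_comp {P : Proc N I} {σ τ : N → N} {x z : N} (w : N)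
    (hz : z ∉ (P.fn.erase x).image σ) :
    P.subst (Function.update τ z w ∘ Function.update σ x z) =
      P.subst (Function.update (τ ∘ σ) x w) := by
  refine subst_congr P fun y hy => ?_
  by_cases hyx : y = x
  · subst hyx; simp
  · have : σ y ≠ z := by
      rintro rfl
      exact hz (Finset.mem_image_of_mem _ (Finset.mem_erase.2 ⟨hyx, hy⟩))
    simp [hyx, this]

/-- `Q` satisfies the composition law for substitutions. -/
def SubstComp (P : Proc N I) : Prop :=
  ∀ σ τ : N → N, Cong ((P.subst σ).subst τ) (P.subst (τ ∘ σ))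

theorem SubstComp.rename {P : Proc N I} (h : SubstComp P) {σ : N → N} {x z w : N}
    (hz : z ∉ (P.fn.erase x).image σ) :
    Cong (subst₁ w z (P.subst (Function.update σ x z))) (P.subst (Function.update σ x w)) := by
  refine (h _ _).trans ?_
  rw [subst_update_comp w hz]
  exact .refl _

theorem notMem_fn_subst_update {P : Proc N I} {σ : N → N} {x z w : N}
    (hw : w ∉ (P.fn.erase x).image σ) (hzw : w ≠ z) :
    w ∉ (P.subst (Function.update σ x z)).fn := by
  rw [fn_subst]
  simp only [Finset.mem_image, not_exists, not_and]
  intro y hy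
  by_cases hyx : y = x
  · subst hyx; simpa using hzw.symm
  · simp only [ne_eq, hyx, not_false_eq_true, Function.update_of_ne]
    rintro rfl
    exact hw (Finset.mem_image_of_mem _ (Finset.mem_erase.2 ⟨hyx, hy⟩))

theorem SubstComp.res {P : Proc N I} (h : SubstComp P) {σ : N → N} {x z w : N}
    (hz : z ∉ (P.fn.erase x).image σ) (hw : w ∉ (P.fn.erase x).image σ) :
    Cong (res z (P.subst (Function.update σ x z))) (res w (P.subst (Function.update σ x w))) := by
  by_cases hzw : w = z
  · subst hzw; exact .refl _
  · exact (Cong.alpha_res (notMem_fn_subst_update hw hzw)).trans (.res_congr (h.rename hz))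

theorem SubstComp.sumEq {P P' : Proc N I} (h : SubstComp P) {σ : N → N} {c x z w : N}
    (hz : z ∉ (P.fn.erase x).image σ) (hw : w ∉ (P.fn.erase x).image σ)
    (hP : Cong (P.subst (Function.update σ x w)) P') :
    SumEq (.inp c z) (P.subst (Function.update σ x z)) (.inp c w) P' := by
  by_cases hzw : w = z
  · subst hzw; exact .inl ⟨rfl, hP⟩
  · exact .inr ⟨c, z, w, rfl, rfl, notMem_fn_subst_update hw hzw, (h.rename hz).trans hP⟩

theorem subst_subst (P : Proc N I) : SubstComp P := by
  induction P with
  | call K as => intro σ τ; simpa [subst] using Cong.refl _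
  | choice n act cont ih =>
    intro σ τ
    rw [subst_choice, subst_choice, subst_choice]
    refine (Cong.choice_congr fun i => ih i _ _).trans (.choice_sumEq fun i => ?_)
    cases act i with
    | out a b => exact .inl ⟨rfl, .refl _⟩
    | tau => exact .inl ⟨rfl, .refl _⟩
    | inp a x =>
      simp only [Act.substUnder, Act.envUnder]
      have hz : avoid x (((cont i).fn.erase x).image σ) ∉ ((cont i).fn.erase x).image σ :=
        avoid_notMem _ _
      rw [fn_subst, image_comp_update_erase hz, subst_update_comp _ hz]
      exact (ih i).sumEq (avoid_notMem _ _) (avoid_notMem x _) (.refl _)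
  | res r P ih =>
    intro σ τ
    simp only [subst]
    set z := avoid r ((P.fn.erase r).image σ) with hz
    have hz' : z ∉ (P.fn.erase r).image σ := avoid_notMem _ _
    rw [fn_subst, image_comp_update_erase hz']
    refine (Cong.res_congr (ih _ _)).trans ?_
    rw [subst_update_comp _ hz']
    exact ih.res (avoid_notMem _ _) (avoid_notMem _ _)
  | par P Q ihP ihQ => intro σ τ; exact .par_congr (ihP _ _) (ihQ _ _)

theorem fn_subst_comp_erase (P : Proc N I) {σ : N → N} {x z : N}
    (hz : z ∉ (P.fn.erase x).image σ) :
    (P.subst (Function.update σ x z)).fn.erase z = (P.fn.erase x).image σ := by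
  rw [fn_subst, image_update_erase hz]

theorem fn_subst₁_erase {P : Proc N I} {x x' : N} (h : x' ∉ P.fn) :
    (subst₁ x' x P).fn.erase x' = P.fn.erase x := by
  rw [subst₁, fn_subst_comp_erase P (by simpa using fun _ => h), Finset.image_id]

theorem Cong.fn_eq {P Q : Proc N I} (h : Cong P Q) : P.fn = Q.fn := by
  induction h with
  | refl => rfl
  | symm _ ih => exact ih.symm
  | trans _ _ ih₁ ih₂ => exact ih₁.trans ih₂
  | choice_congr _ ih => simp only [fn_choice, ih]
  | res_congr _ ih => simp only [fn, ih]
  | par_congr _ _ ih₁ ih₂ => simp only [fn, ih₁, ih₂]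
  | alpha_res h => simp only [fn, fn_subst₁_erase h]
  | @alpha_inp n act cont i a x x' ha hx =>
    rw [fn_choice, fn_choice]
    congr 1
    funext j
    by_cases hj : j = i
    · subst hj
      simp [ha, Act.fnUnder, fn_subst₁_erase hx]
    · simp [hj]
  | @choice_perm n act cont e =>
    ext y
    simp only [fn_choice, Finset.mem_biUnion, Finset.mem_univ, true_and, Function.comp]
    exact (e.surjective.exists (p := fun i => y ∈ (act i).fnUnder (cont i).fn))
  | par_comm => simp only [fn, Finset.union_comm]
  | par_assoc => simp only [fn, Finset.union_assoc]
  | par_nil => simp [fn, fn_nil]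
  | res_nil => simp [fn, fn_nil]
  | res_comm => simp only [fn]; exact Finset.erase_right_comm
  | res_par h => simp only [fn]; rw [Finset.erase_union_distrib, Finset.erase_eq_of_notMem h]

/-- Instead of the name provided by `subst`, any fresh name may be used for a restricted name. -/
theorem subst_res (P : Proc N I) {σ : N → N} {r z : N} (hz : z ∉ (P.fn.erase r).image σ) :
    Cong ((res r P).subst σ) (res z (P.subst (Function.update σ r z))) := by
  simp only [subst]
  exact (subst_subst P).res (avoid_notMem _ _) hz

theorem subst_subst₁ {P : Proc N I} {x x' : N} (h : x' ∉ P.fn) (σ : N → N) (z : N) :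
    Cong ((subst₁ x' x P).subst (Function.update σ x' z)) (P.subst (Function.update σ x z)) := by
  refine (subst_subst P _ _).trans ?_
  rw [subst_update_comp (σ := id) z (by simpa using fun _ => h)]
  exact .refl _

theorem Cong.subst {P Q : Proc N I} (h : Cong P Q) :
    ∀ σ : N → N, Cong (P.subst σ) (Q.subst σ) := by
  induction h with
  | refl => exact fun _ => .refl _
  | symm _ ih => exact fun σ => (ih σ).symm
  | trans _ _ ih₁ ih₂ => exact fun σ => (ih₁ σ).trans (ih₂ σ)
  | @choice_congr n act cont cont' hc ih =>
    intro σ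
    rw [subst_choice, subst_choice]
    simp only [(hc _).fn_eq]
    exact .choice_congr fun i => ih i _
  | @res_congr r P P' hc ih =>
    intro σ
    simp only [Proc.subst, hc.fn_eq]
    exact .res_congr (ih _)
  | par_congr _ _ ih₁ ih₂ => exact fun σ => .par_congr (ih₁ σ) (ih₂ σ)
  | @alpha_res r r' P h =>
    intro σ
    have hz := avoid_notMem r ((P.fn.erase r).image σ)
    refine (subst_res P hz).trans (Cong.symm ((subst_res _ ?_).trans
      (.res_congr (subst_subst₁ h σ _))))
    rwa [fn_subst₁_erase h]
  | @alpha_inp n act cont i a x x' ha hx =>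
    intro σ
    rw [subst_choice, subst_choice]
    refine .choice_sumEq fun j => ?_
    by_cases hj : j = i
    · subst hj
      simp only [ha, Function.update_self, Act.substUnder, Act.envUnder, fn_subst₁_erase hx]
      exact (subst_subst _).sumEq (avoid_notMem _ _) (avoid_notMem _ _) (subst_subst₁ hx _ _).symm
    · simp only [ne_eq, hj, not_false_eq_true, Function.update_of_ne]
      exact .inl ⟨rfl, .refl _⟩
  | choice_perm e =>
    intro σ
    rw [subst_choice, subst_choice]
    exact .choice_perm e
  | par_comm => exact fun _ => .par_comm _ _
  | par_assoc => exact fun _ => .par_assoc _ _ _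
  | par_nil =>
    intro σ
    simp only [Proc.subst, subst_nil]
    exact .par_nil _
  | res_nil r =>
    intro σ
    simp only [Proc.subst, subst_nil]
    exact .res_nil _
  | res_comm r r' P =>
    intro σ
    by_cases hr : r = r'
    · subst hr; exact .refl _
    obtain ⟨z, hz⟩ := Infinite.exists_notMem_finset (P.fn.image σ)
    obtain ⟨z', hz'⟩ := Infinite.exists_notMem_finset (insert z (P.fn.image σ))
    have key : ∀ {r r' z z' : N}, r ≠ r' → z ∉ P.fn.image σ → z' ∉ insert z (P.fn.image σ) →
        Cong ((res r (res r' P)).subst σ)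
          (res z (res z' (P.subst (Function.update (Function.update σ r z) r' z')))) := by
      intro r r' z z' hr hz hz'
      refine (subst_res _ fun h => hz ?_).trans (.res_congr (subst_res _ fun h => hz' ?_))
      · exact Finset.image_subset_image
          ((Finset.erase_subset _ _).trans (Finset.erase_subset _ _)) h
      · obtain ⟨y, hy, rfl⟩ := Finset.mem_image.1 h
        by_cases hyr : y = r
        · subst hyr; simp
        · simp only [ne_eq, hyr, not_false_eq_true, Function.update_of_ne]
          exact Finset.mem_insert_of_mem (Finset.mem_image_of_mem _ (Finset.mem_of_mem_erase hy))
    simp only [Finset.mem_insert, not_or] at hz'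
    refine (key hr hz (z' := z') (by simpa using hz')).trans ((Cong.res_comm _ _ _).trans ?_)
    rw [Function.update_comm hr]
    exact (key (Ne.symm hr) hz'.2 (by simpa [hz] using Ne.symm hz'.1)).symm
  | @res_par r P Q h =>
    intro σ
    obtain ⟨z, hz⟩ := Infinite.exists_notMem_finset ((P.fn ∪ Q.fn).image σ)
    rw [Finset.image_union, Finset.mem_union, not_or] at hz
    have hQ : z ∉ (Q.fn.erase r).image σ := fun h => hz.2
      (Finset.image_subset_image (Finset.erase_subset _ _) h)
    have hPQ : z ∉ ((par P Q).fn.erase r).image σ := fun h' => by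
      have := Finset.image_subset_image (Finset.erase_subset _ _) h'
      simp only [fn, Finset.image_union, Finset.mem_union] at this
      tauto
    refine (subst_res _ hPQ).trans ?_
    refine Cong.trans ?_ (Cong.par_congr (.refl _) (subst_res Q hQ)).symm
    have : P.subst (Function.update σ r z) = P.subst σ := subst_congr P fun y hy => by
      rw [Function.update_of_ne]; rintro rfl; exact h hy
    simp only [Proc.subst]
    rw [this]
    exact .res_par (by rw [fn_subst]; exact hz.1)

end Proc

namespace Proc

variable {N : Type u} {I : Type v} [DecidableEq N] [Infinite N]

/-- Processes up to structural congruence. -/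
abbrev Cls (N : Type u) (I : Type v) [DecidableEq N] [Infinite N] := Quotient (congSetoid N I)

/-- The class of a process. -/
def cls (P : Proc N I) : Cls N I := Quotient.mk _ P

theorem cls_eq_iff {P Q : Proc N I} : cls P = cls Q ↔ Cong P Q := Quotient.eq

theorem Cong.cls_eq {P Q : Proc N I} (h : Cong P Q) : cls P = cls Q := cls_eq_iff.2 h

namespace Cls

instance : Add (Cls N I) :=
  ⟨Quotient.map₂ par fun _ _ h _ _ h' => Cong.par_congr h h'⟩

instance : Zero (Cls N I) := ⟨cls nil⟩

theorem cls_par (P Q : Proc N I) : cls (par P Q) = cls P + cls Q := rfl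

theorem cls_nil : cls (nil : Proc N I) = 0 := rfl

instance : AddCommMonoid (Cls N I) where
  add_assoc := by
    rintro ⟨P⟩ ⟨Q⟩ ⟨R⟩
    exact (Cong.par_assoc P Q R).cls_eq
  zero_add := by
    rintro ⟨P⟩
    exact ((Cong.par_comm _ _).trans (Cong.par_nil P)).cls_eq
  add_zero := by
    rintro ⟨P⟩
    exact (Cong.par_nil P).cls_eq
  add_comm := by
    rintro ⟨P⟩ ⟨Q⟩
    exact (Cong.par_comm P Q).cls_eq
  nsmul := nsmulRec

/-- The free names of a class. -/
def fn : Cls N I → Finset N := Quotient.lift Proc.fn fun _ _ h => Cong.fn_eq h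

theorem fn_cls (P : Proc N I) : fn (cls P) = P.fn := rfl

theorem fn_add (p q : Cls N I) : fn (p + q) = fn p ∪ fn q := by
  obtain ⟨P⟩ := p; obtain ⟨Q⟩ := q; rfl

theorem fn_zero : fn (0 : Cls N I) = ∅ := fn_nil

theorem fn_sum {ι : Type*} (s : Finset ι) (f : ι → Cls N I) :
    fn (∑ i ∈ s, f i) = s.biUnion fun i => fn (f i) := by
  classical
  induction s using Finset.induction_on with
  | empty => simp [fn_zero]
  | insert i s hi ih => rw [Finset.sum_insert hi, fn_add, ih, Finset.biUnion_insert]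

/-- Restriction. -/
def res (r : N) : Cls N I → Cls N I := Quotient.map (Proc.res r) fun _ _ h => Cong.res_congr h

theorem cls_res (r : N) (P : Proc N I) : cls (Proc.res r P) = res r (cls P) := rfl

theorem fn_res (r : N) (q : Cls N I) : fn (res r q) = (fn q).erase r := by
  obtain ⟨Q⟩ := q; rfl

theorem res_comm (r r' : N) (q : Cls N I) : res r (res r' q) = res r' (res r q) := by
  obtain ⟨Q⟩ := q; exact (Cong.res_comm r r' Q).cls_eq

theorem res_add {r : N} {p : Cls N I} (h : r ∉ fn p) (q : Cls N I) :
    res r (p + q) = p + res r q := by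
  obtain ⟨P⟩ := p; obtain ⟨Q⟩ := q; exact (Cong.res_par h).cls_eq

theorem res_zero (r : N) : res r (0 : Cls N I) = 0 := (Cong.res_nil r).cls_eq

theorem res_of_notMem {r : N} {q : Cls N I} (h : r ∉ fn q) : res r q = q := by
  conv_lhs => rw [← add_zero q, res_add h, res_zero, add_zero]

instance : LeftCommutative (res : N → Cls N I → Cls N I) := ⟨res_comm⟩

/-- Restriction of a finite set of names. -/
noncomputable def nu (A : Finset N) (q : Cls N I) : Cls N I := A.toList.foldr res q

theorem nu_empty (q : Cls N I) : nu ∅ q = q := by simp [nu]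

theorem nu_insert {r : N} {A : Finset N} (h : r ∉ A) (q : Cls N I) :
    nu (insert r A) q = res r (nu A q) := by
  unfold nu
  rw [(Finset.toList_insert h).foldr_eq]
  rfl

theorem fn_nu (A : Finset N) (q : Cls N I) : fn (nu A q) = fn q \ A := by
  induction A using Finset.induction_on with
  | empty => simp [nu_empty]
  | insert r A h ih => rw [nu_insert h, fn_res, ih, Finset.sdiff_insert]

theorem nu_add {A : Finset N} {p : Cls N I} (h : Disjoint A (fn p)) (q : Cls N I) :
    nu A (p + q) = p + nu A q := by
  induction A using Finset.induction_on with
  | empty => simp [nu_empty]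
  | insert r A hr ih =>
    rw [Finset.disjoint_insert_left] at h
    rw [nu_insert hr, ih h.2, res_add h.1, nu_insert hr]

theorem nu_union {A B : Finset N} (h : Disjoint A B) (q : Cls N I) :
    nu (A ∪ B) q = nu A (nu B q) := by
  induction A using Finset.induction_on with
  | empty => simp [nu_empty]
  | insert r A hr ih =>
    rw [Finset.disjoint_insert_left] at h
    rw [Finset.insert_union, nu_insert (by simp [hr, h.1]), ih h.2, nu_insert hr]

theorem nu_zero (A : Finset N) : nu A (0 : Cls N I) = 0 := by
  induction A using Finset.induction_on with
  | empty => simp [nu_empty]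
  | insert r A hr ih => rw [nu_insert hr, ih, res_zero]

theorem nu_of_disjoint {A : Finset N} {q : Cls N I} (h : Disjoint A (fn q)) : nu A q = q := by
  conv_lhs => rw [← add_zero q, nu_add h, nu_zero, add_zero]

theorem nu_inter (A : Finset N) (q : Cls N I) : nu (A ∩ fn q) q = nu A q := by
  conv_rhs => rw [← Finset.sdiff_union_inter A (fn q), Finset.union_comm,
    nu_union (Finset.disjoint_sdiff_inter A (fn q)).symm, nu_of_disjoint Finset.sdiff_disjoint]

theorem cls_resList {l : List N} (hl : l.Nodup) (P : Proc N I) :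
    cls (resList l P) = nu l.toFinset (cls P) := by
  induction l with
  | nil => simp [resList, nu_empty]
  | cons r l ih =>
    rw [List.nodup_cons] at hl
    rw [List.toFinset_cons, nu_insert (by simpa using hl.1), ← ih hl.2]
    rfl

theorem cls_parList (l : List (Proc N I)) : cls (parList l) = (l.map cls).sum := by
  induction l with
  | nil => rfl
  | cons P l ih =>
    cases l with
    | nil => simp [parList]
    | cons Q l => rw [parList, cls_par, ih, List.map_cons, List.map_cons, List.sum_cons]; rfl

theorem cls_parList_ofFn {n : ℕ} (f : Fin n → Proc N I) :
    cls (parList (List.ofFn f)) = ∑ i, cls (f i) := by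
  rw [cls_parList, List.map_ofFn, List.sum_ofFn]; rfl

/-- The reaction relation on classes. -/
def React (params : I → List N) (body : I → Proc N I) (q q' : Cls N I) : Prop :=
  ∃ P P', q = cls P ∧ q' = cls P' ∧ Proc.React params body P P'

variable {params : I → List N} {body : I → Proc N I}

theorem react_cls {P P' : Proc N I} :
    React params body (cls P) (cls P') ↔ Proc.React params body P P' := by
  refine ⟨?_, fun h => ⟨P, P', rfl, rfl, h⟩⟩
  rintro ⟨Q, Q', h, h', hr⟩
  exact .struct (cls_eq_iff.1 h) hr (cls_eq_iff.1 h'.symm)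

theorem React.add_right {q q' : Cls N I} (h : React params body q q') (p : Cls N I) :
    React params body (q + p) (q' + p) := by
  obtain ⟨Q, Q', rfl, rfl, h⟩ := h
  obtain ⟨P⟩ := p
  exact ⟨_, _, rfl, rfl, .par h⟩

theorem React.res {q q' : Cls N I} (h : React params body q q') (r : N) :
    React params body (res r q) (res r q') := by
  obtain ⟨Q, Q', rfl, rfl, h⟩ := h
  exact ⟨_, _, rfl, rfl, .res h⟩

theorem React.nu {q q' : Cls N I} (h : React params body q q') (A : Finset N) :
    React params body (nu A q) (nu A q') := by
  induction A using Finset.induction_on with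
  | empty => simpa [nu_empty] using h
  | insert r A hr ih => rw [nu_insert hr, nu_insert hr]; exact ih.res r

end Cls

end Proc

namespace Proc

variable {N : Type u} {I : Type v} [DecidableEq N] [Infinite N]

/-- Summands up to structural congruence. An input is a function of the received name. -/
inductive Summand (N : Type u) (I : Type v) [DecidableEq N] [Infinite N] where
  | tau (q : Cls N I)
  | out (a b : N) (q : Cls N I)
  | inp (a : N) (f : N → Cls N I)

/-- Threads that are calls or nonempty choices, up to structural congruence. -/
structure Thread (N : Type u) (I : Type v) [DecidableEq N] [Infinite N] where
  toCls : Cls N I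
  head : (I × List N) ⊕ Multiset (Summand N I)

/-- The summand `π.P` in the environment `ρ`. -/
noncomputable def summand (ρ : N → N) (P : Proc N I) : Act N → Summand N I
  | .tau => .tau (cls (P.subst ρ))
  | .out a b => .out (ρ a) (ρ b) (cls (P.subst ρ))
  | .inp a x => .inp (ρ a) fun z => cls (P.subst (Function.update ρ x z))

noncomputable def callThread (ρ : N → N) (K : I) (as : List N) : Thread N I :=
  ⟨cls ((call K as).subst ρ), .inl (K, as.map ρ)⟩

noncomputable def choiceThread (ρ : N → N) {n : ℕ} (act : Fin n → Act N)
    (cont : Fin n → Proc N I) : Thread N I :=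
  ⟨cls ((choice n act cont).subst ρ),
    .inr (Finset.univ.val.map fun i => summand ρ (cont i) (act i))⟩

/-- `Unfolds P ρ A T`: in the environment `ρ`, the process `P` is the parallel composition of the
threads `T`, where `A` are the restricted names that are used. -/
def Unfolds : Proc N I → (N → N) → Finset N → Multiset (Thread N I) → Prop
  | call K as, ρ, A, T => A = ∅ ∧ T = {callThread ρ K as}
  | choice n act cont, ρ, A, T => A = ∅ ∧ T = if n = 0 then 0 else {choiceThread ρ act cont}
  | res r P, ρ, A, T =>
      if r ∈ P.fn then
        ∃ z ∉ (P.fn.erase r).image ρ, ∃ A', A = insert z A' ∧ z ∉ A' ∧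
          Unfolds P (Function.update ρ r z) A' T
      else Unfolds P ρ A T
  | par P Q, ρ, A, T => ∃ A₁ A₂ T₁ T₂, A = A₁ ∪ A₂ ∧ T = T₁ + T₂ ∧ Disjoint A₁ A₂ ∧
      Disjoint A₁ (Q.fn.image ρ) ∧ Disjoint A₂ (P.fn.image ρ) ∧
      Unfolds P ρ A₁ T₁ ∧ Unfolds Q ρ A₂ T₂

theorem summand_congr {ρ ρ' : N → N} {P : Proc N I} {a : Act N}
    (h : ∀ x ∈ a.fnUnder P.fn, ρ x = ρ' x) : summand ρ P a = summand ρ' P a := by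
  cases a with
  | tau => simp only [summand]; rw [subst_congr P h]
  | out a b =>
    simp only [summand]
    rw [subst_congr P fun x hx => h x (by simp [Act.fnUnder, hx]), h a (by simp [Act.fnUnder]),
      h b (by simp [Act.fnUnder])]
  | inp a x =>
    simp only [summand]
    rw [h a (by simp [Act.fnUnder])]
    congr 1
    funext z
    rw [subst_congr P fun y hy => ?_]
    by_cases hyx : y = x
    · subst hyx; simp
    · simp [hyx, h y (by simp [Act.fnUnder, hyx, hy])]

theorem choiceThread_congr {ρ ρ' : N → N} {n : ℕ} {act : Fin n → Act N} {cont : Fin n → Proc N I}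
    (h : ∀ x ∈ (choice n act cont).fn, ρ x = ρ' x) :
    choiceThread ρ act cont = choiceThread ρ' act cont := by
  unfold choiceThread
  rw [subst_congr _ h]
  congr 2
  refine Multiset.map_congr rfl fun i _ => summand_congr fun x hx => h x ?_
  exact Finset.mem_biUnion.2 ⟨i, Finset.mem_univ _, hx⟩

theorem update_congr {ρ ρ' : N → N} {s : Finset N} {r : N} (h : ∀ x ∈ s.erase r, ρ x = ρ' x)
    (z : N) : ∀ x ∈ s, Function.update ρ r z x = Function.update ρ' r z x := by
  intro x hx
  by_cases hxr : x = r
  · subst hxr; simp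
  · simp [hxr, h x (Finset.mem_erase.2 ⟨hxr, hx⟩)]

theorem unfolds_congr (P : Proc N I) : ∀ {ρ ρ' : N → N}, (∀ x ∈ P.fn, ρ x = ρ' x) →
    ∀ {A T}, Unfolds P ρ A T ↔ Unfolds P ρ' A T := by
  induction P with
  | call K as =>
    intro ρ ρ' h A T
    simp only [Unfolds, callThread]
    rw [subst_congr _ h, List.map_congr_left fun x hx => h x (by simpa [fn] using hx)]
  | choice n act cont _ => intro ρ ρ' h A T; simp only [Unfolds]; rw [choiceThread_congr h]
  | res r P ih =>
    intro ρ ρ' h A T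
    simp only [Unfolds]
    split_ifs with hr
    · rw [image_erase_congr h]
      simp only [ih (update_congr h _)]
    · exact ih fun x hx => h x (by simp only [fn]; rwa [Finset.erase_eq_of_notMem hr])
  | par P Q ihP ihQ =>
    intro ρ ρ' h A T
    have hP : ∀ x ∈ P.fn, ρ x = ρ' x := fun x hx => h x (by simp [fn, hx])
    have hQ : ∀ x ∈ Q.fn, ρ x = ρ' x := fun x hx => h x (by simp [fn, hx])
    simp only [Unfolds, ihP hP, ihQ hQ, Finset.image_congr hP, Finset.image_congr hQ]

theorem summand_subst (σ ρ : N → N) (P : Proc N I) (a : Act N) :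
    summand ρ (P.subst (a.envUnder σ P.fn)) (a.substUnder σ P.fn) = summand (ρ ∘ σ) P a := by
  cases a with
  | tau => simp only [summand, Act.substUnder, Act.envUnder, (subst_subst P _ _).cls_eq]
  | out a b =>
    simp only [summand, Act.substUnder, Act.envUnder, (subst_subst P _ _).cls_eq, Function.comp]
  | inp a x =>
    simp only [summand, Act.substUnder, Act.envUnder, (subst_subst P _ _).cls_eq,
      subst_update_comp _ (avoid_notMem _ _), Function.comp]

theorem choiceThread_subst (σ ρ : N → N) {n : ℕ} (act : Fin n → Act N) (cont : Fin n → Proc N I) :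
    choiceThread ρ (fun i => (act i).substUnder σ (cont i).fn)
        (fun i => (cont i).subst ((act i).envUnder σ (cont i).fn)) =
      choiceThread (ρ ∘ σ) act cont := by
  unfold choiceThread
  simp only [summand_subst]
  rw [← subst_choice, (subst_subst _ _ _).cls_eq]

theorem mem_fn_subst_update {P : Proc N I} {σ : N → N} {r z : N}
    (hz : z ∉ (P.fn.erase r).image σ) : z ∈ (P.subst (Function.update σ r z)).fn ↔ r ∈ P.fn := by
  rw [fn_subst, Finset.mem_image]
  constructor
  · rintro ⟨y, hy, hyz⟩
    by_cases hyr : y = r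
    · rwa [← hyr]
    · simp only [ne_eq, hyr, not_false_eq_true, Function.update_of_ne] at hyz
      exact absurd (Finset.mem_image.2 ⟨y, Finset.mem_erase.2 ⟨hyr, hy⟩, hyz⟩) hz
  · exact fun h => ⟨r, h, by simp⟩

theorem unfolds_subst (P : Proc N I) : ∀ {σ ρ : N → N} {A T},
    Unfolds (P.subst σ) ρ A T ↔ Unfolds P (ρ ∘ σ) A T := by
  induction P with
  | call K as =>
    intro σ ρ A T
    simp only [Unfolds, callThread, subst, List.map_map]
  | choice n act cont _ =>
    intro σ ρ A T
    rw [subst_choice]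
    simp only [Unfolds, choiceThread_subst]
  | res r P ih =>
    intro σ ρ A T
    have hz : avoid r ((P.fn.erase r).image σ) ∉ (P.fn.erase r).image σ := avoid_notMem _ _
    simp only [subst, Unfolds]
    simp only [mem_fn_subst_update hz, ih, fn_subst_comp_erase P hz, Finset.image_image]
    split_ifs with hr
    · refine exists_congr fun w => and_congr_right fun hw => exists_congr fun A' =>
        and_congr_right fun _ => and_congr_right fun _ => unfolds_congr P fun y hy => ?_
      by_cases hyr : y = r
      · subst hyr; simp
      · have : σ y ≠ avoid r ((P.fn.erase r).image σ) := fun h => hz (h ▸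
          Finset.mem_image_of_mem _ (Finset.mem_erase.2 ⟨hyr, hy⟩))
        simp [hyr, this]
    · refine unfolds_congr P fun y hy => ?_
      have : y ≠ r := by rintro rfl; exact hr hy
      simp [this]
  | par P Q ihP ihQ =>
    intro σ ρ A T
    simp only [subst, Unfolds, ihP, ihQ, fn_subst, Finset.image_image]

theorem unfolds_update_of_notMem {P : Proc N I} {r : N} (h : r ∉ P.fn) {ρ : N → N} {z : N}
    {A : Finset N} {T : Multiset (Thread N I)} :
    Unfolds P (Function.update ρ r z) A T ↔ Unfolds P ρ A T :=
  unfolds_congr P fun y hy => Function.update_of_ne (by rintro rfl; exact h hy) _ _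

theorem unfolds_nil {ρ : N → N} {A : Finset N} {T : Multiset (Thread N I)} :
    Unfolds nil ρ A T ↔ A = ∅ ∧ T = 0 := by
  simp [nil, Unfolds]

theorem Unfolds.res_comm {P : Proc N I} {r r' : N} (hr : r ≠ r') {ρ : N → N} {A : Finset N}
    {T : Multiset (Thread N I)} (h : Unfolds (res r (res r' P)) ρ A T) :
    Unfolds (res r' (res r P)) ρ A T := by
  simp only [Unfolds, fn, Finset.mem_erase, hr, hr.symm, ne_eq, not_false_eq_true, true_and]
    at h ⊢
  by_cases h1 : r ∈ P.fn <;> by_cases h2 : r' ∈ P.fn <;> simp only [h1, h2, if_true, if_false] at h ⊢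
  · obtain ⟨z, hz, A', rfl, hzA, z', hz', A'', rfl, hzA', h⟩ := h
    have hzz : z' ≠ z := by
      rintro rfl
      exact hz' (Finset.mem_image.2 ⟨r, Finset.mem_erase.2 ⟨hr, h1⟩, by simp⟩)
    rw [Finset.mem_insert, not_or] at hzA
    refine ⟨z', fun hm => hz' ?_, insert z A'', Finset.insert_comm _ _ _,
      by simp [hzz, hzA'], z, fun hm => ?_, A'', rfl, hzA.2, ?_⟩
    · obtain ⟨y, hy, rfl⟩ := Finset.mem_image.1 hm
      simp only [Finset.mem_erase] at hy
      exact Finset.mem_image.2 ⟨y, by simp [hy], by simp [hy]⟩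
    · obtain ⟨y, hy, hyz⟩ := Finset.mem_image.1 hm
      simp only [Finset.mem_erase] at hy
      by_cases hyr : y = r'
      · subst hyr; exact hzz (by simpa using hyz)
      · rw [Function.update_of_ne hyr] at hyz
        exact hz (Finset.mem_image.2 ⟨y, by simp [hy, hyr], hyz⟩)
    · rwa [Function.update_comm hr.symm]
  · obtain ⟨z, hz, A', rfl, hzA, h⟩ := h
    exact ⟨z, by rwa [Finset.erase_eq_of_notMem h2] at hz, A', rfl, hzA, h⟩
  · obtain ⟨z, hz, A', rfl, hzA, h⟩ := h
    exact ⟨z, by rwa [Finset.erase_eq_of_notMem h1], A', rfl, hzA, h⟩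
  · exact h

theorem disjoint_image_update {s A : Finset N} {ρ : N → N} {r z : N} (hr : r ∈ s) :
    Disjoint A (s.image (Function.update ρ r z)) ↔ z ∉ A ∧ Disjoint A ((s.erase r).image ρ) := by
  have : s.image (Function.update ρ r z) = insert z ((s.erase r).image ρ) := by
    conv_lhs => rw [← Finset.insert_erase hr, Finset.image_insert, Function.update_self]
    congr 1
    exact Finset.image_congr fun y hy => Function.update_of_ne (Finset.ne_of_mem_erase hy) _ _
  rw [this, Finset.disjoint_insert_right]

theorem unfolds_res_par {P Q : Proc N I} {r : N} (hr : r ∉ P.fn) {ρ : N → N} {A : Finset N}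
    {T : Multiset (Thread N I)} :
    Unfolds (res r (par P Q)) ρ A T ↔ Unfolds (par P (res r Q)) ρ A T := by
  have hP : ∀ z, P.fn.image (Function.update ρ r z) = P.fn.image ρ := fun z =>
    Finset.image_congr fun y hy => Function.update_of_ne (by rintro rfl; exact hr hy) _ _
  simp only [Unfolds, fn, Finset.mem_union, hr, false_or, Finset.erase_union_distrib,
    unfolds_update_of_notMem hr, hP, Finset.erase_eq_of_notMem hr]
  split_ifs with hQ
  · constructor
    · rintro ⟨z, hz, A', rfl, hzA, A₁, A₂, T₁, T₂, rfl, rfl, hA, h1, h2, h3, h4⟩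
      simp only [Finset.image_union, Finset.mem_union, not_or] at hz hzA
      rw [disjoint_image_update hQ] at h1
      refine ⟨A₁, insert z A₂, T₁, T₂, by rw [Finset.union_insert], rfl, ?_, h1.2, ?_, h3,
        z, hz.2, A₂, rfl, hzA.2, h4⟩
      · exact Finset.disjoint_insert_right.2 ⟨hzA.1, hA⟩
      · exact Finset.disjoint_insert_left.2 ⟨hz.1, h2⟩
    · rintro ⟨A₁, A₂, T₁, T₂, rfl, rfl, hA, h1, h2, h3, z, hz, A', rfl, hzA, h4⟩
      rw [Finset.disjoint_insert_right] at hA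
      rw [Finset.disjoint_insert_left] at h2
      refine ⟨z, ?_, A₁ ∪ A', by rw [Finset.union_insert], ?_, A₁, A', T₁, T₂, rfl, rfl, hA.2,
        (disjoint_image_update hQ).2 ⟨hA.1, h1⟩, h2.2, h3, h4⟩
      · rw [Finset.image_union, Finset.mem_union, not_or]; exact ⟨h2.1, hz⟩
      · rw [Finset.mem_union, not_or]; exact ⟨hA.1, hzA⟩
  · rw [Finset.erase_eq_of_notMem hQ]

theorem Unfolds.par_comm {P Q : Proc N I} {ρ : N → N} {A : Finset N} {T : Multiset (Thread N I)}
    (h : Unfolds (par P Q) ρ A T) : Unfolds (par Q P) ρ A T := by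
  obtain ⟨A₁, A₂, T₁, T₂, rfl, rfl, hA, h1, h2, h3, h4⟩ := h
  exact ⟨A₂, A₁, T₂, T₁, Finset.union_comm _ _, add_comm _ _, hA.symm, h2, h1, h4, h3⟩

theorem unfolds_par_assoc {P Q R : Proc N I} {ρ : N → N} {A : Finset N}
    {T : Multiset (Thread N I)} :
    Unfolds (par (par P Q) R) ρ A T ↔ Unfolds (par P (par Q R)) ρ A T := by
  simp only [Unfolds, fn, Finset.image_union, Finset.disjoint_union_right]
  constructor
  · rintro ⟨A', A₃, T', T₃, rfl, rfl, hA, h1, h2, ⟨A₁, A₂, T₁, T₂, rfl, rfl, hA', h3, h4, h5, h6⟩, h7⟩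
    simp only [Finset.disjoint_union_left] at *
    exact ⟨A₁, A₂ ∪ A₃, T₁, T₂ + T₃, Finset.union_assoc _ _ _, add_assoc _ _ _,
      by simp only [Finset.disjoint_union_right]; tauto, by tauto,
      by simp only [Finset.disjoint_union_left]; tauto, h5,
      A₂, A₃, T₂, T₃, rfl, rfl, by tauto, by tauto, by tauto, h6, h7⟩
  · rintro ⟨A₁, A', T₁, T', rfl, rfl, hA, h1, h2, h5, ⟨A₂, A₃, T₂, T₃, rfl, rfl, hA', h3, h4, h6, h7⟩⟩
    simp only [Finset.disjoint_union_left, Finset.disjoint_union_right] at *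
    exact ⟨A₁ ∪ A₂, A₃, T₁ + T₂, T₃, (Finset.union_assoc _ _ _).symm, (add_assoc _ _ _).symm,
      by simp only [Finset.disjoint_union_left]; tauto,
      by simp only [Finset.disjoint_union_left]; tauto, by tauto,
      ⟨A₁, A₂, T₁, T₂, rfl, rfl, by tauto, by tauto, by tauto, h5, h6⟩, h7⟩

theorem choiceThread_alpha {n : ℕ} {act : Fin n → Act N} {cont : Fin n → Proc N I} {i : Fin n}
    {a x x' : N} (ha : act i = .inp a x) (hx : x' ∉ (cont i).fn) (ρ : N → N) :
    choiceThread ρ act cont = choiceThread ρ (Function.update act i (.inp a x'))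
      (Function.update cont i (subst₁ x' x (cont i))) := by
  unfold choiceThread
  rw [((Cong.alpha_inp ha hx).subst ρ).cls_eq]
  congr 2
  refine Multiset.map_congr rfl fun j _ => ?_
  by_cases hj : j = i
  · subst hj
    simp only [ha, Function.update_self, summand, (subst_subst₁ hx _ _).cls_eq]
  · simp [hj]

theorem Cong.unfolds_iff {P Q : Proc N I} (h : Cong P Q) :
    ∀ {ρ A T}, Unfolds P ρ A T ↔ Unfolds Q ρ A T := by
  induction h with
  | refl => exact Iff.rfl
  | symm _ ih => exact ih.symm
  | trans _ _ ih₁ ih₂ => exact ih₁.trans ih₂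
  | @choice_congr n act cont cont' hc ih =>
    intro ρ A T
    have : choiceThread ρ act cont = choiceThread ρ act cont' := by
      unfold choiceThread
      rw [((Cong.choice_congr hc).subst ρ).cls_eq]
      congr 2
      refine Multiset.map_congr rfl fun j _ => ?_
      cases act j <;> simp only [summand, ((hc j).subst _).cls_eq]
    simp only [Unfolds, this]
  | res_congr hc ih => intro ρ A T; simp only [Unfolds, hc.fn_eq, ih]
  | par_congr h₁ h₂ ih₁ ih₂ => intro ρ A T; simp only [Unfolds, h₁.fn_eq, h₂.fn_eq, ih₁, ih₂]
  | @alpha_res r r' P h =>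
    intro ρ A T
    have hz : r' ∉ (P.fn.erase r).image id := by simpa using fun _ => h
    simp only [Unfolds, fn_subst₁_erase h]
    simp only [subst₁, mem_fn_subst_update hz, unfolds_subst]
    split_ifs with hr
    · refine exists_congr fun w => and_congr_right fun hw => exists_congr fun A' =>
        and_congr_right fun _ => and_congr_right fun _ => unfolds_congr P fun y hy => ?_
      by_cases hyr : y = r
      · subst hyr; simp
      · have : y ≠ r' := by rintro rfl; exact h hy
        simp [hyr, this]
    · refine unfolds_congr P fun y hy => ?_
      have : y ≠ r := by rintro rfl; exact hr hy
      simp [this]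
  | alpha_inp ha hx => intro ρ A T; simp only [Unfolds, choiceThread_alpha ha hx ρ]
  | @choice_perm n act cont e =>
    intro ρ A T
    have : choiceThread ρ act cont = choiceThread ρ (act ∘ e) (cont ∘ e) := by
      unfold choiceThread
      rw [((Cong.choice_perm e).subst ρ).cls_eq]
      congr 2
      conv_lhs => rw [← Multiset.map_univ_val_equiv e, Multiset.map_map]
      rfl
    simp only [Unfolds, this]
  | par_comm => exact ⟨.par_comm, .par_comm⟩
  | par_assoc => exact unfolds_par_assoc
  | par_nil P =>
    intro ρ A T
    simp only [Unfolds, unfolds_nil, fn_nil]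
    constructor
    · rintro ⟨A₁, A₂, T₁, T₂, rfl, rfl, -, -, -, h, rfl, rfl⟩
      simpa using h
    · exact fun h => ⟨A, ∅, T, 0, by simp, by simp, by simp, by simp, by simp, h, rfl, rfl⟩
  | res_nil => intro ρ A T; simp [Unfolds, fn_nil]
  | res_comm r r' P =>
    by_cases hr : r = r'
    · subst hr; exact Iff.rfl
    · exact ⟨.res_comm hr, .res_comm (Ne.symm hr)⟩
  | res_par h => exact unfolds_res_par h

end Proc

namespace Proc

variable {N : Type u} {I : Type v} [DecidableEq N] [Infinite N]

theorem subst_subst_cls (P : Proc N I) (σ τ : N → N) :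
    cls ((P.subst σ).subst τ) = cls (P.subst (τ ∘ σ)) := (subst_subst P σ τ).cls_eq

theorem cls_choice_zero {act : Fin 0 → Act N} {cont : Fin 0 → Proc N I} :
    cls (choice 0 act cont) = 0 := by
  rw [← Cls.cls_nil, nil]
  congr 2 <;> exact funext fun i => i.elim0

theorem Unfolds.cls_eq {P : Proc N I} : ∀ {ρ : N → N} {A : Finset N} {T : Multiset (Thread N I)},
    Unfolds P ρ A T → cls (P.subst ρ) = Cls.nu A (T.map Thread.toCls).sum := by
  induction P with
  | call K as =>
    rintro ρ A T ⟨rfl, rfl⟩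
    simp [callThread, Cls.nu_empty]
  | choice n act cont _ =>
    rintro ρ A T ⟨rfl, rfl⟩
    split_ifs with hn
    · subst hn
      rw [subst_choice, cls_choice_zero]
      simp [Cls.nu_empty]
    · simp [choiceThread, Cls.nu_empty]
  | res r P ih =>
    intro ρ A T h
    simp only [Unfolds] at h
    split_ifs at h with hr
    · obtain ⟨z, hz, A', rfl, hzA, h⟩ := h
      rw [(subst_res P hz).cls_eq, Cls.cls_res, ih h, Cls.nu_insert hzA]
    · have hz := avoid_notMem r ((P.fn.erase r).image ρ)
      rw [(subst_res P hz).cls_eq, Cls.cls_res, Cls.res_of_notMem, ← ih h]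
      · congr 1
        exact subst_congr P fun y hy => Function.update_of_ne (by rintro rfl; exact hr hy) _ _
      · rwa [Cls.fn_cls, mem_fn_subst_update hz]
  | par P Q ihP ihQ =>
    rintro ρ A T ⟨A₁, A₂, T₁, T₂, rfl, rfl, hA, h1, h2, h3, h4⟩
    rw [subst, Cls.cls_par, ihP h3, ihQ h4, Multiset.map_add, Multiset.sum_add, Cls.nu_union hA]
    have e1 := ihP h3
    have e2 := ihQ h4
    set p := (T₁.map Thread.toCls).sum
    set q := (T₂.map Thread.toCls).sum
    have hp : Disjoint A₂ (Cls.fn p) := by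
      have : Cls.fn p ⊆ P.fn.image ρ ∪ A₁ := by
        have := congrArg Cls.fn e1
        rw [Cls.fn_cls, fn_subst, Cls.fn_nu] at this
        rw [this, Finset.sdiff_union_self_eq_union]
        exact Finset.subset_union_left
      exact Finset.disjoint_of_subset_right this (Finset.disjoint_union_right.2 ⟨h2, hA.symm⟩)
    have hq : Disjoint A₁ (Cls.fn (Cls.nu A₂ q)) := by
      rwa [← e2, Cls.fn_cls, fn_subst]
    rw [Cls.nu_add hp, add_comm p, Cls.nu_add hq, add_comm]

theorem lookup_zip_map {α β γ : Type*} [BEq α] (f : β → γ) (y : α) :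
    ∀ (xs : List α) (as : List β), (xs.zip (as.map f)).lookup y = ((xs.zip as).lookup y).map f := by
  intro xs
  induction xs with
  | nil => simp
  | cons x xs ih =>
    intro as
    cases as with
    | nil => simp
    | cons a as =>
      simp only [List.map_cons, List.zip_cons_cons, List.lookup_cons, ih]
      cases y == x <;> simp

theorem lookup_zip_isSome {α β : Type*} [DecidableEq α] {y : α} :
    ∀ {xs : List α} {as : List β}, as.length = xs.length → y ∈ xs →
      ∃ a ∈ as, (xs.zip as).lookup y = some a := by
  intro xs
  induction xs with
  | nil => simp
  | cons x xs ih =>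
    intro as hl hy
    cases as with
    | nil => simp at hl
    | cons a as =>
      simp only [List.zip_cons_cons, List.lookup_cons]
      by_cases hyx : y = x
      · exact ⟨a, by simp, by simp [hyx]⟩
      · obtain ⟨b, hb, h⟩ := ih (as := as) (by simpa using hl) (by simpa [hyx] using hy)
        exact ⟨b, by simp [hb], by rw [beq_false_of_ne hyx]; exact h⟩

section Reaction

variable {params : I → List N} {body : I → Proc N I}

theorem fn_substList_subset {K : I} (hb : (body K).fn ⊆ (params K).toFinset) {as : List N}
    (hl : as.length = (params K).length) :
    (substList as (params K) (body K)).fn ⊆ as.toFinset := by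
  rw [substList, fn_subst]
  intro y hy
  obtain ⟨x, hx, rfl⟩ := Finset.mem_image.1 hy
  obtain ⟨a, ha, h⟩ := lookup_zip_isSome hl (List.mem_toFinset.1 (hb hx))
  simpa [h] using ha

theorem substList_map {K : I} (hb : (body K).fn ⊆ (params K).toFinset) {as : List N}
    (hl : as.length = (params K).length) (ρ : N → N) :
    cls (substList (as.map ρ) (params K) (body K)) =
      cls ((substList as (params K) (body K)).subst ρ) := by
  rw [substList, substList, subst_subst_cls]
  congr 1
  refine subst_congr _ fun y hy => ?_
  obtain ⟨a, ha, h⟩ := lookup_zip_isSome hl (List.mem_toFinset.1 (hb hy))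
  simp [lookup_zip_map, h]

theorem React.fn_subset (hb : ∀ K, (body K).fn ⊆ (params K).toFinset) {P P' : Proc N I}
    (h : React params body P P') : P'.fn ⊆ P.fn := by
  induction h with
  | @tau n act cont i hi =>
    refine subset_trans ?_ (Finset.subset_biUnion_of_mem _ (Finset.mem_univ i))
    rw [hi]; exact subset_rfl
  | const hl => exact fn_substList_subset (hb _) hl
  | @comm n act cont m act' cont' i j x y z hi hj =>
    have h1 : (act i).fnUnder (cont i).fn ⊆ (choice n act cont).fn :=
      Finset.subset_biUnion_of_mem (fun i => (act i).fnUnder (cont i).fn) (Finset.mem_univ i)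
    have h2 : (act' j).fnUnder (cont' j).fn ⊆ (choice m act' cont').fn :=
      Finset.subset_biUnion_of_mem (fun i => (act' i).fnUnder (cont' i).fn) (Finset.mem_univ j)
    rw [hi] at h1
    rw [hj] at h2
    refine Finset.union_subset (fun w hw => Finset.mem_union.2 ?_)
      (subset_trans (subset_trans Finset.subset_union_right h2) Finset.subset_union_right)
    rw [subst₁, fn_subst] at hw
    obtain ⟨v, hv, rfl⟩ := Finset.mem_image.1 hw
    by_cases hvy : v = y
    · subst hvy
      exact .inr (h2 (by simp [Act.fnUnder]))
    · rw [Function.update_of_ne hvy]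
      exact .inl (h1 (by simp [Act.fnUnder, hvy, hv]))
  | par _ ih => exact Finset.union_subset_union_left ih
  | res _ ih => exact Finset.erase_subset_erase _ ih
  | struct h₁ _ h₂ ih => rwa [h₁.fn_eq, ← h₂.fn_eq]

/-- The reactions of a multiset of threads. -/
inductive ThreadStep (params : I → List N) (body : I → Proc N I) :
    Multiset (Thread N I) → Multiset (Cls N I) → Prop
  | tau {t T s q} : t.head = .inr s → .tau q ∈ s →
      ThreadStep params body (t ::ₘ T) (q ::ₘ T.map Thread.toCls)
  | const {t T K as} : t.head = .inl (K, as) → as.length = (params K).length →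
      ThreadStep params body (t ::ₘ T)
        (cls (substList as (params K) (body K)) ::ₘ T.map Thread.toCls)
  | comm {t t' T s s' a f b q} : t.head = .inr s → t'.head = .inr s' → .inp a f ∈ s →
      .out a b q ∈ s' →
      ThreadStep params body (t ::ₘ t' ::ₘ T) (f b ::ₘ q ::ₘ T.map Thread.toCls)

theorem ThreadStep.add_right {T : Multiset (Thread N I)} {U : Multiset (Cls N I)}
    (h : ThreadStep params body T U) (T' : Multiset (Thread N I)) :
    ThreadStep params body (T + T') (U + T'.map Thread.toCls) := by
  cases h with
  | tau h1 h2 =>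
    simp only [Multiset.cons_add, ← Multiset.map_add]; exact .tau h1 h2
  | const h1 h2 =>
    simp only [Multiset.cons_add, ← Multiset.map_add]; exact .const h1 h2
  | comm h1 h2 h3 h4 =>
    simp only [Multiset.cons_add, ← Multiset.map_add]; exact .comm h1 h2 h3 h4

theorem summand_mem_choiceThread {ρ : N → N} {n : ℕ} {act : Fin n → Act N}
    {cont : Fin n → Proc N I} (i : Fin n) :
    summand ρ (cont i) (act i) ∈ Finset.univ.val.map fun i => summand ρ (cont i) (act i) :=
  Multiset.mem_map_of_mem (fun i => summand ρ (cont i) (act i)) (Finset.mem_univ_val i)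

/-- The reactions of a process are the reactions of the threads into which it unfolds. -/
theorem React.threadStep (hb : ∀ K, (body K).fn ⊆ (params K).toFinset) {P P' : Proc N I}
    (h : React params body P P') : ∀ {ρ A T}, Unfolds P ρ A T →
      ∃ U, ThreadStep params body T U ∧ cls (P'.subst ρ) = Cls.nu A U.sum := by
  induction h with
  | @tau n act cont i hi =>
    rintro ρ A T ⟨rfl, rfl⟩
    have hn : n ≠ 0 := by rintro rfl; exact i.elim0
    rw [if_neg hn]
    refine ⟨_, .tau (T := 0) (t := choiceThread ρ act cont) (q := cls ((cont i).subst ρ)) rfl ?_,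
      by simp [Cls.nu_empty]⟩
    have := summand_mem_choiceThread (ρ := ρ) (act := act) (cont := cont) i
    rw [hi] at this
    exact this
  | @const K as hl =>
    rintro ρ A T ⟨rfl, rfl⟩
    refine ⟨_, .const (T := 0) rfl (by simpa using hl), ?_⟩
    simp [Cls.nu_empty, substList_map (hb K) hl]
  | @comm n act cont m act' cont' i j x y z hi hj =>
    rintro ρ A T ⟨A₁, A₂, T₁, T₂, rfl, rfl, -, -, -, ⟨rfl, rfl⟩, ⟨rfl, rfl⟩⟩
    have hn : n ≠ 0 := by rintro rfl; exact i.elim0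
    have hm : m ≠ 0 := by rintro rfl; exact j.elim0
    have h1 := summand_mem_choiceThread (ρ := ρ) (act := act) (cont := cont) i
    have h2 := summand_mem_choiceThread (ρ := ρ) (act := act') (cont := cont') j
    rw [hi] at h1
    rw [hj] at h2
    rw [if_neg hn, if_neg hm]
    refine ⟨_, .comm (t := choiceThread ρ act cont) (t' := choiceThread ρ act' cont') (T := 0)
      rfl rfl h1 h2, ?_⟩
    simp only [Finset.union_empty, Cls.nu_empty, Multiset.map_zero, Multiset.sum_cons,
      Multiset.sum_zero, add_zero, subst, Cls.cls_par, subst₁, subst_subst_cls]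
    congr 2
    refine subst_congr _ fun w _ => ?_
    by_cases hw : w = y
    · subst hw; simp
    · simp [hw]
  | @par P P' Q hr ih =>
    rintro ρ A T ⟨A₁, A₂, T₁, T₂, rfl, rfl, hA, h1, h2, h3, h4⟩
    obtain ⟨U, hU, hP'⟩ := ih h3
    refine ⟨_, hU.add_right T₂, ?_⟩
    have e2 := h4.cls_eq
    rw [Multiset.sum_add, subst, Cls.cls_par, Cls.nu_union hA]
    have hq : Disjoint A₁ (Cls.fn (Cls.nu A₂ (T₂.map Thread.toCls).sum)) := by
      rwa [← e2, Cls.fn_cls, fn_subst]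
    have hp : Disjoint A₂ (Cls.fn U.sum) := by
      have : Cls.fn U.sum ⊆ P.fn.image ρ ∪ A₁ := by
        have := congrArg Cls.fn hP'
        rw [Cls.fn_cls, fn_subst, Cls.fn_nu] at this
        refine subset_trans ?_ (Finset.union_subset_union_left
          (Finset.image_subset_image (hr.fn_subset hb)))
        rw [this, Finset.sdiff_union_self_eq_union]
        exact Finset.subset_union_left
      exact Finset.disjoint_of_subset_right this (Finset.disjoint_union_right.2 ⟨h2, hA.symm⟩)
    rw [Cls.nu_add hp, add_comm U.sum, Cls.nu_add hq, ← e2, ← hP', add_comm]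
  | @res r P P' hr ih =>
    intro ρ A T h
    have hfn := hr.fn_subset hb
    simp only [Unfolds] at h
    split_ifs at h with hrP
    · obtain ⟨z, hz, A', rfl, hzA, h⟩ := h
      obtain ⟨U, hU, hP'⟩ := ih h
      refine ⟨U, hU, ?_⟩
      have hz' : z ∉ (P'.fn.erase r).image ρ := fun h => hz
        (Finset.image_subset_image (Finset.erase_subset_erase _ hfn) h)
      rw [(subst_res P' hz').cls_eq, Cls.cls_res, hP', Cls.nu_insert hzA]
    · obtain ⟨U, hU, hP'⟩ := ih h
      refine ⟨U, hU, ?_⟩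
      rw [← hP']
      have hrP' : r ∉ P'.fn := fun h => hrP (hfn h)
      have hz := avoid_notMem r ((P'.fn.erase r).image ρ)
      rw [(subst_res P' hz).cls_eq, Cls.cls_res, Cls.res_of_notMem]
      · congr 1
        exact subst_congr P' fun y hy => Function.update_of_ne (by rintro rfl; exact hrP' hy) _ _
      · rwa [Cls.fn_cls, mem_fn_subst_update hz]
  | struct h₁ _ h₂ ih =>
    intro ρ A T h
    obtain ⟨U, hU, hP'⟩ := ih (h₁.unfolds_iff.1 h)
    exact ⟨U, hU, by rw [← hP', (h₂.subst ρ).cls_eq]⟩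

/-- The thread of a call or nonempty choice in the environment `ρ`. -/
noncomputable def toThread (ρ : N → N) : Proc N I → Thread N I
  | call K as => callThread ρ K as
  | choice _ act cont => choiceThread ρ act cont
  | P => ⟨cls (P.subst ρ), .inr 0⟩

theorem toCls_toThread (ρ : N → N) (P : Proc N I) :
    (toThread ρ P).toCls = cls (P.subst ρ) := by
  cases P <;> rfl

/-- Calls and nonempty choices. -/
def IsActive (P : Proc N I) : Prop := (P.IsChoice ∨ P.IsCall) ∧ P.StopFree

theorem IsActive.unfolds {P : Proc N I} (h : P.IsActive) (ρ : N → N) :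
    Unfolds P ρ ∅ {toThread ρ P} := by
  cases P with
  | call K as => exact ⟨rfl, rfl⟩
  | choice n act cont => exact ⟨rfl, by rw [if_neg h.2.1]; rfl⟩
  | res r P => exact absurd h.1 (by simp [IsChoice, IsCall])
  | par P Q => exact absurd h.1 (by simp [IsChoice, IsCall])

theorem unfolds_parList {ι : Type*} {f : ι → Proc N I} {t : ι → Thread N I} {ρ : N → N} :
    ∀ {l : List ι}, (∀ i ∈ l, Unfolds (f i) ρ ∅ {t i}) →
      Unfolds (parList (l.map f)) ρ ∅ (l.map t : List (Thread N I))
  | [], _ => by simp [parList, unfolds_nil]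
  | [i], h => by simpa [parList] using h i (by simp)
  | i :: j :: l, h =>
    ⟨∅, ∅, {t i}, ((j :: l).map t : List (Thread N I)), by simp, by simp, by simp, by simp,
      by simp, h i (by simp), unfolds_parList (l := j :: l) fun k hk => h k (by simp [hk])⟩

theorem Unfolds.resList {P : Proc N I} {T : Multiset (Thread N I)} (h : Unfolds P id ∅ T) :
    ∀ {l : List N}, l.Nodup → Unfolds (resList l P) id (l.toFinset ∩ P.fn) T := by
  intro l
  have fn_resList : ∀ l : List N, (Proc.resList l P).fn = P.fn \ l.toFinset := by
    intro l
    induction l with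
    | nil => simp [Proc.resList]
    | cons r l ih =>
      rw [List.toFinset_cons, Finset.sdiff_insert, ← ih]; rfl
  induction l with
  | nil => intro _; simpa [Proc.resList] using h
  | cons r l ih =>
    intro hl
    rw [List.nodup_cons] at hl
    change Unfolds (Proc.res r (Proc.resList l P)) _ _ _
    simp only [Unfolds]
    rw [fn_resList, List.toFinset_cons]
    split_ifs with hr
    · refine ⟨r, by simp, l.toFinset ∩ P.fn, ?_, by simp [hl.1], ?_⟩
      · rw [Finset.insert_inter_of_mem (Finset.mem_sdiff.1 hr).1]
      · rw [show Function.update (id : N → N) r r = id from Function.update_eq_self r id]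
        exact ih hl.2
    · rw [Finset.insert_inter_of_notMem]
      · exact ih hl.2
      · simpa [hl.1] using hr

theorem map_toCls_sum {n : ℕ} (S : Fin n → Proc N I) (ρ : N → N) (s : Finset (Fin n)) :
    ((s.val.map fun i => toThread ρ (S i)).map Thread.toCls).sum =
      ∑ i ∈ s, cls ((S i).subst ρ) := by
  simp only [Multiset.map_map, Function.comp_def, toCls_toThread]
  rfl

theorem map_eq_cons_of_fintype {ι α : Type*} [DecidableEq ι] {s : Finset ι} {f : ι → α}
    {t : α} {T : Multiset α} (h : s.val.map f = t ::ₘ T) :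
    ∃ i ∈ s, f i = t ∧ T = (s.erase i).val.map f := by
  obtain ⟨i, hi, h1, h2⟩ := (Multiset.map_eq_cons f s.val T t).2 h
  exact ⟨i, hi, h1, by rw [Finset.erase_val, h2]⟩

theorem head_toThread_inr {P : Proc N I} {ρ : N → N} {s : Multiset (Summand N I)}
    {x : Summand N I} (h : (toThread ρ P).head = .inr s) (hx : x ∈ s) :
    ∃ n, ∃ (act : Fin n → Act N) (cont : Fin n → Proc N I) (k : Fin n),
      P = choice n act cont ∧ x = summand ρ (cont k) (act k) := by
  cases P with
  | call K as => cases h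
  | choice n act cont =>
    obtain rfl := Sum.inr_injective h
    obtain ⟨k, -, rfl⟩ := Multiset.mem_map.1 hx
    exact ⟨n, act, cont, k, rfl, rfl⟩
  | res r P => obtain rfl := Sum.inr_injective h; simp at hx
  | par P Q => obtain rfl := Sum.inr_injective h; simp at hx

theorem summand_eq_tau {ρ : N → N} {P : Proc N I} {a : Act N} {q : Cls N I}
    (h : .tau q = summand ρ P a) : a = .tau ∧ q = cls (P.subst ρ) := by
  cases a <;> simp_all [summand]

theorem summand_eq_out {ρ : N → N} {P : Proc N I} {a : Act N} {x y : N} {q : Cls N I}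
    (h : .out x y q = summand ρ P a) :
    ∃ x' y', a = .out x' y' ∧ x = ρ x' ∧ y = ρ y' ∧ q = cls (P.subst ρ) := by
  cases a <;> simp_all [summand]

theorem summand_eq_inp {ρ : N → N} {P : Proc N I} {a : Act N} {x : N} {f : N → Cls N I}
    (h : .inp x f = summand ρ P a) :
    ∃ x' y', a = .inp x' y' ∧ x = ρ x' ∧ f = fun z => cls (P.subst (Function.update ρ y' z)) := by
  cases a <;> simp_all [summand]

/-- The reactions of `ν A. (S₁ρ | … | Sₙρ)`. -/
theorem react_nu_sum_cases (hb : ∀ K, (body K).fn ⊆ (params K).toFinset) {n : ℕ}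
    {S : Fin n → Proc N I} (hS : ∀ i, (S i).IsActive) {ρ : N → N} {A : Finset N} {q : Cls N I}
    (h : Cls.React params body (Cls.nu A (∑ i, cls ((S i).subst ρ))) q) :
    (∃ i m, ∃ (act : Fin m → Act N) (cont : Fin m → Proc N I) (k : Fin m),
      S i = choice m act cont ∧ act k = .tau ∧
      q = Cls.nu A (cls ((cont k).subst ρ) + ∑ j ∈ Finset.univ.erase i, cls ((S j).subst ρ))) ∨
    (∃ i K as, S i = call K as ∧ as.length = (params K).length ∧
      q = Cls.nu A (cls ((substList as (params K) (body K)).subst ρ) +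
        ∑ j ∈ Finset.univ.erase i, cls ((S j).subst ρ))) ∨
    (∃ i i' m m', ∃ (act : Fin m → Act N) (cont : Fin m → Proc N I) (act' : Fin m' → Act N)
      (cont' : Fin m' → Proc N I) (k : Fin m) (k' : Fin m') (x y x' z : N), i ≠ i' ∧
      S i = choice m act cont ∧ S i' = choice m' act' cont' ∧ act k = .inp x y ∧
      act' k' = .out x' z ∧ ρ x = ρ x' ∧
      q = Cls.nu A (cls ((cont k).subst (Function.update ρ y (ρ z))) + (cls ((cont' k').subst ρ) +
        ∑ j ∈ (Finset.univ.erase i).erase i', cls ((S j).subst ρ)))) := by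
  set P := parList (List.ofFn fun i => (S i).subst ρ) with hP
  have hPcls : cls P = ∑ i, cls ((S i).subst ρ) := Cls.cls_parList_ofFn _
  have hA : A.toList.Nodup := A.nodup_toList
  have hunf : Unfolds P id ∅ (Finset.univ.val.map fun i => toThread ρ (S i)) := by
    rw [hP, List.ofFn_eq_map, Fin.univ_val_map, List.ofFn_eq_map]
    exact unfolds_parList fun i _ => unfolds_subst _ |>.2 ((hS i).unfolds _)
  have hunf' := hunf.resList hA
  rw [Finset.toList_toFinset] at hunf'
  obtain ⟨P', rfl⟩ : ∃ P', q = cls P' := ⟨q.out, q.out_eq.symm⟩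
  have hcls : cls (Proc.resList A.toList P) = Cls.nu A (∑ i, cls ((S i).subst ρ)) := by
    rw [Cls.cls_resList hA, Finset.toList_toFinset, hPcls]
  rw [← hcls, Cls.react_cls] at h
  have hfn := h.fn_subset hb
  obtain ⟨U, hU, hP'⟩ := h.threadStep hb hunf'
  rw [subst_id] at hP'
  have hU' : cls P' = Cls.nu A U.sum := by
    have h1 : Cls.fn U.sum ⊆ P.fn := by
      have e := congrArg Cls.fn hP'
      rw [Cls.fn_nu, Cls.fn_cls] at e
      have h2 : (Proc.resList A.toList P).fn ⊆ P.fn := by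
        rw [← Cls.fn_cls, hcls, Cls.fn_nu, ← hPcls]
        exact Finset.sdiff_subset
      intro x hx
      by_cases hxA : x ∈ A ∩ P.fn
      · exact (Finset.mem_inter.1 hxA).2
      · exact h2 (hfn (e ▸ Finset.mem_sdiff.2 ⟨hx, hxA⟩))
    rw [hP', ← Cls.nu_inter, ← Cls.nu_inter A, Finset.inter_assoc,
      Finset.inter_eq_right.2 h1]
  rw [hU']
  generalize hT : (Finset.univ.val.map fun i => toThread ρ (S i)) = T at hU
  cases hU with
  | @tau t T s q hs hq =>
    obtain ⟨i, -, rfl, rfl⟩ := map_eq_cons_of_fintype hT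
    obtain ⟨m, act, cont, k, hi, hx⟩ := head_toThread_inr hs hq
    obtain ⟨ha, rfl⟩ := summand_eq_tau hx
    refine .inl ⟨i, m, act, cont, k, hi, ha, ?_⟩
    rw [Multiset.sum_cons, map_toCls_sum]
  | @const t T K as ht hl =>
    obtain ⟨i, -, rfl, rfl⟩ := map_eq_cons_of_fintype hT
    refine .inr (.inl ?_)
    cases hi : S i with
    | call L bs =>
      rw [hi] at ht
      obtain ⟨rfl, rfl⟩ : L = K ∧ bs.map ρ = as := by simpa [toThread, callThread] using ht
      rw [List.length_map] at hl
      refine ⟨i, L, bs, hi, hl, ?_⟩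
      rw [Multiset.sum_cons, map_toCls_sum, substList_map (hb L) hl]
    | choice m act cont => rw [hi] at ht; cases ht
    | res r P => rw [hi] at ht; cases ht
    | par P Q => rw [hi] at ht; cases ht
  | @comm t t' T s s' a f b q hs hs' hf hq =>
    obtain ⟨i, -, rfl, hT'⟩ := map_eq_cons_of_fintype hT
    obtain ⟨i', hi', rfl, rfl⟩ := map_eq_cons_of_fintype hT'.symm
    obtain ⟨m, act, cont, k, hi, hx⟩ := head_toThread_inr hs hf
    obtain ⟨m', act', cont', k', hSi', hx'⟩ := head_toThread_inr hs' hq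
    obtain ⟨x, y, ha, rfl, rfl⟩ := summand_eq_inp hx
    obtain ⟨x', z, ha', hxx, rfl, rfl⟩ := summand_eq_out hx'
    refine .inr (.inr ⟨i, i', m, m', act, cont, act', cont', k, k', x, y, x', z,
      (Finset.ne_of_mem_erase hi').symm, hi, hSi', ha, ha', hxx, ?_⟩)
    rw [Multiset.sum_cons, Multiset.sum_cons, map_toCls_sum]

end Reaction

end Proc

namespace Proc

variable {N : Type u} {I : Type v} [DecidableEq N] [Infinite N]

namespace Cls

theorem nu_singleton (r : N) (q : Cls N I) : nu {r} q = res r q := by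
  rw [← insert_empty_eq, nu_insert (by simp), nu_empty]

theorem nu_res_of_mem {r : N} {A : Finset N} (h : r ∈ A) (q : Cls N I) :
    nu A (res r q) = nu A q := by
  have hd : Disjoint (A.erase r) {r} := by simp
  have hA : A = A.erase r ∪ {r} := by
    rw [Finset.union_comm, Finset.singleton_union, Finset.insert_erase h]
  rw [hA, nu_union hd, nu_union hd, nu_singleton, nu_singleton, res_of_notMem (r := r)]
  simp [fn_res]

/-- The application of a substitution. -/
noncomputable def subst (σ : N → N) : Cls N I → Cls N I :=
  Quotient.map (Proc.subst σ) fun _ _ h => Cong.subst h σ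

theorem subst_cls (σ : N → N) (P : Proc N I) : subst σ (cls P) = cls (P.subst σ) := rfl

theorem subst_res {q : Cls N I} {σ : N → N} {r z : N} (hz : z ∉ ((fn q).erase r).image σ) :
    subst σ (res r q) = res z (subst (Function.update σ r z) q) := by
  obtain ⟨Q⟩ := q; exact (Proc.subst_res Q hz).cls_eq

theorem subst_nu {π : N → N} {q : Cls N I} {A : Finset N} (hπ : Set.InjOn π A) :
    ∀ {ρ : N → N}, Disjoint (A.image π) ((fn q \ A).image ρ) →
      subst ρ (nu A q) = nu (A.image π) (subst (fun x => if x ∈ A then π x else ρ x) q) := by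
  induction A using Finset.induction_on with
  | empty => intro ρ _; simp [nu_empty]
  | insert r A hr ih =>
    intro ρ h
    rw [Finset.image_insert, Finset.disjoint_insert_left, Finset.sdiff_insert] at h
    have hπr : π r ∉ A.image π := by
      rw [Finset.mem_image]
      rintro ⟨y, hy, hyr⟩
      rw [hπ (by simp [hy]) (by simp) hyr] at hy
      exact hr hy
    rw [nu_insert hr, subst_res (z := π r) (by rw [fn_nu]; exact h.1), Finset.image_insert,
      nu_insert hπr, ih (hπ.mono (by simp))]
    · congr 3
      funext x
      by_cases hxr : x = r
      · subst hxr; simp [hr]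
      · simp [hxr]
    · rw [Finset.disjoint_right]
      intro y hy
      obtain ⟨x, hx, rfl⟩ := Finset.mem_image.1 hy
      by_cases hxr : x = r
      · subst hxr; simpa using hπr
      · rw [Function.update_of_ne hxr]
        exact Finset.disjoint_right.1 h.2
          (Finset.mem_image_of_mem _ (Finset.mem_erase.2 ⟨hxr, hx⟩))

theorem subst_id (q : Cls N I) : subst id q = q := by
  obtain ⟨Q⟩ := q; exact congrArg cls (Proc.subst_id Q)

theorem nu_rename {π : N → N} {q : Cls N I} {A : Finset N} (hπ : Set.InjOn π A)
    (h : Disjoint (A.image π) (fn q \ A)) :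
    nu A q = nu (A.image π) (subst (fun x => if x ∈ A then π x else x) q) := by
  have := subst_nu (ρ := id) hπ (by rwa [Finset.image_id])
  rw [subst_id] at this
  exact this

theorem subst_add (σ : N → N) (p q : Cls N I) : subst σ (p + q) = subst σ p + subst σ q := by
  obtain ⟨P⟩ := p; obtain ⟨Q⟩ := q; rfl

theorem subst_zero (σ : N → N) : subst σ (0 : Cls N I) = 0 := congrArg cls (subst_nil σ)

theorem subst_sum {ι : Type*} (σ : N → N) (s : Finset ι) (f : ι → Cls N I) :
    subst σ (∑ i ∈ s, f i) = ∑ i ∈ s, subst σ (f i) := by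
  classical
  induction s using Finset.induction_on with
  | empty => simp [subst_zero]
  | insert i s hi ih => rw [Finset.sum_insert hi, Finset.sum_insert hi, subst_add, ih]

/-- A restricted name of a thread may be chosen from the names restricted globally. -/
theorem nu_subst_res {A : Finset N} {P : Proc N I} {r z : N} {ρ : N → N} {p : Cls N I}
    (hzA : z ∈ A) (hzP : z ∉ (P.fn.erase r).image ρ) (hz : z ∉ fn p) :
    nu A (cls ((Proc.res r P).subst ρ) + p) =
      nu A (cls (P.subst (Function.update ρ r z)) + p) := by
  rw [(Proc.subst_res P hzP).cls_eq, cls_res, add_comm, ← res_add hz, nu_res_of_mem hzA, add_comm]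

variable {params : I → List N} {body : I → Proc N I}

theorem react_tau {n : ℕ} {act : Fin n → Act N} {cont : Fin n → Proc N I} {k : Fin n}
    (h : act k = .tau) (ρ : N → N) :
    React params body (cls ((choice n act cont).subst ρ)) (cls ((cont k).subst ρ)) := by
  rw [react_cls, subst_choice]
  have := Proc.React.tau (params := params) (body := body) (i := k)
    (act := fun i => (act i).substUnder ρ (cont i).fn)
    (cont := fun i => (cont i).subst ((act i).envUnder ρ (cont i).fn)) (by rw [h]; rfl)
  rwa [h] at this

theorem react_call {K : I} (hb : (body K).fn ⊆ (params K).toFinset) {as : List N}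
    (hl : as.length = (params K).length) (ρ : N → N) :
    React params body (cls ((call K as).subst ρ))
      (cls ((substList as (params K) (body K)).subst ρ)) := by
  rw [← substList_map hb hl, react_cls]
  exact .const (by simpa using hl)

theorem react_comm {n m : ℕ} {act : Fin n → Act N} {cont : Fin n → Proc N I} {k : Fin n}
    {act' : Fin m → Act N} {cont' : Fin m → Proc N I} {k' : Fin m} {x y x' z : N}
    (h : act k = .inp x y) (h' : act' k' = .out x' z) {ρ : N → N} (hx : ρ x = ρ x') :
    React params body
      (cls ((choice n act cont).subst ρ) + cls ((choice m act' cont').subst ρ))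
      (cls ((cont k).subst (Function.update ρ y (ρ z))) + cls ((cont' k').subst ρ)) := by
  have := Proc.React.comm (params := params) (body := body) (i := k) (j := k')
    (act := fun i => (act i).substUnder ρ (cont i).fn)
    (cont := fun i => (cont i).subst ((act i).envUnder ρ (cont i).fn))
    (act' := fun i => (act' i).substUnder ρ (cont' i).fn)
    (cont' := fun i => (cont' i).subst ((act' i).envUnder ρ (cont' i).fn))
    (x := ρ x) (y := avoid y (((cont k).fn.erase y).image ρ)) (z := ρ z)
    (by rw [h]; rfl) (by rw [h', hx]; rfl)
  rw [← react_cls, ← subst_choice, ← subst_choice, cls_par, cls_par, h, h', subst₁,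
    subst_subst_cls] at this
  have hy : avoid y (((cont k).fn.erase y).image ρ) ∉ ((cont k).fn.erase y).image ρ :=
    avoid_notMem _ _
  have e := subst_update_comp (τ := id) (ρ z) hy
  rw [Act.envUnder, e] at this
  exact this

end Cls

end Proc

namespace FCPSpec

variable {N : Type u} {I : Type v} [DecidableEq N] [Infinite N] [Fintype I]

/-- The initial threads and the bodies of the defining equations, as an indexed family. -/
def bodyAt (F : FCPSpec N I) : Fin F.n ⊕ I → Proc N I := Sum.elim F.thread F.body

/-- The names bound in a process. -/
def boundNames (P : Proc N I) : Multiset N := P.resNames + P.inpNames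

theorem isBody_bodyAt (F : FCPSpec N I) (b : Fin F.n ⊕ I) : F.IsBody (F.bodyAt b) := by
  cases b with
  | inl i => exact .inl ⟨i, rfl⟩
  | inr K => exact .inr ⟨K, rfl⟩

variable {F : FCPSpec N I}

theorem sum_boundNames_le (F : FCPSpec N I) :
    ∑ b, boundNames (F.bodyAt b) ≤ F.resOcc + F.inpOcc := by
  rw [Fintype.sum_sum_type]
  simp only [boundNames, bodyAt, Sum.elim_inl, Sum.elim_inr, Finset.sum_add_distrib, resOcc, inpOcc]
  rw [Multiset.le_iff_exists_add]
  exact ⟨(F.rs : Multiset N), by abel⟩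

theorem nodup_sum_unique {ι α : Type*} [DecidableEq ι] {s : Finset ι} {f : ι → Multiset α}
    (h : (∑ i ∈ s, f i).Nodup) {i j : ι} (hi : i ∈ s) (hj : j ∈ s) {x : α} (hxi : x ∈ f i)
    (hxj : x ∈ f j) : i = j := by
  by_contra hij
  rw [← Finset.add_sum_erase s f hi, Multiset.nodup_add] at h
  refine Multiset.disjoint_left.1 h.2.2 hxi (Multiset.mem_sum.2 ⟨j, ?_, hxj⟩)
  exact Finset.mem_erase.2 ⟨Ne.symm hij, hj⟩

theorem NormalForm.params_nodup (hF : F.NormalForm) (K : I) : (F.params K).Nodup := by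
  classical
  have h := (Multiset.nodup_add.1 hF.formal_nodup).2.1
  rw [← Finset.add_sum_erase _ _ (Finset.mem_univ K), Multiset.nodup_add] at h
  exact Multiset.coe_nodup.1 h.1

theorem NormalForm.frmOcc_eq (hF : F.NormalForm) : F.frmOcc = ∑ b, (F.bodyAt b).fn.val := by
  rw [Fintype.sum_sum_type, frmOcc]
  congr 1
  refine Finset.sum_congr rfl fun K _ => ?_
  rw [bodyAt, Sum.elim_inr, hF.fn_body, List.toFinset_val, (hF.params_nodup K).dedup]

theorem NormalForm.fn_bodyAt_subset (hF : F.NormalForm) (b : Fin F.n ⊕ I) :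
    (F.bodyAt b).fn ⊆ F.FRM := by
  intro x hx
  rw [FRM, Multiset.mem_toFinset, hF.frmOcc_eq]
  exact Multiset.mem_sum.2 ⟨b, Finset.mem_univ _, hx⟩

theorem resNames_bodyAt_subset {b : Fin F.n ⊕ I} {r : N} (h : r ∈ (F.bodyAt b).resNames) :
    r ∈ F.RESTR := by
  rw [RESTR, Multiset.mem_toFinset, resOcc]
  cases b with
  | inl i =>
    exact Multiset.mem_add.2 (.inl (Multiset.mem_add.2 (.inr
      (Multiset.mem_sum.2 ⟨i, Finset.mem_univ _, h⟩))))
  | inr K => exact Multiset.mem_add.2 (.inr (Multiset.mem_sum.2 ⟨K, Finset.mem_univ _, h⟩))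

theorem inpNames_bodyAt_subset {b : Fin F.n ⊕ I} {r : N} (h : r ∈ (F.bodyAt b).inpNames) :
    r ∈ F.INP := by
  rw [INP, Multiset.mem_toFinset, inpOcc]
  cases b with
  | inl i => exact Multiset.mem_add.2 (.inl (Multiset.mem_sum.2 ⟨i, Finset.mem_univ _, h⟩))
  | inr K => exact Multiset.mem_add.2 (.inr (Multiset.mem_sum.2 ⟨K, Finset.mem_univ _, h⟩))

theorem NormalForm.disjoint_RESTR (hF : F.NormalForm) : ∀ x ∈ F.INP ∪ F.FRM, x ∉ F.RESTR := by
  intro x hx hr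
  rcases Finset.mem_union.1 hx with hx | hx
  · exact Multiset.disjoint_left.1 (Multiset.nodup_add.1 hF.bound_nodup).2.2
      (Multiset.mem_toFinset.1 hr) (Multiset.mem_toFinset.1 hx)
  · exact Finset.disjoint_left.1 hF.bound_formal (Finset.mem_union_left _ hr) hx

theorem mem_of_mem_boundNames {b : Fin F.n ⊕ I} {x : N} (h : x ∈ boundNames (F.bodyAt b)) :
    x ∈ F.RESTR ∪ F.INP := by
  rcases Multiset.mem_add.1 h with h | h
  · exact Finset.mem_union_left _ (resNames_bodyAt_subset h)
  · exact Finset.mem_union_right _ (inpNames_bodyAt_subset h)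

/-- `x` is a name of the process with index `b`, free or bound. -/
def Scope (F : FCPSpec N I) (b : Fin F.n ⊕ I) (x : N) : Prop :=
  x ∈ (F.bodyAt b).fn ∨ x ∈ boundNames (F.bodyAt b)

theorem Scope.unique (hF : F.NormalForm) {b b' : Fin F.n ⊕ I} {x : N} (h : F.Scope b x)
    (h' : F.Scope b' x) : b = b' := by
  classical
  have key : ∀ {b b'}, x ∈ (F.bodyAt b).fn → x ∈ boundNames (F.bodyAt b') → False :=
    fun h h' => Finset.disjoint_left.1 hF.bound_formal (mem_of_mem_boundNames h')
      (hF.fn_bodyAt_subset _ h)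
  rcases h with h | h <;> rcases h' with h' | h'
  · have := hF.formal_nodup
    rw [hF.frmOcc_eq] at this
    exact nodup_sum_unique this (Finset.mem_univ b) (Finset.mem_univ b') h h'
  · exact (key h h').elim
  · exact (key h' h).elim
  · exact nodup_sum_unique (Multiset.nodup_of_le F.sum_boundNames_le hF.bound_nodup)
      (Finset.mem_univ b) (Finset.mem_univ b') h h'

theorem NormalForm.boundNames_nodup (hF : F.NormalForm) (b : Fin F.n ⊕ I) :
    (boundNames (F.bodyAt b)).Nodup :=
  Multiset.nodup_of_le ((Finset.single_le_sum (f := fun b => boundNames (F.bodyAt b))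
    (fun _ _ => Multiset.zero_le _) (Finset.mem_univ b)).trans F.sum_boundNames_le) hF.bound_nodup

theorem NormalForm.fn_boundNames (hF : F.NormalForm) {b b' : Fin F.n ⊕ I} {x : N}
    (h : x ∈ (F.bodyAt b).fn) : x ∉ boundNames (F.bodyAt b') := fun h' =>
  Finset.disjoint_left.1 hF.bound_formal (mem_of_mem_boundNames h') (hF.fn_bodyAt_subset b h)

end FCPSpec

namespace FCPSpec

variable {N : Type u} {I : Type v} [DecidableEq N] [Infinite N] [Fintype I]
variable {F : FCPSpec N I} {New : Type w}

/-- The process with index `b` can become active in the `i`-th thread. -/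
def Owns (F : FCPSpec N I) (i : Fin F.n) : Fin F.n ⊕ I → Prop
  | .inl j => j = i
  | .inr K => F.CalledBy i K

theorem Owns.unique (hF : F.NormalForm) {i j : Fin F.n} {b : Fin F.n ⊕ I} (h : F.Owns i b)
    (h' : F.Owns j b) : i = j := by
  cases b with
  | inl k => exact h.symm.trans h'
  | inr K => exact hF.calls_disjoint i j K h h'

theorem Owns.calls {i : Fin F.n} {b : Fin F.n ⊕ I} (h : F.Owns i b) {K : I}
    (hK : K ∈ (F.bodyAt b).calls) : F.Owns i (.inr K) := by
  cases b with
  | inl j => obtain rfl : j = i := h; exact .direct hK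
  | inr L => exact .step h hK

theorem NormalForm.call_ne (hF : F.NormalForm) {b : Fin F.n ⊕ I} {K : I}
    (hK : K ∈ (F.bodyAt b).calls) : b ≠ .inr K := by
  rintro rfl; exact hF.no_self_call K hK

/-- The properties of the augmented processes `(S, l)` derived from the process with index `b`. -/
structure ThreadInv (New : Type w) (F : FCPSpec N I) (b : Fin F.n ⊕ I) (S : Proc N I)
    (l : List N) : Prop where
  derived : ReflTransGen (fun s s' => ¬ s.ctl.IsCall ∧ F.CNext New s s')
    ⟨.thread (F.bodyAt b), []⟩ ⟨.thread S, l⟩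
  isThread : S.IsThread
  arity : S.RespectsArity fun K => (F.params K).length
  stopFree : S.StopFree
  bindersUsed : S.BindersUsed
  resNames_le : S.resNames ≤ (F.bodyAt b).resNames
  inpNames_le : S.inpNames ≤ (F.bodyAt b).inpNames
  calls_subset : S.calls ⊆ (F.bodyAt b).calls
  scope : ∀ x, x ∈ S.fn ∨ x ∈ l → F.Scope b x
  fresh : ∀ x, x ∈ S.fn ∨ x ∈ l → x ∉ boundNames S
  disjoint : ∀ x ∈ S.fn, x ∉ l
  nodup : l.Nodup

theorem ThreadInv.boundNames_nodup (hF : F.NormalForm) {b : Fin F.n ⊕ I} {S : Proc N I}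
    {l : List N} (h : ThreadInv New F b S l) : (boundNames S).Nodup :=
  Multiset.nodup_of_le (add_le_add h.resNames_le h.inpNames_le) (hF.boundNames_nodup b)

theorem ThreadInv.init (hF : F.NormalForm) (b : Fin F.n ⊕ I) :
    ThreadInv New F b (F.bodyAt b) [] where
  derived := .refl
  isThread := hF.isThread _ (F.isBody_bodyAt b)
  arity := hF.arity _ (F.isBody_bodyAt b)
  stopFree := hF.stopFree _ (F.isBody_bodyAt b)
  bindersUsed := hF.bindersUsed _ (F.isBody_bodyAt b)
  resNames_le := le_rfl
  inpNames_le := le_rfl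
  calls_subset := subset_rfl
  scope x hx := .inl (by simpa using hx)
  fresh x hx := hF.fn_boundNames (by simpa using hx)
  disjoint := by simp
  nodup := by simp

theorem ThreadInv.res (hF : F.NormalForm) {b : Fin F.n ⊕ I} {r : N} {S : Proc N I} {l : List N}
    (h : ThreadInv New F b (.res r S) l)
    (hs : F.CNext New ⟨.thread (.res r S), l⟩ ⟨.thread S, l⟩) :
    ThreadInv New F b S l where
  derived := h.derived.tail ⟨(by rintro ⟨K, xs, h | h⟩ <;> cases h), hs⟩
  isThread := h.isThread
  arity := h.arity
  stopFree := h.stopFree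
  bindersUsed := h.bindersUsed.2
  resNames_le := (Multiset.le_cons_self _ _).trans h.resNames_le
  inpNames_le := h.inpNames_le
  calls_subset := h.calls_subset
  scope x hx := by
    by_cases hxr : x = r
    · subst hxr
      exact .inr (Multiset.mem_add.2 (.inl (Multiset.mem_of_le h.resNames_le (by simp [Proc.resNames]))))
    · exact h.scope x (hx.imp_left fun hx => by simp [Proc.fn, hxr, hx])
  fresh x hx := by
    by_cases hxr : x = r
    · subst hxr
      have := h.boundNames_nodup hF
      simp only [boundNames, Proc.resNames, Proc.inpNames, Multiset.cons_add,
        Multiset.nodup_cons] at this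
      exact this.1
    · have := h.fresh x (hx.imp_left fun hx => by simp [Proc.fn, hxr, hx])
      simp only [boundNames, Proc.resNames, Proc.inpNames, Multiset.cons_add,
        Multiset.mem_cons, not_or] at this
      exact this.2
  disjoint x hx hl := by
    by_cases hxr : x = r
    · subst hxr
      exact h.fresh x (.inr hl) (by simp [boundNames, Proc.resNames])
    · exact h.disjoint x (by simp [Proc.fn, hxr, hx]) hl
  nodup := h.nodup

theorem ThreadInv.res_facts {b : Fin F.n ⊕ I} {r : N} {S : Proc N I} {l : List N}
    (h : ThreadInv New F b (.res r S) l) :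
    r ∈ F.RESTR ∧ r ∈ S.fn ∧ r ∉ l ∧ F.Scope b r :=
  have hr : r ∈ (F.bodyAt b).resNames := Multiset.mem_of_le h.resNames_le (by simp [Proc.resNames])
  ⟨resNames_bodyAt_subset hr, h.bindersUsed.1,
    fun hl => h.fresh r (.inr hl) (by simp [boundNames, Proc.resNames]),
    .inr (Multiset.mem_add.2 (.inl hr))⟩

section Choice

variable {b : Fin F.n ⊕ I} {n : ℕ} {act : Fin n → Act N} {cont : Fin n → Proc N I} {l : List N}

theorem fnUnder_subset (k : Fin n) :
    (act k).fnUnder (cont k).fn ⊆ (Proc.choice n act cont).fn :=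
  Finset.subset_biUnion_of_mem (fun i => (act i).fnUnder (cont i).fn) (Finset.mem_univ k)

theorem fn_cont_subset {k : Fin n} {x : N} (hx : x ∈ (cont k).fn) :
    x ∈ (Proc.choice n act cont).fn ∨ x ∈ (act k).binder := by
  by_cases h : x ∈ (act k).binder
  · exact .inr h
  · refine .inl (fnUnder_subset k ?_)
    cases ha : act k with
    | out a b => simp [Act.fnUnder, hx]
    | tau => simpa [Act.fnUnder] using hx
    | inp a y =>
      rw [ha] at h
      simp [Act.binder] at h
      simp [Act.fnUnder, hx, h]

theorem binder_le (k : Fin n) :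
    (act k).binder + (cont k).inpNames ≤ (Proc.choice n act cont).inpNames :=
  Finset.single_le_sum (f := fun i => (act i).binder + (cont i).inpNames)
    (fun _ _ => Multiset.zero_le _) (Finset.mem_univ k)

theorem resNames_cont_le (k : Fin n) :
    (cont k).resNames ≤ (Proc.choice n act cont).resNames :=
  Finset.single_le_sum (f := fun i => (cont i).resNames)
    (fun _ _ => Multiset.zero_le _) (Finset.mem_univ k)

theorem boundNames_cont_le (k : Fin n) :
    (act k).binder + boundNames (cont k) ≤ boundNames (Proc.choice n act cont) := by
  have := add_le_add (resNames_cont_le (act := act) (cont := cont) k)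
    (binder_le (act := act) (cont := cont) k)
  rw [boundNames, boundNames]
  convert this using 1
  abel

theorem ThreadInv.binder_facts (h : ThreadInv New F b (.choice n act cont) l) {k : Fin n} {a y : N}
    (ha : act k = .inp a y) :
    y ∈ F.INP ∧ y ∈ (cont k).fn ∧ y ∉ (Proc.choice n act cont).fn ∧ y ∉ l ∧ F.Scope b y := by
  have hb : y ∈ (act k).binder := by simp [ha, Act.binder]
  have h1 := Multiset.mem_of_le (binder_le (cont := cont) k) (Multiset.mem_add.2 (.inl hb))
  have h2 := Multiset.mem_of_le h.inpNames_le h1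
  have h3 : y ∈ boundNames (Proc.choice n act cont) := Multiset.mem_add.2 (.inr h1)
  exact ⟨inpNames_bodyAt_subset h2, (h.bindersUsed k).1 a y ha, fun h' => h.fresh y (.inl h') h3,
    fun h' => h.fresh y (.inr h') h3, .inr (Multiset.mem_add.2 (.inr h2))⟩

theorem mem_forget {P Q : Proc N I} {x : N} : x ∈ forget P Q ↔ x ∈ P.fn ∧ x ∉ Q.fn := by
  simp [forget]

theorem ThreadInv.choice (hF : F.NormalForm) (h : ThreadInv New F b (.choice n act cont) l)
    (k : Fin n)
    (hs : F.CNext New ⟨.thread (.choice n act cont), l⟩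
      ⟨.thread (cont k), l ++ forget (.choice n act cont) (cont k)⟩) :
    ThreadInv New F b (cont k) (l ++ forget (.choice n act cont) (cont k)) := by
  have hbound : ∀ x ∈ (act k).binder, x ∈ (F.bodyAt b).inpNames := fun x hx =>
    Multiset.mem_of_le ((binder_le k).trans h.inpNames_le) (Multiset.mem_add.2 (.inl hx))
  have hcase : ∀ x, x ∈ (cont k).fn ∨ x ∈ l ++ forget (.choice n act cont) (cont k) →
      (x ∈ (Proc.choice n act cont).fn ∨ x ∈ l) ∨ x ∈ (act k).binder := by
    intro x hx
    rw [List.mem_append, mem_forget] at hx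
    rcases hx with hx | hx | hx
    · exact (fn_cont_subset hx).imp_left .inl
    · exact .inl (.inr hx)
    · exact .inl (.inl hx.1)
  have hfresh : ∀ x ∈ (act k).binder, x ∉ (Proc.choice n act cont).fn ∧ x ∉ l := by
    intro x hx
    have hm : x ∈ boundNames (Proc.choice n act cont) :=
      Multiset.mem_of_le (boundNames_cont_le k) (Multiset.mem_add.2 (.inl hx))
    exact ⟨fun h' => h.fresh x (.inl h') hm, fun h' => h.fresh x (.inr h') hm⟩
  exact
  { derived := h.derived.tail ⟨(by rintro ⟨K, xs, h | h⟩ <;> cases h), hs⟩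
    isThread := h.isThread k
    arity := h.arity k
    stopFree := h.stopFree.2 k
    bindersUsed := (h.bindersUsed k).2
    resNames_le := (resNames_cont_le k).trans h.resNames_le
    inpNames_le := (le_add_of_nonneg_left (Multiset.zero_le _)).trans
      ((binder_le k).trans h.inpNames_le)
    calls_subset := subset_trans (Set.subset_iUnion (fun i => (cont i).calls) k) h.calls_subset
    scope := fun x hx => (hcase x hx).elim (h.scope x) fun hx =>
      .inr (Multiset.mem_add.2 (.inr (hbound x hx)))
    fresh := fun x hx => by
      rcases hcase x hx with hx | hx
      · exact fun h' => h.fresh x hx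
          (Multiset.mem_of_le (boundNames_cont_le k) (Multiset.mem_add.2 (.inr h')))
      · have := Multiset.nodup_of_le (boundNames_cont_le k) (h.boundNames_nodup hF)
        exact Multiset.disjoint_left.1 (Multiset.nodup_add.1 this).2.2 hx
    disjoint := fun x hx hl => by
      rw [List.mem_append, mem_forget] at hl
      rcases hl with hl | hl
      · rcases fn_cont_subset (act := act) hx with h' | h'
        · exact h.disjoint x h' hl
        · exact (hfresh x h').2 hl
      · exact hl.2 hx
    nodup := by
      refine h.nodup.append (Finset.nodup_toList _) fun x hx hx' => ?_
      exact h.disjoint x (mem_forget.1 hx').1 hx }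

end Choice

/-- The properties of the augmented processes reachable in the `i`-th control flow net. -/
inductive Good (New : Type w) (F : FCPSpec N I) (i : Fin F.n) : CState N I → Prop
  | thread {b S l} : F.Owns i b → ThreadInv New F b S l → Good New F i ⟨.thread S, l⟩
  | passing {b K xs l} : F.Owns i b → K ∈ (F.bodyAt b).calls → xs.length ≤ (F.params K).length →
      (∀ x, x ∈ xs ∨ x ∈ l → F.Scope b x) → l.Nodup → Good New F i ⟨.passing K xs, l⟩

/-- The properties of calls, not yet started or under execution. -/
structure CallInv (F : FCPSpec N I) (i : Fin F.n) (b : Fin F.n ⊕ I) (K : I) (xs l : List N) :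
    Prop where
  owns : F.Owns i b
  calls : K ∈ (F.bodyAt b).calls
  length_le : xs.length ≤ (F.params K).length
  scope : ∀ x, x ∈ xs ∨ x ∈ l → F.Scope b x
  nodup : l.Nodup

theorem Good.callInv {i : Fin F.n} {c : Ctl N I} {l : List N} (h : Good New F i ⟨c, l⟩) {K : I}
    {xs : List N} (hc : c.IsCallOf K xs) : ∃ b, CallInv F i b K xs l := by
  rcases hc with rfl | rfl
  · cases h with
    | @thread b _ _ ho h =>
      exact ⟨b, ho, h.calls_subset rfl, h.arity.le,
        fun x hx => h.scope x (by simpa [Proc.fn] using hx), h.nodup⟩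
  · cases h with
    | @passing b _ _ _ ho h1 h2 h3 h4 => exact ⟨b, ho, h1, h2, h3, h4⟩

theorem CallInv.good {i : Fin F.n} {b : Fin F.n ⊕ I} {K : I} {xs l : List N}
    (h : CallInv F i b K xs l) : Good New F i ⟨.passing K xs, l⟩ :=
  .passing h.owns h.calls h.length_le h.scope h.nodup

theorem CallInv.pass {i : Fin F.n} {b : Fin F.n ⊕ I} {K : I} {xs l : List N} {x : N}
    (h : CallInv F i b K (xs ++ [x]) l) :
    CallInv F i b K xs (if x ∈ l then l else l ++ [x]) where
  owns := h.owns
  calls := h.calls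
  length_le := by have := h.length_le; simp at this; omega
  scope y hy := h.scope y (by
    split_ifs at hy with hx
    · exact hy.imp_left fun hy => by simp [hy]
    · simp only [List.mem_append, List.mem_singleton] at hy ⊢
      tauto)
  nodup := by
    split_ifs with hx
    · exact h.nodup
    · exact h.nodup.append (by simp) (by simpa using hx)

theorem CallInv.unmap {i : Fin F.n} {b : Fin F.n ⊕ I} {K : I} {xs l : List N} {x : N}
    (h : CallInv F i b K xs (x :: l)) : CallInv F i b K xs l where
  owns := h.owns
  calls := h.calls
  length_le := h.length_le
  scope y hy := h.scope y (by simp only [List.mem_cons]; tauto)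
  nodup := (List.nodup_cons.1 h.nodup).2

theorem CallInv.ne_params (hF : F.NormalForm) {i : Fin F.n} {b : Fin F.n ⊕ I} {K : I}
    {xs l : List N} (h : CallInv F i b K xs l) {x : N} (hx : x ∈ xs ∨ x ∈ l) :
    x ∉ F.params K := by
  intro hK
  have : F.Scope (.inr K) x := .inl (by rw [bodyAt, Sum.elim_inr, hF.fn_body]; simpa using hK)
  exact hF.call_ne h.calls ((h.scope x hx).unique hF this)

theorem Good.step (hF : F.NormalForm) {i : Fin F.n} {s s' : CState N I} {L : SyncLabel N New}
    {C : Set (Cmd N New)} (h : Good New F i s) (hs : F.CStep s L C s') : Good New F i s' := by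
  have hn : F.CNext New s s' := ⟨L, C, hs⟩
  cases hs with
  | nu r S l n =>
    cases h with
    | thread ho h => exact .thread ho (h.res hF hn)
  | tau l ha =>
    cases h with
    | thread ho h => exact .thread ho (h.choice hF _ hn)
  | snd l a b ha =>
    cases h with
    | thread ho h => exact .thread ho (h.choice hF _ hn)
  | rcv l a b ha =>
    cases h with
    | thread ho h => exact .thread ho (h.choice hF _ hn)
  | call₁ l a hc hf =>
    obtain ⟨b, hb⟩ := h.callInv hc
    exact hb.pass.good
  | call₂ x l a hc =>
    obtain ⟨b, hb⟩ := h.callInv hc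
    exact hb.unmap.good
  | call₃ hc =>
    obtain ⟨b, hb⟩ := h.callInv hc
    exact .thread (hb.owns.calls hb.calls) (ThreadInv.init hF (.inr _))

theorem Good.init (hF : F.NormalForm) (i : Fin F.n) : Good New F i ⟨.thread (F.thread i), []⟩ :=
  .thread (b := .inl i) rfl (ThreadInv.init hF (.inl i))

/-- The names in use by the control part of an augmented process. -/
def ctlNames (F : FCPSpec N I) : Ctl N I → Finset N
  | .thread S => S.fn
  | .passing K xs => xs.toFinset ∪ ((F.params K).drop xs.length).toFinset

/-- The names that have to be mapped. -/
def live (F : FCPSpec N I) (s : CState N I) : Finset N := F.ctlNames s.ctl ∪ s.forgotten.toFinset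

theorem Good.scope (hF : F.NormalForm) {i : Fin F.n} {s : CState N I} (h : Good New F i s) {x : N}
    (hx : x ∈ F.live s) : ∃ b, F.Owns i b ∧ F.Scope b x := by
  cases h with
  | @thread b S l ho h =>
    simp only [live, ctlNames, Finset.mem_union, List.mem_toFinset] at hx
    exact ⟨b, ho, h.scope x hx⟩
  | @passing b K xs l ho h1 h2 h3 h4 =>
    simp only [live, ctlNames, Finset.mem_union, List.mem_toFinset] at hx
    rcases hx with (hx | hx) | hx
    · exact ⟨b, ho, h3 x (.inl hx)⟩
    · refine ⟨.inr K, ho.calls h1, .inl ?_⟩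
      rw [bodyAt, Sum.elim_inr, hF.fn_body, List.mem_toFinset]
      exact List.mem_of_mem_drop hx
    · exact ⟨b, ho, h3 x (.inr hx)⟩

/-- A name belonging to the scope of one thread is not in use by another thread. -/
theorem Good.notMem_live (hF : F.NormalForm) {i j : Fin F.n} (hij : i ≠ j) {s : CState N I}
    (h : Good New F j s) {b : Fin F.n ⊕ I} (hb : F.Owns i b) {x : N} (hx : F.Scope b x) :
    x ∉ F.live s := by
  intro hx'
  obtain ⟨b', hb', hx''⟩ := h.scope hF hx'
  obtain rfl := hx.unique hF hx''
  exact hij (hb.unique hF hb')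

end FCPSpec

section Moves

variable {X : Type*}

/-- The tokens on `A` are consumed and tokens on `B` are produced. -/
def Moves (A B : Set X) (m m' : X → ℕ) : Prop :=
  (∀ p ∈ A, 0 < m p) ∧ ∀ p, m' p = m p - A.indicator 1 p + B.indicator 1 p

theorem Moves.unique {A B : Set X} {m m' m'' : X → ℕ} (h : Moves A B m m') (h' : Moves A B m m'') :
    m' = m'' := funext fun p => (h.2 p).trans (h'.2 p).symm

end Moves

namespace FCPSpec

variable {N : Type u} {I : Type v} [DecidableEq N] [Infinite N] [Fintype I]
variable {F : FCPSpec N I} {New : Type w}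

/-- The places from which the commands in `C` consume tokens. -/
def cmdsPre (F : FCPSpec N I) (C : Set (Cmd N New)) : Set (SPlace N New) := ⋃ c ∈ C, F.cmdPre c

/-- The places on which the commands in `C` produce tokens. -/
def cmdsPost (F : FCPSpec N I) (C : Set (Cmd N New)) : Set (SPlace N New) := ⋃ c ∈ C, F.cmdPost c

theorem fires_implement_iff {X Y Y' : Type*} {W₁ : PetriNet (SPlace N New) Y'}
    {W₂ : CFNet N New X Y} {m : SPlace N New → ℕ} {c : X → ℕ} {t : Y}
    {M' : SPlace N New ⊕ X → ℕ} :
    (F.implement W₁ W₂).Fires (Sum.elim m c) t M' ↔ t ∈ W₂.T ∧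
      Moves (F.cmdsPre (W₂.cmds t)) (F.cmdsPost (W₂.cmds t)) m (M' ∘ Sum.inl) ∧
      Moves (W₂.pre t) (W₂.post t) c (M' ∘ Sum.inr) := by
  classical
  have e1 : ∀ (A : Set (SPlace N New)) (B : Set X) p,
      (Sum.inl '' A ∪ Sum.inr '' B : Set (SPlace N New ⊕ X)).indicator (1 : SPlace N New ⊕ X → ℕ) (Sum.inl p) =
        A.indicator 1 p := by
    intro A B p; simp [Set.indicator_apply]
  have e2 : ∀ (A : Set (SPlace N New)) (B : Set X) p,
      (Sum.inl '' A ∪ Sum.inr '' B : Set (SPlace N New ⊕ X)).indicator (1 : SPlace N New ⊕ X → ℕ) (Sum.inr p) =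
        B.indicator 1 p := by
    intro A B p; simp [Set.indicator_apply]
  unfold PetriNet.Fires Moves
  simp only [implement, Sum.forall, e1, e2, Sum.elim_inl, Sum.elim_inr, Function.comp, cmdsPre,
    cmdsPost]
  simp only [Set.mem_union, Set.mem_image, Sum.inl.injEq, exists_eq_right, reduceCtorEq, and_false,
    exists_false, or_false, Sum.inr.injEq, false_or]
  tauto

section Control

variable {n : ℕ} {X : Type*}

open Classical in
/-- The marking of the control flow nets, where the net `i` has one token on `s i`. -/
noncomputable def ctlMarking (s : Fin n → X) (p : Fin n × X) : ℕ := if s p.1 = p.2 then 1 else 0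

theorem ctlMarking_pos {s : Fin n → X} {p : Fin n × X} : 0 < ctlMarking s p ↔ s p.1 = p.2 := by
  unfold ctlMarking; split_ifs <;> simp [*]

theorem moves_ctl_single {s : Fin n → X} (i : Fin n) (x : X) :
    Moves (Prod.mk i '' {s i}) (Prod.mk i '' {x}) (ctlMarking s)
      (ctlMarking (Function.update s i x)) := by
  classical
  constructor
  · rintro _ ⟨_, rfl, rfl⟩
    simp [ctlMarking]
  · rintro ⟨j, y⟩
    by_cases hj : j = i
    · subst hj
      simp only [ctlMarking, Function.update_self, Set.image_singleton, Set.indicator_apply,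
        Set.mem_singleton_iff, Prod.mk.injEq, true_and, Pi.one_apply]
      by_cases h1 : s j = y <;> by_cases h2 : x = y <;> simp [h1, h2, eq_comm]
    · simp [ctlMarking, hj]

theorem moves_ctl_pair {s : Fin n → X} {i j : Fin n} (hij : i ≠ j) (x y : X) :
    Moves (Prod.mk i '' {s i} ∪ Prod.mk j '' {s j}) (Prod.mk i '' {x} ∪ Prod.mk j '' {y})
      (ctlMarking s) (ctlMarking (Function.update (Function.update s i x) j y)) := by
  classical
  constructor
  · rintro _ (⟨_, rfl, rfl⟩ | ⟨_, rfl, rfl⟩) <;> simp [ctlMarking]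
  · rintro ⟨k, z⟩
    by_cases hj : k = j
    · subst hj
      simp only [ctlMarking, Function.update_self, Set.image_singleton, Set.indicator_apply,
        Set.mem_union, Set.mem_singleton_iff, Prod.mk.injEq, true_and, hij.symm, false_and,
        false_or, Pi.one_apply]
      grind
    · by_cases hi : k = i
      · subst hi
        simp only [ctlMarking, Function.update_of_ne hj, Function.update_self,
          Set.image_singleton, Set.indicator_apply, Set.mem_union,
          Set.mem_singleton_iff, Prod.mk.injEq, true_and, hj, false_and, or_false, Pi.one_apply]
        grind
      · simp [ctlMarking, hj, hi]

end Control

section Environment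

variable {e : N → Option (Val N New)} {C : Set (Cmd N New)}

theorem eq_mem_cmdsPre {x : N} {a : Val N New} :
    SPlace.eq x a ∈ F.cmdsPre C ↔ .test x a ∈ C ∨ .unmap x a ∈ C := by
  simp only [cmdsPre, Set.mem_iUnion, exists_prop]
  constructor
  · rintro ⟨c, hc, h⟩
    rcases c with ⟨y, p | n⟩ | ⟨y, b⟩ | ⟨y, b⟩ <;> simp only [cmdPre] at h
    · simp at h
    · split_ifs at h <;> simp at h
    · obtain ⟨rfl, rfl⟩ : x = y ∧ a = b := by simpa using h
      exact .inr hc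
    · obtain ⟨rfl, rfl⟩ : x = y ∧ a = b := by simpa using h
      exact .inl hc
  · rintro (h | h)
    · exact ⟨_, h, rfl⟩
    · exact ⟨_, h, rfl⟩

theorem ne_mem_cmdsPre {x : N} {n : New} :
    SPlace.ne x n ∈ F.cmdsPre C ↔
      ∃ y, .map y (.new n) ∈ C ∧ (y ∈ F.RESTR ∧ x ∈ F.INP ∪ F.FRM ∨ y ∉ F.RESTR ∧ x = y) := by
  simp only [cmdsPre, Set.mem_iUnion, exists_prop]
  constructor
  · rintro ⟨c, hc, h⟩
    rcases c with ⟨y, p | n⟩ | ⟨y, b⟩ | ⟨y, b⟩ <;> simp only [cmdPre] at h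
    · simp at h
    · split_ifs at h with hy
      · simp only [Set.singleton_union, Set.mem_insert_iff, reduceCtorEq, Set.mem_ofPred_eq,
          SPlace.ne.injEq, false_or] at h
        obtain ⟨z, hz, rfl, rfl⟩ := h
        exact ⟨y, hc, .inl ⟨hy, hz⟩⟩
      · obtain ⟨rfl, rfl⟩ : x = y ∧ _ = _ := by simpa using h
        exact ⟨x, hc, .inr ⟨hy, rfl⟩⟩
    · simp at h
    · simp at h
  · rintro ⟨y, hc, ⟨hy, hx⟩ | ⟨hy, rfl⟩⟩
    · refine ⟨_, hc, ?_⟩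
      simp only [cmdPre, if_pos hy]
      exact .inr ⟨x, hx, rfl⟩
    · exact ⟨_, hc, by simp only [cmdPre, if_neg hy]; rfl⟩

theorem neStar_mem_cmdsPre {n : New} :
    SPlace.neStar n ∈ F.cmdsPre C ↔ ∃ y ∈ F.RESTR, .map y (.new n) ∈ C := by
  simp only [cmdsPre, Set.mem_iUnion, exists_prop]
  constructor
  · rintro ⟨c, hc, h⟩
    rcases c with ⟨y, p | n⟩ | ⟨y, b⟩ | ⟨y, b⟩ <;> simp only [cmdPre] at h
    · simp at h
    · split_ifs at h with hy
      · obtain rfl : _ = _ := by simpa using h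
        exact ⟨y, hy, hc⟩
      · simp at h
    · simp at h
    · simp at h
  · rintro ⟨y, hy, hc⟩
    refine ⟨_, hc, ?_⟩
    simp only [cmdPre, if_pos hy]
    exact .inl rfl

theorem eq_mem_cmdsPost {x : N} {a : Val N New} :
    SPlace.eq x a ∈ F.cmdsPost C ↔ .test x a ∈ C ∨ .map x a ∈ C := by
  simp only [cmdsPost, Set.mem_iUnion, exists_prop]
  constructor
  · rintro ⟨c, hc, h⟩
    rcases c with ⟨y, p | n⟩ | ⟨y, p | n⟩ | ⟨y, b⟩ <;> simp only [cmdPost] at h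
    · obtain ⟨rfl, rfl⟩ : x = y ∧ a = _ := by simpa using h
      exact .inr hc
    · split_ifs at h <;> obtain ⟨rfl, rfl⟩ : x = y ∧ a = _ := by simpa using h
      · exact .inr hc
      · exact .inr hc
    · simp at h
    · split_ifs at h <;> simp at h
    · obtain ⟨rfl, rfl⟩ : x = y ∧ a = b := by simpa using h
      exact .inl hc
  · rintro (h | h)
    · exact ⟨_, h, rfl⟩
    · refine ⟨_, h, ?_⟩
      cases a with
      | pub p => rfl
      | new n =>
        simp only [cmdPost]
        split_ifs
        · exact .inl rfl
        · rfl

theorem ne_mem_cmdsPost {x : N} {n : New} :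
    SPlace.ne x n ∈ F.cmdsPost C ↔
      (∃ y ∈ F.RESTR, .map y (.new n) ∈ C ∧ x ∈ F.INP ∪ F.FRM) ∨
        x ∉ F.RESTR ∧ .unmap x (.new n) ∈ C := by
  simp only [cmdsPost, Set.mem_iUnion, exists_prop]
  constructor
  · rintro ⟨c, hc, h⟩
    rcases c with ⟨y, p | n⟩ | ⟨y, p | n⟩ | ⟨y, b⟩ <;> simp only [cmdPost] at h
    · simp at h
    · split_ifs at h with hy
      · simp only [Set.singleton_union, Set.mem_insert_iff, reduceCtorEq, Set.mem_ofPred_eq,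
          SPlace.ne.injEq, false_or] at h
        obtain ⟨z, hz, rfl, rfl⟩ := h
        exact .inl ⟨y, hy, hc, hz⟩
      · simp at h
    · simp at h
    · split_ifs at h with hy
      · simp at h
      · obtain ⟨rfl, rfl⟩ : x = y ∧ _ = _ := by simpa using h
        exact .inr ⟨hy, hc⟩
    · simp at h
  · rintro (⟨y, hy, hc, hx⟩ | ⟨hx, hc⟩)
    · refine ⟨_, hc, ?_⟩
      simp only [cmdPost, if_pos hy]
      exact .inr ⟨x, hx, rfl⟩
    · exact ⟨_, hc, by simp only [cmdPost, if_neg hx]; rfl⟩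

theorem neStar_mem_cmdsPost {n : New} :
    SPlace.neStar n ∈ F.cmdsPost C ↔ ∃ y ∈ F.RESTR, .unmap y (.new n) ∈ C := by
  simp only [cmdsPost, Set.mem_iUnion, exists_prop]
  constructor
  · rintro ⟨c, hc, h⟩
    rcases c with ⟨y, p | n⟩ | ⟨y, p | n⟩ | ⟨y, b⟩ <;> simp only [cmdPost] at h
    · simp at h
    · split_ifs at h with hy <;> simp at h
    · simp at h
    · split_ifs at h with hy
      · obtain rfl : _ = _ := by simpa using h
        exact ⟨y, hy, hc⟩
      · simp at h
    · simp at h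
  · rintro ⟨y, hy, hc⟩
    exact ⟨_, hc, by simp only [cmdPost, if_pos hy]; rfl⟩

open Classical in
/-- The marking of the substitution net that represents `e`. -/
noncomputable def envMarking (F : FCPSpec N I) (e : N → Option (Val N New)) : SPlace N New → ℕ
  | .eq x a => if e x = some a then 1 else 0
  | .ne x n => if x ∈ F.INP ∪ F.FRM ∧ e x ≠ some (.new n) then 1 else 0
  | .neStar n => if ∃ r ∈ F.RESTR, e r = some (.new n) then 0 else 1

/-- The environment `e` assigns admissible values, and different values to different restricted
names. -/
structure EnvInv (F : FCPSpec N I) (e : N → Option (Val N New)) : Prop where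
  inDom : ∀ x a, e x = some a → F.InDom x a
  inj : ∀ r ∈ F.RESTR, ∀ r' ∈ F.RESTR, ∀ a, e r = some a → e r' = some a → r = r'

theorem envMarking_eq_pos {x : N} {a : Val N New} :
    0 < F.envMarking e (.eq x a) ↔ e x = some a := by
  simp only [envMarking]; split_ifs <;> simp [*]

theorem test_of_moves {m' : SPlace N New → ℕ}
    (h : Moves (F.cmdsPre C) (F.cmdsPost C) (F.envMarking e) m') {x : N} {a : Val N New}
    (hc : .test x a ∈ C) : e x = some a :=
  envMarking_eq_pos.1 (h.1 _ (eq_mem_cmdsPre.2 (.inl hc)))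

theorem unmap_of_moves {m' : SPlace N New → ℕ}
    (h : Moves (F.cmdsPre C) (F.cmdsPost C) (F.envMarking e) m') {x : N} {a : Val N New}
    (hc : .unmap x a ∈ C) : e x = some a :=
  envMarking_eq_pos.1 (h.1 _ (eq_mem_cmdsPre.2 (.inr hc)))

theorem fresh_of_moves (he : EnvInv F e) {m' : SPlace N New → ℕ}
    (h : Moves (F.cmdsPre C) (F.cmdsPost C) (F.envMarking e) m') {r : N} {n : New}
    (hr : r ∈ F.RESTR) (hc : .map r (.new n) ∈ C) (y : N) : e y ≠ some (.new n) := by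
  intro hy
  have hdom : y ∈ F.INP ∪ F.FRM ∪ F.RESTR := he.inDom y _ hy
  rcases Finset.mem_union.1 hdom with hd | hd
  · have := h.1 _ (ne_mem_cmdsPre.2 ⟨r, hc, .inl ⟨hr, hd⟩⟩)
    simp [envMarking, hy] at this
  · have := h.1 _ (neStar_mem_cmdsPre.2 ⟨r, hr, hc⟩)
    simp only [envMarking] at this
    rw [if_pos ⟨y, hd, hy⟩] at this
    simp at this

theorem moves_tests (hm : ∀ x a, .map x a ∉ C) (hu : ∀ x a, .unmap x a ∉ C)
    (ht : ∀ x a, .test x a ∈ C → e x = some a) :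
    Moves (F.cmdsPre C) (F.cmdsPost C) (F.envMarking e) (F.envMarking e) := by
  classical
  constructor
  · rintro (⟨x, a⟩ | ⟨x, n⟩ | n) hp
    · simp only [eq_mem_cmdsPre, hu, or_false] at hp
      exact envMarking_eq_pos.2 (ht x a hp)
    · simp [ne_mem_cmdsPre, hm] at hp
    · simp [neStar_mem_cmdsPre, hm] at hp
  · rintro (⟨x, a⟩ | ⟨x, n⟩ | n)
    · simp only [Set.indicator_apply, eq_mem_cmdsPre, eq_mem_cmdsPost, hm, hu, or_false]
      split_ifs with h
      · simp [envMarking, ht x a h]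
      · simp
    · simp [ne_mem_cmdsPre, ne_mem_cmdsPost, hm, hu]
    · simp [neStar_mem_cmdsPre, neStar_mem_cmdsPost, hm, hu]

theorem moves_map (hF : F.NormalForm) {x : N} {a : Val N New}
    (hx : x ∈ F.INP ∪ F.FRM ∪ F.RESTR) (hex : e x = none)
    (hfresh : x ∈ F.RESTR → ∀ n, a = .new n → ∀ y, e y ≠ some (.new n))
    (hm : ∀ y b, .map y b ∈ C ↔ y = x ∧ b = a) (hu : ∀ x a, .unmap x a ∉ C)
    (ht : ∀ x a, .test x a ∈ C → e x = some a) :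
    Moves (F.cmdsPre C) (F.cmdsPost C) (F.envMarking e)
      (F.envMarking (Function.update e x (some a))) := by
  classical
  have hxr : x ∉ F.RESTR → x ∈ F.INP ∪ F.FRM := fun h => (Finset.mem_union.1 hx).resolve_right h
  constructor
  · rintro (⟨y, b⟩ | ⟨y, n⟩ | n) hp
    · simp only [eq_mem_cmdsPre, hu, or_false] at hp
      exact envMarking_eq_pos.2 (ht y b hp)
    · obtain ⟨z, hz, h⟩ := ne_mem_cmdsPre.1 hp
      obtain ⟨rfl, ha⟩ := (hm z _).1 hz
      rcases h with ⟨hz, hy⟩ | ⟨hz, rfl⟩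
      · simp only [envMarking]
        rw [if_pos ⟨hy, hfresh hz n ha.symm y⟩]
        exact one_pos
      · simp only [envMarking]
        rw [if_pos ⟨hxr hz, by simp [hex]⟩]
        exact one_pos
    · obtain ⟨z, hz, h⟩ := neStar_mem_cmdsPre.1 hp
      obtain ⟨rfl, ha⟩ := (hm z _).1 h
      simp only [envMarking]
      rw [if_neg]
      · exact one_pos
      · rintro ⟨y, -, hy⟩
        exact hfresh hz n ha.symm y hy
  · rintro (⟨y, b⟩ | ⟨y, n⟩ | n)
    · simp only [Set.indicator_apply, eq_mem_cmdsPre, eq_mem_cmdsPost, hm, hu, or_false, envMarking,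
        Pi.one_apply]
      by_cases hy : y = x
      · subst hy
        have h1 : Cmd.test y b ∉ C := fun h => by rw [ht _ _ h] at hex; cases hex
        simp only [Function.update_self, h1, hex, false_or, true_and, if_false, reduceCtorEq,
          Option.some.injEq, eq_comm (a := b)]
        simp
      · simp only [ne_eq, hy, not_false_eq_true, Function.update_of_ne, false_and, or_false]
        by_cases h1 : Cmd.test y b ∈ C
        · simp [ht _ _ h1, h1]
        · simp [h1]
    · have hpre : SPlace.ne y n ∈ F.cmdsPre C ↔ a = .new n ∧
          (x ∈ F.RESTR ∧ y ∈ F.INP ∪ F.FRM ∨ x ∉ F.RESTR ∧ y = x) := by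
        rw [ne_mem_cmdsPre]
        constructor
        · rintro ⟨z, hz, h⟩
          obtain ⟨rfl, ha⟩ := (hm z _).1 hz
          exact ⟨ha.symm, h⟩
        · rintro ⟨ha, h⟩
          exact ⟨x, (hm _ _).2 ⟨rfl, ha.symm⟩, h⟩
      have hpost : SPlace.ne y n ∈ F.cmdsPost C ↔ a = .new n ∧ x ∈ F.RESTR ∧ y ∈ F.INP ∪ F.FRM := by
        simp only [ne_mem_cmdsPost, hu, and_false, or_false]
        constructor
        · rintro ⟨z, hz, h, hy⟩
          obtain ⟨rfl, ha⟩ := (hm z _).1 h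
          exact ⟨ha.symm, hz, hy⟩
        · rintro ⟨ha, h, hy⟩
          exact ⟨x, h, (hm _ _).2 ⟨rfl, ha.symm⟩, hy⟩
      simp only [Set.indicator_apply, hpre, hpost, envMarking, Pi.one_apply]
      by_cases ha : a = .new n
      · by_cases hr : x ∈ F.RESTR
        · by_cases hy : y ∈ F.INP ∪ F.FRM
          · have hyx : y ≠ x := by rintro rfl; exact hF.disjoint_RESTR y hy hr
            simp [ha, hr, hyx, hfresh hr n ha y]
          · simp [hy, hr]
        · by_cases hy : y = x
          · subst hy
            simp [ha, hr]
            grind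
          · simp [hy, hr]
      · by_cases hy : y = x
        · subst hy
          simp [ha, hex]
        · simp [ha, hy]
    · have hpre : SPlace.neStar n ∈ F.cmdsPre C ↔ a = .new n ∧ x ∈ F.RESTR := by
        rw [neStar_mem_cmdsPre]
        constructor
        · rintro ⟨z, hz, h⟩
          obtain ⟨rfl, ha⟩ := (hm z _).1 h
          exact ⟨ha.symm, hz⟩
        · rintro ⟨ha, h⟩
          exact ⟨x, h, (hm _ _).2 ⟨rfl, ha.symm⟩⟩
      have hpost : SPlace.neStar n ∉ F.cmdsPost C := by simp [neStar_mem_cmdsPost, hu]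
      simp only [Set.indicator_apply, hpre, hpost, envMarking, Pi.one_apply, if_false, add_zero]
      by_cases h : a = .new n ∧ x ∈ F.RESTR
      · rw [if_pos h, if_pos ⟨x, h.2, by simp [h.1]⟩]
        split_ifs <;> rfl
      · rw [if_neg h, Nat.sub_zero]
        congr 1
        refine propext (exists_congr fun r => and_congr_right fun hr => ?_)
        by_cases hrx : r = x
        · subst hrx
          have : a ≠ .new n := fun ha => h ⟨ha, hr⟩
          simp [this, hex]
        · simp [hrx]

theorem moves_unmap (hF : F.NormalForm) (he : EnvInv F e) {x : N} {a : Val N New}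
    (hex : e x = some a) (hm : ∀ x a, .map x a ∉ C) (hu : ∀ y b, .unmap y b ∈ C ↔ y = x ∧ b = a)
    (ht : ∀ x a, .test x a ∉ C) :
    Moves (F.cmdsPre C) (F.cmdsPost C) (F.envMarking e)
      (F.envMarking (Function.update e x none)) := by
  classical
  constructor
  · rintro (⟨y, b⟩ | ⟨y, n⟩ | n) hp
    · simp only [eq_mem_cmdsPre, hu, ht, false_or] at hp
      obtain ⟨rfl, rfl⟩ := hp
      exact envMarking_eq_pos.2 hex
    · simp [ne_mem_cmdsPre, hm] at hp
    · simp [neStar_mem_cmdsPre, hm] at hp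
  · rintro (⟨y, b⟩ | ⟨y, n⟩ | n)
    · simp only [Set.indicator_apply, eq_mem_cmdsPre, eq_mem_cmdsPost, hm, hu, ht, or_false, envMarking,
        Pi.one_apply]
      by_cases hy : y = x
      · subst hy
        simp [hex, eq_comm]
      · simp [hy]
    · simp only [Set.indicator_apply, ne_mem_cmdsPre, ne_mem_cmdsPost, hm, hu, envMarking,
        Pi.one_apply, false_and, and_false, exists_false, if_false, false_or, Nat.sub_zero]
      by_cases hy : y = x
      · subst hy
        by_cases ha : a = .new n
        · subst ha
          by_cases hr : y ∈ F.RESTR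
          · have : y ∉ F.INP ∪ F.FRM := fun h => hF.disjoint_RESTR y h hr
            simp [this, hr]
          · have : y ∈ F.INP ∪ F.FRM :=
              (Finset.mem_union.1 (he.inDom y _ hex)).resolve_right hr
            simp [this, hr, hex]
        · simp [hex, ha, eq_comm (a := Val.new n)]
      · simp [hy]
    · have hpost : SPlace.neStar n ∈ F.cmdsPost C ↔ a = .new n ∧ x ∈ F.RESTR := by
        rw [neStar_mem_cmdsPost]
        constructor
        · rintro ⟨z, hz, h⟩
          obtain ⟨rfl, ha⟩ := (hu z _).1 h
          exact ⟨ha.symm, hz⟩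
        · rintro ⟨ha, h⟩
          exact ⟨x, h, (hu _ _).2 ⟨rfl, ha.symm⟩⟩
      have hpre : SPlace.neStar n ∉ F.cmdsPre C := by simp [neStar_mem_cmdsPre, hm]
      simp only [Set.indicator_apply, hpre, hpost, envMarking, Pi.one_apply, if_false, Nat.sub_zero]
      by_cases h : a = .new n ∧ x ∈ F.RESTR
      · have hneg : ¬ ∃ r ∈ F.RESTR, Function.update e x none r = some (.new n) := by
          rintro ⟨r, hr, hrn⟩
          by_cases hrx : r = x
          · subst hrx; simp at hrn
          · rw [Function.update_of_ne hrx] at hrn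
            exact hrx (he.inj r hr x h.2 _ hrn (by rw [hex, h.1]))
        have hpos : ∃ r ∈ F.RESTR, e r = some (.new n) := ⟨x, h.2, by rw [hex, h.1]⟩
        rw [if_pos h, if_pos hpos, if_neg hneg, zero_add]
      · rw [if_neg h, add_zero]
        congr 1
        refine propext (exists_congr fun r => and_congr_right fun hr => ?_)
        by_cases hrx : r = x
        · subst hrx
          have : a ≠ .new n := fun ha => h ⟨ha, hr⟩
          simp [this, hex]
        · simp [hrx]

end Environment

end FCPSpec

namespace FCPSpec

variable {N : Type u} {I : Type v} [DecidableEq N] [Infinite N] [Fintype I]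
variable {F : FCPSpec N I} {New : Type w}

/-- The invariant of the pairs of states of the control flow nets and environments that represent
reachable markings. -/
structure Conf (F : FCPSpec N I) (s : Fin F.n → CState N I) (e : N → Option (Val N New)) : Prop where
  good : ∀ i, Good New F i (s i)
  reach : ∀ i, ReflTransGen (F.CNext New) ⟨.thread (F.thread i), []⟩ (s i)
  isSome : ∀ x, (e x).isSome ↔ ∃ i, x ∈ F.live (s i)
  env : EnvInv F e

/-- The marking that represents `s` and `e`. -/
noncomputable def marking (F : FCPSpec N I) (s : Fin F.n → CState N I)
    (e : N → Option (Val N New)) : SPlace N New ⊕ (Fin F.n × CState N I) → ℕ :=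
  Sum.elim (F.envMarking e) (ctlMarking s)

/-- The steps between reachable markings, in terms of control states and environments. -/
inductive MStep (F : FCPSpec N I) (s : Fin F.n → CState N I) (e : N → Option (Val N New)) :
    (Fin F.n → CState N I) → (N → Option (Val N New)) → Prop
  | nu {i r S l n} : s i = ⟨.thread (.res r S), l⟩ → (∀ y, e y ≠ some (.new n)) →
      MStep F s e (Function.update s i ⟨.thread S, l⟩) (Function.update e r (some (.new n)))
  | tau {i m l} {act : Fin m → Act N} {cont : Fin m → Proc N I} {k : Fin m} :
      s i = ⟨.thread (.choice m act cont), l⟩ → act k = .tau →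
      MStep F s e (Function.update s i
        ⟨.thread (cont k), l ++ forget (.choice m act cont) (cont k)⟩) e
  | pass {i c l K xs x f a} : s i = ⟨c, l⟩ → c.IsCallOf K (xs ++ [x]) →
      (F.params K)[xs.length]? = some f → e x = some a →
      MStep F s e (Function.update s i ⟨.passing K xs, if x ∈ l then l else l ++ [x]⟩)
        (Function.update e f (some a))
  | unmap {i c x l K a} : s i = ⟨c, x :: l⟩ → c.IsCallOf K [] → e x = some a →
      MStep F s e (Function.update s i ⟨.passing K [], l⟩) (Function.update e x none)
  | start {i c K} : s i = ⟨c, []⟩ → c.IsCallOf K [] →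
      MStep F s e (Function.update s i ⟨.thread (F.body K), []⟩) e
  | comm {i j m l m' l'} {act : Fin m → Act N} {cont : Fin m → Proc N I} {k : Fin m}
      {act' : Fin m' → Act N} {cont' : Fin m' → Proc N I} {k' : Fin m'} {x y x' z a b} : i ≠ j →
      s i = ⟨.thread (.choice m act cont), l⟩ → s j = ⟨.thread (.choice m' act' cont'), l'⟩ →
      act k = .inp x y → act' k' = .out x' z → e x = some a → e x' = some a → e z = some b →
      MStep F s e (Function.update (Function.update s i
          ⟨.thread (cont k), l ++ forget (.choice m act cont) (cont k)⟩) j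
          ⟨.thread (cont' k'), l' ++ forget (.choice m' act' cont') (cont' k')⟩)
        (Function.update e y (some b))

section Live

variable {i : Fin F.n}

theorem Good.ctlNames_eq {c : Ctl N I} {l : List N} {K : I} {xs : List N}
    (h : Good New F i ⟨c, l⟩) (hc : c.IsCallOf K xs) :
    F.ctlNames c = xs.toFinset ∪ ((F.params K).drop xs.length).toFinset := by
  rcases hc with rfl | rfl
  · cases h with
    | thread ho h =>
      have : xs.length = (F.params K).length := h.arity
      simp [ctlNames, Proc.fn, this]
  · rfl

theorem live_choice {m : ℕ} {act : Fin m → Act N} {cont : Fin m → Proc N I} {k : Fin m}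
    {l : List N} (h : (act k).binder = 0) :
    F.live ⟨.thread (cont k), l ++ forget (.choice m act cont) (cont k)⟩ =
      F.live ⟨.thread (.choice m act cont), l⟩ := by
  ext x
  simp only [live, ctlNames, Finset.mem_union, List.mem_toFinset, List.mem_append, mem_forget]
  have : x ∈ (cont k).fn → x ∈ (Proc.choice m act cont).fn := fun hx =>
    (fn_cont_subset (act := act) hx).resolve_right (by simp [h])
  tauto

theorem live_inp {b : Fin F.n ⊕ I} {m : ℕ} {act : Fin m → Act N} {cont : Fin m → Proc N I}
    {k : Fin m} {l : List N} (h : ThreadInv New F b (.choice m act cont) l) {x y : N}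
    (ha : act k = .inp x y) :
    F.live ⟨.thread (cont k), l ++ forget (.choice m act cont) (cont k)⟩ =
      insert y (F.live ⟨.thread (.choice m act cont), l⟩) := by
  ext x
  simp only [live, ctlNames, Finset.mem_union, List.mem_toFinset, List.mem_append, mem_forget,
    Finset.mem_insert]
  have h1 : x ∈ (cont k).fn → x ∈ (Proc.choice m act cont).fn ∨ x = y := fun hx =>
    (fn_cont_subset (act := act) hx).imp_right (by simp [ha, Act.binder])
  have h2 : x = y → x ∈ (cont k).fn := by rintro rfl; exact (h.binder_facts ha).2.1
  tauto

theorem live_res {b : Fin F.n ⊕ I} {r : N} {S : Proc N I} {l : List N}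
    (h : ThreadInv New F b (.res r S) l) :
    F.live ⟨.thread S, l⟩ = insert r (F.live ⟨.thread (.res r S), l⟩) := by
  ext x
  simp only [live, ctlNames, Finset.mem_union, List.mem_toFinset, Finset.mem_insert, Proc.fn,
    Finset.mem_erase]
  have h2 : x = r → x ∈ S.fn := by rintro rfl; exact h.res_facts.2.1
  tauto

theorem live_pass {c : Ctl N I} {l : List N} {K : I} {xs : List N} {x f : N}
    (h : Good New F i ⟨c, l⟩) (hc : c.IsCallOf K (xs ++ [x]))
    (hf : (F.params K)[xs.length]? = some f) :
    F.live ⟨.passing K xs, if x ∈ l then l else l ++ [x]⟩ = insert f (F.live ⟨c, l⟩) := by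
  have hdrop : (F.params K).drop xs.length = f :: (F.params K).drop (xs.length + 1) := by
    obtain ⟨hlt, rfl⟩ := List.getElem?_eq_some_iff.1 hf
    exact List.drop_eq_getElem_cons hlt
  ext y
  simp only [live, h.ctlNames_eq hc]
  simp only [ctlNames, hdrop, Finset.mem_union, List.mem_toFinset, Finset.mem_insert,
    List.mem_cons, List.mem_append, List.length_append, List.length_singleton, List.not_mem_nil,
    or_false]
  split_ifs with hx
  · by_cases hy : y = x
    · subst hy; simp [hx]
    · tauto
  · simp only [List.mem_append, List.mem_singleton]
    tauto

theorem notMem_live_pass (hF : F.NormalForm) {c : Ctl N I} {l : List N} {K : I} {xs : List N}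
    {x f : N} (h : Good New F i ⟨c, l⟩) (hc : c.IsCallOf K (xs ++ [x]))
    (hf : (F.params K)[xs.length]? = some f) : f ∉ F.live ⟨c, l⟩ := by
  obtain ⟨b, hb⟩ := h.callInv hc
  obtain ⟨hlt, rfl⟩ := List.getElem?_eq_some_iff.1 hf
  have hmem : (F.params K)[xs.length] ∈ F.params K := List.getElem_mem hlt
  have hdrop := List.drop_eq_getElem_cons hlt
  have hnd := (hF.params_nodup K).sublist (List.drop_sublist xs.length _)
  rw [hdrop, List.nodup_cons] at hnd
  simp only [live, h.ctlNames_eq hc, Finset.mem_union, List.mem_toFinset,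
    List.length_append, List.length_singleton]
  rintro ((h1 | h1) | h1)
  · exact hb.ne_params hF (.inl h1) hmem
  · exact hnd.1 h1
  · exact hb.ne_params hF (.inr h1) hmem

theorem live_unmap (hF : F.NormalForm) {c : Ctl N I} {l : List N} {K : I} {x : N}
    (h : Good New F i ⟨c, x :: l⟩) (hc : c.IsCallOf K []) :
    F.live ⟨.passing K [], l⟩ = (F.live ⟨c, x :: l⟩).erase x := by
  obtain ⟨b, hb⟩ := h.callInv hc
  have h1 : x ∉ F.params K := hb.ne_params hF (.inr (by simp))
  have h2 : x ∉ l := (List.nodup_cons.1 hb.nodup).1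
  ext y
  simp only [live, h.ctlNames_eq hc]
  simp only [ctlNames, Finset.mem_union, List.mem_toFinset, Finset.mem_erase, List.mem_cons,
    List.length_nil, List.drop_zero]
  by_cases hy : y = x
  · subst hy; simp [h1, h2]
  · simp [hy]

theorem live_start (hF : F.NormalForm) {c : Ctl N I} {K : I}
    (h : Good New F i ⟨c, []⟩) (hc : c.IsCallOf K []) :
    F.live ⟨.thread (F.body K), []⟩ = F.live ⟨c, []⟩ := by
  simp only [live, h.ctlNames_eq hc]
  simp [ctlNames, hF.fn_body]

end Live

section Conf

variable {s : Fin F.n → CState N I} {e : N → Option (Val N New)}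

theorem Conf.eq_none (hF : F.NormalForm) (h : Conf F s e) {i : Fin F.n} {b : Fin F.n ⊕ I}
    (hb : F.Owns i b) {x : N} (hx : F.Scope b x) (hi : x ∉ F.live (s i)) : e x = none := by
  by_contra hne
  obtain ⟨j, hj⟩ := (h.isSome x).1 (Option.isSome_iff_ne_none.2 hne)
  by_cases hij : i = j
  · subst hij; exact hi hj
  · exact (h.good j).notMem_live hF hij hb hx hj

theorem Conf.exists_eq_some (h : Conf F s e) {i : Fin F.n} {x : N} (hx : x ∈ F.live (s i)) :
    ∃ a, e x = some a := Option.isSome_iff_exists.1 ((h.isSome x).2 ⟨i, hx⟩)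

theorem exists_live_update {i : Fin F.n} {t : CState N I} {x : N} :
    (∃ j, x ∈ F.live (Function.update s i t j)) ↔
      x ∈ F.live t ∨ ∃ j, j ≠ i ∧ x ∈ F.live (s j) := by
  constructor
  · rintro ⟨j, hj⟩
    by_cases hji : j = i
    · subst hji; exact .inl (by simpa using hj)
    · exact .inr ⟨j, hji, by simpa [hji] using hj⟩
  · rintro (h | ⟨j, hji, hj⟩)
    · exact ⟨i, by simpa using h⟩
    · exact ⟨j, by simpa [hji] using hj⟩

theorem exists_live_split {i : Fin F.n} {x : N} :
    (∃ j, x ∈ F.live (s j)) ↔ x ∈ F.live (s i) ∨ ∃ j, j ≠ i ∧ x ∈ F.live (s j) := by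
  conv_lhs => rw [← Function.update_eq_self i s]
  exact exists_live_update

theorem EnvInv.map (he : EnvInv F e) {x : N} {a : Val N New} (ha : F.InDom x a)
    (hfresh : x ∈ F.RESTR → ∀ y, e y ≠ some a) : EnvInv F (Function.update e x (some a)) where
  inDom y b h := by
    by_cases hy : y = x
    · subst hy; obtain rfl : a = b := by simpa using h
      exact ha
    · exact he.inDom y b (by simpa [hy] using h)
  inj r hr r' hr' b h h' := by
    by_cases h1 : r = x <;> by_cases h2 : r' = x
    · rw [h1, h2]
    · subst h1
      obtain rfl : a = b := by simpa using h
      exact absurd (by simpa [h2] using h') (hfresh hr r')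
    · subst h2
      obtain rfl : a = b := by simpa using h'
      exact absurd (by simpa [h1] using h) (hfresh hr' r)
    · exact he.inj r hr r' hr' b (by simpa [h1] using h) (by simpa [h2] using h')

theorem EnvInv.unmap (he : EnvInv F e) (x : N) : EnvInv F (Function.update e x none) where
  inDom y b h := by
    by_cases hy : y = x
    · subst hy; simp at h
    · exact he.inDom y b (by simpa [hy] using h)
  inj r hr r' hr' b h h' := by
    by_cases h1 : r = x
    · subst h1; simp at h
    · by_cases h2 : r' = x
      · subst h2; simp at h'
      · exact he.inj r hr r' hr' b (by simpa [h1] using h) (by simpa [h2] using h')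

theorem EnvInv.mem_PUB (he : EnvInv F e) {x p : N} (h : e x = some (.pub p)) : p ∈ F.PUB :=
  (he.inDom x _ h).1

theorem inDom_of_mem {x : N} {a : Val N New} (hx : x ∈ F.INP ∪ F.FRM)
    (ha : ∀ p, a = .pub p → p ∈ F.PUB) : F.InDom x a := by
  cases a with
  | pub p => exact ⟨ha p rfl, hx⟩
  | new n => exact Finset.mem_union_left _ hx

theorem Conf.inDom_of_eq (h : Conf F s e) {x y : N} {a : Val N New} (hy : y ∈ F.INP ∪ F.FRM)
    (hx : e x = some a) : F.InDom y a :=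
  inDom_of_mem hy fun _ hp => h.env.mem_PUB (hp ▸ hx)

theorem Conf.update (hF : F.NormalForm) (h : Conf F s e) {i : Fin F.n} {t : CState N I}
    {L : SyncLabel N New} {C : Set (Cmd N New)} (hs : F.CStep (s i) L C t)
    {e' : N → Option (Val N New)} (he : EnvInv F e')
    (hl : ∀ x, (e' x).isSome ↔ x ∈ F.live t ∨ ∃ j, j ≠ i ∧ x ∈ F.live (s j)) :
    Conf F (Function.update s i t) e' where
  good j := by
    by_cases hj : j = i
    · subst hj; rw [Function.update_self]; exact (h.good j).step hF hs
    · rw [Function.update_of_ne hj]; exact h.good j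
  reach j := by
    by_cases hj : j = i
    · subst hj; rw [Function.update_self]; exact (h.reach j).tail ⟨L, C, hs⟩
    · rw [Function.update_of_ne hj]; exact h.reach j
  isSome x := (hl x).trans exists_live_update.symm
  env := he

theorem Conf.update_same (hF : F.NormalForm) (h : Conf F s e) {i : Fin F.n} {t : CState N I}
    {L : SyncLabel N New} {C : Set (Cmd N New)} (hs : F.CStep (s i) L C t)
    (hl : F.live t = F.live (s i)) : Conf F (Function.update s i t) e :=
  h.update hF hs h.env fun x => by rw [hl, ← exists_live_split]; exact h.isSome x

theorem isSome_update_some {x y : N} {a : Val N New} :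
    (Function.update e x (some a) y).isSome ↔ y = x ∨ (e y).isSome := by
  by_cases hy : y = x
  · subst hy; simp
  · simp [hy]

theorem Conf.update_map (hF : F.NormalForm) (h : Conf F s e) {i : Fin F.n} {t : CState N I}
    {L : SyncLabel N New} {C : Set (Cmd N New)} (hs : F.CStep (s i) L C t) {x : N} {a : Val N New}
    (ha : F.InDom x a) (hfresh : x ∈ F.RESTR → ∀ y, e y ≠ some a)
    (hl : F.live t = insert x (F.live (s i))) :
    Conf F (Function.update s i t) (Function.update e x (some a)) :=
  h.update hF hs (h.env.map ha hfresh) fun y => by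
    rw [hl, isSome_update_some, h.isSome, exists_live_split (i := i), Finset.mem_insert, or_assoc]

/-- The facts about the name bound by a restriction or an input prefix that is executed next. -/
theorem Conf.res_facts (hF : F.NormalForm) (h : Conf F s e) {i : Fin F.n} {r : N} {S : Proc N I}
    {l : List N} (hi : s i = ⟨.thread (.res r S), l⟩) :
    r ∈ F.RESTR ∧ e r = none ∧ (∀ j, j ≠ i → r ∉ F.live (s j)) ∧
      F.live ⟨.thread S, l⟩ = insert r (F.live (s i)) := by
  have hg := h.good i
  rw [hi] at hg
  cases hg with
  | thread ho ht =>
    obtain ⟨h1, h2, h3, h4⟩ := ht.res_facts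
    refine ⟨h1, h.eq_none hF ho h4 ?_, fun j hj => (h.good j).notMem_live hF hj.symm ho h4, ?_⟩
    · rw [hi]; simp [live, ctlNames, Proc.fn, h3]
    · rw [hi]; exact live_res ht

theorem Conf.inp_facts (hF : F.NormalForm) (h : Conf F s e) {i : Fin F.n} {m : ℕ}
    {act : Fin m → Act N} {cont : Fin m → Proc N I} {k : Fin m} {l : List N} {x y : N}
    (hi : s i = ⟨.thread (.choice m act cont), l⟩) (ha : act k = .inp x y) :
    y ∈ F.INP ∪ F.FRM ∧ e y = none ∧ (∀ j, j ≠ i → y ∉ F.live (s j)) ∧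
      F.live ⟨.thread (cont k), l ++ forget (.choice m act cont) (cont k)⟩ =
        insert y (F.live (s i)) := by
  have hg := h.good i
  rw [hi] at hg
  cases hg with
  | thread ho ht =>
    obtain ⟨h1, h2, h3, h4, h5⟩ := ht.binder_facts ha
    refine ⟨Finset.mem_union_left _ h1, h.eq_none hF ho h5 ?_,
      fun j hj => (h.good j).notMem_live hF hj.symm ho h5, ?_⟩
    · rw [hi]; simp [live, ctlNames, h3, h4]
    · rw [hi]; exact live_inp ht ha

theorem Conf.pass_facts (hF : F.NormalForm) (h : Conf F s e) {i : Fin F.n} {c : Ctl N I}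
    {l : List N} {K : I} {xs : List N} {x f : N} (hi : s i = ⟨c, l⟩)
    (hc : c.IsCallOf K (xs ++ [x])) (hf : (F.params K)[xs.length]? = some f) :
    f ∈ F.INP ∪ F.FRM ∧ e f = none ∧ (∀ j, j ≠ i → f ∉ F.live (s j)) ∧
      F.live ⟨.passing K xs, if x ∈ l then l else l ++ [x]⟩ = insert f (F.live (s i)) := by
  have hg := h.good i
  rw [hi] at hg
  obtain ⟨b, hb⟩ := hg.callInv hc
  have hfK : f ∈ (F.bodyAt (.inr K)).fn := by
    rw [bodyAt, Sum.elim_inr, hF.fn_body, List.mem_toFinset]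
    exact List.mem_of_getElem? hf
  have ho := hb.owns.calls hb.calls
  refine ⟨Finset.mem_union_right _ (hF.fn_bodyAt_subset _ hfK), h.eq_none hF ho (.inl hfK) ?_,
    fun j hj => (h.good j).notMem_live hF hj.symm ho (.inl hfK), ?_⟩
  · rw [hi]; exact notMem_live_pass hF hg hc hf
  · rw [hi]; exact live_pass hg hc hf

theorem Conf.unmap_facts (hF : F.NormalForm) (h : Conf F s e) {i : Fin F.n} {c : Ctl N I}
    {l : List N} {K : I} {x : N} (hi : s i = ⟨c, x :: l⟩) (hc : c.IsCallOf K []) :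
    x ∉ F.params K ∧ (∀ j, j ≠ i → x ∉ F.live (s j)) ∧
      F.live ⟨.passing K [], l⟩ = (F.live (s i)).erase x := by
  have hg := h.good i
  rw [hi] at hg
  obtain ⟨b, hb⟩ := hg.callInv hc
  refine ⟨hb.ne_params hF (.inr (by simp)),
    fun j hj => (h.good j).notMem_live hF hj.symm hb.owns (hb.scope x (.inr (by simp))), ?_⟩
  rw [hi]; exact live_unmap hF hg hc

/-- Every step preserves the invariant. -/
theorem MStep.conf (hF : F.NormalForm) (h : Conf F s e) {s' : Fin F.n → CState N I}
    {e' : N → Option (Val N New)} (hs : MStep F s e s' e') : Conf F s' e' := by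
  cases hs with
  | @nu i r S l n hi hn =>
    obtain ⟨h1, h2, h3, h4⟩ := h.res_facts hF hi
    exact h.update_map hF (hi ▸ CStep.nu r S l n) (Finset.mem_union_right _ h1) (fun _ => hn) h4
  | @tau i m l act cont k hi ha =>
    exact h.update_same hF (hi ▸ CStep.tau l ha) (hi ▸ live_choice (by simp [ha, Act.binder]))
  | @pass i c l K xs x f a hi hc hf hx =>
    obtain ⟨h1, h2, h3, h4⟩ := h.pass_facts hF hi hc hf
    have hd := h.inDom_of_eq h1 hx
    exact h.update_map hF (hi ▸ CStep.call₁ l a hc hf (h.env.inDom x a hx) hd) hd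
      (fun hr => absurd hr (hF.disjoint_RESTR f h1)) h4
  | @unmap i c x l K a hi hc hx =>
    obtain ⟨h1, h2, h3⟩ := h.unmap_facts hF hi hc
    refine h.update hF (hi ▸ CStep.call₂ x l a hc (h.env.inDom x a hx)) (h.env.unmap x) fun y => ?_
    rw [h3, Finset.mem_erase]
    by_cases hy : y = x
    · subst hy
      simpa using fun j hj => h2 j hj
    · rw [Function.update_of_ne hy, h.isSome, exists_live_split (i := i)]
      simp [hy]
  | @start i c K hi hc =>
    have hg := h.good i
    rw [hi] at hg
    exact h.update_same hF (hi ▸ CStep.call₃ hc) (hi ▸ live_start hF hg hc)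
  | @comm i j m l m' l' act cont k act' cont' k' x y x' z a b hij hi hj ha ha' hx hx' hz =>
    obtain ⟨h1, h2, h3, h4⟩ := h.inp_facts hF hi ha
    have hd := h.inDom_of_eq h1 hz
    have hc1 := h.update_map hF
      (hi ▸ CStep.rcv (i := k) l a b ha (h.env.inDom x a hx) hd) hd
      (fun hr => absurd hr (hF.disjoint_RESTR y h1)) h4
    have hj' : Function.update s i
        ⟨.thread (cont k), l ++ forget (.choice m act cont) (cont k)⟩ j =
          ⟨.thread (.choice m' act' cont'), l'⟩ := by rw [Function.update_of_ne hij.symm, hj]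
    exact hc1.update_same hF
      (hj' ▸ CStep.snd (i := k') l' a b ha' (h.env.inDom x' a hx') (h.env.inDom z b hz))
      (hj' ▸ live_choice (by simp [ha', Act.binder]))

end Conf

end FCPSpec

namespace FCPSpec

variable {N : Type u} {I : Type v} [DecidableEq N] [Infinite N] [Fintype I]
variable {F : FCPSpec N I} {New : Type w}
variable {s : Fin F.n → CState N I} {e : N → Option (Val N New)}

theorem moves_map_restr (hF : F.NormalForm) {r : N} {n : New} (hr : r ∈ F.RESTR)
    (her : e r = none) (hn : ∀ y, e y ≠ some (.new n)) :
    Moves (F.cmdsPre {.map r (.new n)}) (F.cmdsPost {.map r (.new n)}) (F.envMarking e)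
      (F.envMarking (Function.update e r (some (.new n)))) := by
  refine moves_map hF (Finset.mem_union_right _ hr) her ?_ (by simp) (by simp) (by simp)
  rintro - m ⟨⟩
  exact hn

theorem moves_test_map (hF : F.NormalForm) {x y : N} {a : Val N New} (hx : e x = some a)
    (hy : y ∈ F.INP ∪ F.FRM) (hey : e y = none) :
    Moves (F.cmdsPre {.test x a, .map y a}) (F.cmdsPost {.test x a, .map y a}) (F.envMarking e)
      (F.envMarking (Function.update e y (some a))) := by
  refine moves_map hF (Finset.mem_union_left _ hy) hey
    (fun hr => absurd hr (hF.disjoint_RESTR y hy)) (by simp) (by simp) fun z b h => ?_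
  obtain ⟨rfl, rfl⟩ : z = x ∧ b = a := by simpa using h
  exact hx

theorem moves_comm (hF : F.NormalForm) {x x' y z : N} {a b : Val N New} (hx : e x = some a)
    (hx' : e x' = some a) (hz : e z = some b) (hy : y ∈ F.INP ∪ F.FRM) (hey : e y = none) :
    Moves (F.cmdsPre ({.test x' a, .test z b} ∪ {.test x a, .map y b}))
      (F.cmdsPost ({.test x' a, .test z b} ∪ {.test x a, .map y b})) (F.envMarking e)
      (F.envMarking (Function.update e y (some b))) := by
  refine moves_map hF (Finset.mem_union_left _ hy) hey
    (fun hr => absurd hr (hF.disjoint_RESTR y hy)) (by simp) (by simp) fun w c h => ?_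
  have : w = x ∧ c = a ∨ w = x' ∧ c = a ∨ w = z ∧ c = b := by simpa using h
  rcases this with ⟨rfl, rfl⟩ | ⟨rfl, rfl⟩ | ⟨rfl, rfl⟩ <;> assumption

theorem moves_unmap_singleton (hF : F.NormalForm) (he : EnvInv F e) {x : N} {a : Val N New}
    (hx : e x = some a) :
    Moves (F.cmdsPre {.unmap x a}) (F.cmdsPost {.unmap x a}) (F.envMarking e)
      (F.envMarking (Function.update e x none)) :=
  moves_unmap hF he hx (by simp) (by simp) (by simp)

theorem moves_empty (e : N → Option (Val N New)) :
    Moves (F.cmdsPre ∅) (F.cmdsPost ∅) (F.envMarking e) (F.envMarking e) :=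
  moves_tests (by simp) (by simp) (by simp)

theorem fires_inl_iff {M₀ : SPlace N New → ℕ} {i : Fin F.n} {t : CTrans N I New}
    {M' : SPlace N New ⊕ (Fin F.n × CState N I) → ℕ} :
    (F.net M₀).Fires (F.marking s e) (.inl (i, t)) M' ↔
      ((ReflTransGen (F.CNext New) ⟨.thread (F.thread i), []⟩ t.src ∧
        F.CStep t.src t.label t.cmds t.tgt) ∧ t.label = .tau) ∧
      Moves (F.cmdsPre t.cmds) (F.cmdsPost t.cmds) (F.envMarking e) (M' ∘ Sum.inl) ∧
      Moves (Prod.mk i '' {t.src}) (Prod.mk i '' {t.tgt}) (ctlMarking s) (M' ∘ Sum.inr) :=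
  fires_implement_iff

theorem fires_inr_iff {M₀ : SPlace N New → ℕ} {i j : Fin F.n} {t t' : CTrans N I New}
    {M' : SPlace N New ⊕ (Fin F.n × CState N I) → ℕ} :
    (F.net M₀).Fires (F.marking s e) (.inr ((i, t), (j, t'))) M' ↔
      ((i ≠ j ∧ (ReflTransGen (F.CNext New) ⟨.thread (F.thread i), []⟩ t.src ∧
          F.CStep t.src t.label t.cmds t.tgt) ∧
        (ReflTransGen (F.CNext New) ⟨.thread (F.thread j), []⟩ t'.src ∧
          F.CStep t'.src t'.label t'.cmds t'.tgt) ∧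
        ∃ a b, t.label = .send a b ∧ t'.label = .recv a b) ∧ SyncLabel.tau = SyncLabel.tau (N := N)
          (New := New)) ∧
      Moves (F.cmdsPre (t.cmds ∪ t'.cmds)) (F.cmdsPost (t.cmds ∪ t'.cmds)) (F.envMarking e)
        (M' ∘ Sum.inl) ∧
      Moves (Prod.mk i '' {t.src} ∪ Prod.mk j '' {t'.src})
        (Prod.mk i '' {t.tgt} ∪ Prod.mk j '' {t'.tgt}) (ctlMarking s) (M' ∘ Sum.inr) :=
  fires_implement_iff

theorem Conf.step_single (h : Conf F s e) (M₀ : SPlace N New → ℕ) {i : Fin F.n} {t : CState N I}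
    {C : Set (Cmd N New)} (hs : F.CStep (s i) .tau C t) {e' : N → Option (Val N New)}
    (hm : Moves (F.cmdsPre C) (F.cmdsPost C) (F.envMarking e) (F.envMarking e')) :
    (F.net M₀).Step (F.marking s e) (F.marking (Function.update s i t) e') :=
  ⟨.inl (i, ⟨s i, .tau, C, t⟩), fires_inl_iff.2 ⟨⟨⟨h.reach i, hs⟩, rfl⟩, hm, moves_ctl_single i t⟩⟩

/-- The steps between control states and environments are steps of the net. -/
theorem MStep.step (hF : F.NormalForm) (h : Conf F s e) {s' : Fin F.n → CState N I}
    {e' : N → Option (Val N New)} (hs : MStep F s e s' e') (M₀ : SPlace N New → ℕ) :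
    (F.net M₀).Step (F.marking s e) (F.marking s' e') := by
  cases hs with
  | @nu i r S l n hi hn =>
    obtain ⟨h1, h2, -, -⟩ := h.res_facts hF hi
    exact h.step_single M₀ (hi ▸ CStep.nu r S l n) (moves_map_restr hF h1 h2 hn)
  | @tau i m l act cont k hi ha =>
    exact h.step_single M₀ (hi ▸ CStep.tau l ha) (moves_empty e)
  | @pass i c l K xs x f a hi hc hf hx =>
    obtain ⟨h1, h2, -, -⟩ := h.pass_facts hF hi hc hf
    exact h.step_single M₀
      (hi ▸ CStep.call₁ l a hc hf (h.env.inDom x a hx) (h.inDom_of_eq h1 hx))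
      (moves_test_map hF hx h1 h2)
  | @unmap i c x l K a hi hc hx =>
    exact h.step_single M₀ (hi ▸ CStep.call₂ x l a hc (h.env.inDom x a hx))
      (moves_unmap_singleton hF h.env hx)
  | @start i c K hi hc =>
    exact h.step_single M₀ (hi ▸ CStep.call₃ hc) (moves_empty e)
  | @comm i j m l m' l' act cont k act' cont' k' x y x' z a b hij hi hj ha ha' hx hx' hz =>
    obtain ⟨h1, h2, -, -⟩ := h.inp_facts hF hi ha
    have hsnd := CStep.snd (F := F) (i := k') (cont := cont') l' a b ha' (h.env.inDom x' a hx')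
      (h.env.inDom z b hz)
    have hrcv := CStep.rcv (F := F) (i := k) (cont := cont) l a b ha (h.env.inDom x a hx)
      (h.inDom_of_eq h1 hz)
    rw [← hj] at hsnd
    rw [← hi] at hrcv
    refine ⟨.inr ((j, ⟨s j, _, _, _⟩), (i, ⟨s i, _, _, _⟩)), fires_inr_iff.2
      ⟨⟨⟨hij.symm, ⟨h.reach j, hsnd⟩, ⟨h.reach i, hrcv⟩, a, b, rfl, rfl⟩, rfl⟩,
        moves_comm hF hx hx' hz h1 h2, ?_⟩⟩
    rw [Function.update_comm hij]
    exact moves_ctl_pair hij.symm _ _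

theorem src_of_moves {i : Fin F.n} {x : CState N I} {A : Set (Fin F.n × CState N I)}
    {B : Set (Fin F.n × CState N I)} {c : Fin F.n × CState N I → ℕ}
    (h : Moves A B (ctlMarking s) c) (hx : (i, x) ∈ A) : s i = x :=
  ctlMarking_pos.1 (h.1 _ hx)

theorem eq_marking {M' : SPlace N New ⊕ (Fin F.n × CState N I) → ℕ}
    {s' : Fin F.n → CState N I} {e' : N → Option (Val N New)}
    {A B : Set (SPlace N New)} {A' B' : Set (Fin F.n × CState N I)}
    (h₁ : Moves A B (F.envMarking e) (M' ∘ Sum.inl))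
    (h₁' : Moves A B (F.envMarking e) (F.envMarking e'))
    (h₂ : Moves A' B' (ctlMarking s) (M' ∘ Sum.inr))
    (h₂' : Moves A' B' (ctlMarking s) (ctlMarking s')) : M' = F.marking s' e' := by
  rw [marking, ← h₁.unique h₁', ← h₂.unique h₂', Sum.elim_comp_inl_inr]

/-- All steps of the net are steps between control states and environments. -/
theorem Conf.exists_mstep (hF : F.NormalForm) (h : Conf F s e) {M₀ : SPlace N New → ℕ}
    {M' : SPlace N New ⊕ (Fin F.n × CState N I) → ℕ}
    (hs : (F.net M₀).Step (F.marking s e) M') :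
    ∃ s' e', MStep F s e s' e' ∧ M' = F.marking s' e' := by
  obtain ⟨⟨i, src, L, C, tgt⟩ | ⟨⟨j, src', L', C', tgt'⟩, ⟨i, src, L, C, tgt⟩⟩, ht⟩ := hs
  · obtain ⟨⟨⟨-, hc⟩, hL⟩, hm, hm'⟩ := fires_inl_iff.1 ht
    dsimp only at hc hL hm hm'
    obtain rfl := src_of_moves hm' ⟨src, rfl, rfl⟩
    have hctl := moves_ctl_single (s := s) i tgt
    generalize hsi : s i = src at hc
    cases hc with
    | nu r S l n =>
      obtain ⟨h1, h2, -, -⟩ := h.res_facts hF hsi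
      have hn := fresh_of_moves h.env hm h1 rfl
      exact ⟨_, _, .nu hsi hn, eq_marking hm (moves_map_restr hF h1 h2 hn) hm' hctl⟩
    | tau l ha => exact ⟨_, _, .tau hsi ha, eq_marking hm (moves_empty e) hm' hctl⟩
    | snd => cases hL
    | rcv => cases hL
    | @call₁ c K xs x f l a hc hf _ _ =>
      have hx : e x = some a := test_of_moves hm (by simp)
      obtain ⟨h1, h2, -, -⟩ := h.pass_facts hF hsi hc hf
      exact ⟨_, _, .pass hsi hc hf hx, eq_marking hm (moves_test_map hF hx h1 h2) hm' hctl⟩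
    | @call₂ c K x l a hc _ =>
      have hx : e x = some a := unmap_of_moves hm rfl
      exact ⟨_, _, .unmap hsi hc hx, eq_marking hm (moves_unmap_singleton hF h.env hx) hm' hctl⟩
    | call₃ hc => exact ⟨_, _, .start hsi hc, eq_marking hm (moves_empty e) hm' hctl⟩
  · obtain ⟨⟨⟨hij, ⟨-, hc'⟩, ⟨-, hc⟩, a, b, hL', hL⟩, -⟩, hm, hm'⟩ := fires_inr_iff.1 ht
    dsimp only at hc hc' hL hL' hm hm'
    subst hL hL'
    obtain rfl := src_of_moves hm' (.inl ⟨src', rfl, rfl⟩)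
    obtain rfl := src_of_moves hm' (.inr ⟨src, rfl, rfl⟩)
    have hctl := moves_ctl_pair (s := s) hij tgt' tgt
    rw [Function.update_comm hij] at hctl
    generalize hsi : s i = src at hc
    generalize hsj : s j = src' at hc'
    cases hc with
    | @rcv m act cont k x y l _ _ ha _ _ =>
      cases hc' with
      | @snd m' act' cont' k' x' z l' _ _ ha' _ _ =>
        have hx : e x = some a := test_of_moves hm (by simp)
        have hx' : e x' = some a := test_of_moves hm (by simp)
        have hz : e z = some b := test_of_moves hm (by simp)
        obtain ⟨h1, h2, -, -⟩ := h.inp_facts hF hsi ha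
        exact ⟨_, _, .comm hij.symm hsi hsj ha ha' hx hx' hz,
          eq_marking hm (moves_comm hF hx hx' hz h1 h2) hm' hctl⟩

end FCPSpec

namespace FCPSpec

open Proc (cls Cls)

variable {N : Type u} {I : Type v} [DecidableEq N] [Infinite N] [Fintype I]
variable {F : FCPSpec N I} {New : Type w}
variable {s : Fin F.n → CState N I} {e : N → Option (Val N New)}

/-- The name that represents a value. -/
def valName (g : New → N) : Val N New → N
  | .pub p => p
  | .new n => g n

/-- The substitution given by an environment. -/
def valuation (g : New → N) (e : N → Option (Val N New)) (x : N) : N := (e x).elim x (valName g)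

/-- A call under execution is considered as the body of the equation. -/
noncomputable def toProc (F : FCPSpec N I) : Ctl N I → Proc N I
  | .thread S => S
  | .passing K xs => Proc.substList xs (F.params K) (F.body K)

/-- The class of the `i`-th thread. -/
noncomputable def ctlCls (F : FCPSpec N I) (g : New → N) (s : Fin F.n → CState N I)
    (e : N → Option (Val N New)) (i : Fin F.n) : Cls N I :=
  cls ((F.toProc (s i).ctl).subst (valuation g e))

/-- The class of the process represented by the marking given by `s` and `e`. -/
noncomputable def confCls [Fintype New] (F : FCPSpec N I) (g : New → N)
    (s : Fin F.n → CState N I) (e : N → Option (Val N New)) : Cls N I :=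
  Cls.nu (Finset.univ.image g) (∑ i, F.ctlCls g s e i)

theorem NormalForm.fn_body_subset (hF : F.NormalForm) (K : I) :
    (F.body K).fn ⊆ (F.params K).toFinset := (hF.fn_body K).le

theorem lookup_zip_cases {α β : Type*} [DecidableEq α] {y : α} :
    ∀ {ps : List α} {xs : List β}, y ∈ ps →
      (∃ a ∈ xs, (ps.zip xs).lookup y = some a) ∨
        ((ps.zip xs).lookup y = none ∧ y ∈ ps.drop xs.length)
  | [], _, h => by simp at h
  | p :: ps, [], h => .inr (by simpa using h)
  | p :: ps, x :: xs, h => by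
    by_cases hy : y = p
    · exact .inl ⟨x, by simp, by simp [hy]⟩
    · simp only [List.zip_cons_cons, List.lookup_cons, beq_false_of_ne hy, List.length_cons,
        List.drop_succ_cons]
      rcases lookup_zip_cases (ps := ps) (xs := xs) (by simpa [hy] using h) with ⟨a, ha, h'⟩ | h'
      · exact .inl ⟨a, by simp [ha], h'⟩
      · exact .inr h'

theorem fn_toProc_subset (hF : F.NormalForm) (c : Ctl N I) : (F.toProc c).fn ⊆ F.ctlNames c := by
  cases c with
  | thread S => exact subset_rfl
  | passing K xs =>
    simp only [toProc, Proc.substList, Proc.fn_subst, ctlNames, hF.fn_body]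
    intro z hz
    obtain ⟨y, hy, rfl⟩ := Finset.mem_image.1 hz
    rcases lookup_zip_cases (xs := xs) (List.mem_toFinset.1 hy) with ⟨a, ha, h⟩ | ⟨h, h'⟩
    · simp [h, ha]
    · simp [h, h']

theorem fn_toProc_subset_live (hF : F.NormalForm) (t : CState N I) :
    (F.toProc t.ctl).fn ⊆ F.live t :=
  (fn_toProc_subset hF t.ctl).trans Finset.subset_union_left

theorem valuation_eq {g : New → N} {x : N} {a : Val N New} (h : e x = some a) :
    valuation g e x = valName g a := by simp [valuation, h]

theorem valuation_update_some (g : New → N) (e : N → Option (Val N New)) (x : N) (a : Val N New) :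
    valuation g (Function.update e x (some a)) =
      Function.update (valuation g e) x (valName g a) := by
  funext y
  by_cases hy : y = x
  · subst hy; simp [valuation]
  · simp [valuation, hy]

theorem ctlCls_congr (hF : F.NormalForm) {g : New → N} {s' : Fin F.n → CState N I}
    {e' : N → Option (Val N New)} {i : Fin F.n} (hs : s' i = s i)
    (he : ∀ x ∈ F.live (s i), e' x = e x) : F.ctlCls g s' e' i = F.ctlCls g s e i := by
  unfold ctlCls
  rw [hs]
  congr 1
  exact Proc.subst_congr _ fun x hx => by
    simp only [valuation, he x (fn_toProc_subset_live hF _ hx)]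

section ConfCls

variable [Fintype New] {g : New → N}

theorem confCls_eq (s : Fin F.n → CState N I) (e : N → Option (Val N New)) (i : Fin F.n) :
    F.confCls g s e = Cls.nu (Finset.univ.image g)
      (F.ctlCls g s e i + ∑ j ∈ Finset.univ.erase i, F.ctlCls g s e j) := by
  rw [confCls, Finset.add_sum_erase _ _ (Finset.mem_univ i)]

theorem confCls_update (hF : F.NormalForm) {i : Fin F.n} {t : CState N I}
    {e' : N → Option (Val N New)} (he : ∀ j, j ≠ i → ∀ x ∈ F.live (s j), e' x = e x) :
    F.confCls g (Function.update s i t) e' = Cls.nu (Finset.univ.image g)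
      (cls ((F.toProc t.ctl).subst (valuation g e')) +
        ∑ j ∈ Finset.univ.erase i, F.ctlCls g s e j) := by
  rw [confCls_eq _ _ i]
  congr 2
  · simp [ctlCls]
  · refine Finset.sum_congr rfl fun j hj => ?_
    have hji := Finset.ne_of_mem_erase hj
    exact ctlCls_congr hF (Function.update_of_ne hji _ _) (he j hji)

theorem update_eq_of_notMem {x : N} {a : Option (Val N New)} {t : CState N I}
    (hx : x ∉ F.live t) : ∀ y ∈ F.live t, Function.update e x a y = e y := fun y hy =>
  Function.update_of_ne (by rintro rfl; exact hx hy) _ _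

theorem Conf.valuation_ne (h : Conf F s e) (hgP : ∀ n, g n ∉ F.PUB) (hg : Function.Injective g)
    {n : New} (hn : ∀ y, e y ≠ some (.new n)) {j : Fin F.n} {x : N} (hx : x ∈ F.live (s j)) :
    valuation g e x ≠ g n := by
  obtain ⟨a, ha⟩ := h.exists_eq_some hx
  rw [valuation_eq ha]
  cases a with
  | pub p =>
    intro hp
    exact hgP n (hp ▸ h.env.mem_PUB ha)
  | new m =>
    intro hm
    obtain rfl := hg hm
    exact hn x ha

theorem Conf.confCls_nu (hF : F.NormalForm) (h : Conf F s e) (hgP : ∀ n, g n ∉ F.PUB)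
    (hg : Function.Injective g) {i : Fin F.n} {r : N} {S : Proc N I} {l : List N} {n : New}
    (hi : s i = ⟨.thread (.res r S), l⟩) (hn : ∀ y, e y ≠ some (.new n)) :
    F.confCls g s e = F.confCls g (Function.update s i ⟨.thread S, l⟩)
      (Function.update e r (some (.new n))) := by
  obtain ⟨-, -, h3, -⟩ := h.res_facts hF hi
  rw [confCls_update hF fun j hj => update_eq_of_notMem (h3 j hj), confCls_eq _ _ i,
    valuation_update_some, ctlCls, hi]
  refine Cls.nu_subst_res (Finset.mem_image_of_mem _ (Finset.mem_univ n)) (fun hm => ?_)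
    (fun hm => ?_)
  · obtain ⟨x, hx, hxn⟩ := Finset.mem_image.1 hm
    refine h.valuation_ne hgP hg hn (j := i) (x := x) ?_ hxn
    rw [hi]
    exact Finset.mem_union_left _ hx
  · rw [Cls.fn_sum, Finset.mem_biUnion] at hm
    obtain ⟨j, -, hj⟩ := hm
    rw [ctlCls, Cls.fn_cls, Proc.fn_subst] at hj
    obtain ⟨x, hx, hxn⟩ := Finset.mem_image.1 hj
    exact h.valuation_ne hgP hg hn (fn_toProc_subset_live hF _ hx) hxn

theorem Conf.confCls_tau (hF : F.NormalForm) {i : Fin F.n} {t : CState N I} :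
    F.confCls g (Function.update s i t) e = Cls.nu (Finset.univ.image g)
      (cls ((F.toProc t.ctl).subst (valuation g e)) +
        ∑ j ∈ Finset.univ.erase i, F.ctlCls g s e j) :=
  confCls_update hF fun _ _ _ _ => rfl

theorem substList_nil (K : I) : Proc.substList [] (F.params K) (F.body K) = F.body K := by
  rw [Proc.substList]
  exact Proc.subst_eq_self fun x _ => by simp

theorem cls_pass (hF : F.NormalForm) {K : I} {xs : List N} {x f : N} {a : Val N New}
    (hf : (F.params K)[xs.length]? = some f) (hx : e x = some a) (hxs : f ∉ xs) :
    cls ((Proc.substList xs (F.params K) (F.body K)).subst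
        (valuation g (Function.update e f (some a)))) =
      cls ((Proc.substList (xs ++ [x]) (F.params K) (F.body K)).subst (valuation g e)) := by
  obtain ⟨hlt, hfe⟩ := List.getElem?_eq_some_iff.1 hf
  have hsplit : F.params K = (F.params K).take xs.length ++ f :: (F.params K).drop (xs.length + 1) := by
    rw [← hfe, ← List.drop_eq_getElem_cons hlt, List.take_append_drop]
  have hlen : ((F.params K).take xs.length).length = xs.length := by simp; omega
  have hnd := hF.params_nodup K
  generalize (F.params K).take xs.length = p₁ at *
  generalize (F.params K).drop (xs.length + 1) = p₂ at *
  have hz : (F.params K).zip xs = p₁.zip xs := by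
    conv_lhs => rw [hsplit, ← List.append_nil xs, List.zip_append hlen]
    simp
  have hz' : (F.params K).zip (xs ++ [x]) = p₁.zip xs ++ [(f, x)] := by
    rw [hsplit, List.zip_append hlen]; simp
  rw [Proc.substList, Proc.substList, Proc.subst_subst_cls, Proc.subst_subst_cls, hz, hz',
    valuation_update_some, ← valuation_eq hx]
  congr 1
  refine Proc.subst_congr _ fun y _ => ?_
  simp only [Function.comp, List.lookup_append]
  cases hy : (p₁.zip xs).lookup y with
  | some b =>
    have hb : b ∈ xs := by
      obtain ⟨l₁, l₂, h, -⟩ := List.lookup_eq_some_iff.1 hy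
      exact (List.of_mem_zip (h ▸ List.mem_append_right l₁ List.mem_cons_self)).2
    have : b ≠ f := by rintro rfl; exact hxs hb
    simp [this]
  | none =>
    by_cases hyf : y = f
    · subst hyf; simp
    · simp [hyf, List.lookup_cons, beq_false_of_ne hyf]

theorem cls_unmap (hF : F.NormalForm) {K : I} {x : N} (hx : x ∉ F.params K) (a) :
    cls ((Proc.substList [] (F.params K) (F.body K)).subst
        (valuation g (Function.update e x a))) =
      cls ((Proc.substList [] (F.params K) (F.body K)).subst (valuation g e)) := by
  congr 1
  refine Proc.subst_congr _ fun y hy => ?_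
  rw [substList_nil, hF.fn_body, List.mem_toFinset] at hy
  have : y ≠ x := by rintro rfl; exact hx hy
  simp [valuation, this]

/-- The class reached from the call `K⌊xs⌋` in the `i`-th thread. -/
noncomputable def callCls (F : FCPSpec N I) (g : New → N) (s : Fin F.n → CState N I)
    (e : N → Option (Val N New)) (i : Fin F.n) (K : I) (xs : List N) : Cls N I :=
  Cls.nu (Finset.univ.image g)
    (cls ((Proc.substList xs (F.params K) (F.body K)).subst (valuation g e)) +
      ∑ j ∈ Finset.univ.erase i, F.ctlCls g s e j)

theorem Conf.confCls_pass (hF : F.NormalForm) (h : Conf F s e) {i : Fin F.n} {c : Ctl N I}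
    {l : List N} {K : I} {xs : List N} {x f : N} {a : Val N New} (hi : s i = ⟨c, l⟩)
    (hc : c.IsCallOf K (xs ++ [x])) (hf : (F.params K)[xs.length]? = some f) (hx : e x = some a) :
    F.confCls g (Function.update s i ⟨.passing K xs, if x ∈ l then l else l ++ [x]⟩)
      (Function.update e f (some a)) = F.callCls g s e i K (xs ++ [x]) := by
  obtain ⟨-, -, h3, -⟩ := h.pass_facts hF hi hc hf
  have hg := h.good i
  rw [hi] at hg
  obtain ⟨b, hb⟩ := hg.callInv hc
  have hxs : f ∉ xs := fun hm =>
    hb.ne_params hF (x := f) (.inl (by simp [hm])) (List.mem_of_getElem? hf)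
  rw [confCls_update hF fun j hj => update_eq_of_notMem (h3 j hj), callCls,
    ← cls_pass hF hf hx hxs]
  rfl

theorem Conf.confCls_unmap (hF : F.NormalForm) (h : Conf F s e) {i : Fin F.n} {c : Ctl N I}
    {l : List N} {K : I} {x : N} (hi : s i = ⟨c, x :: l⟩) (hc : c.IsCallOf K []) :
    F.confCls g (Function.update s i ⟨.passing K [], l⟩) (Function.update e x none) =
      F.callCls g s e i K [] := by
  obtain ⟨h1, h2, -⟩ := h.unmap_facts hF hi hc
  rw [confCls_update hF fun j hj => update_eq_of_notMem (h2 j hj), callCls,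
    ← cls_unmap hF h1 none]
  rfl

theorem Conf.confCls_start (hF : F.NormalForm) {i : Fin F.n} {K : I} :
    F.confCls g (Function.update s i ⟨.thread (F.body K), []⟩) e = F.callCls g s e i K [] := by
  rw [confCls_update hF fun _ _ _ _ => rfl, callCls, substList_nil]
  rfl

/-- A call that has not yet started reacts, whereas the execution of a call is silent. -/
theorem Conf.callCls_cases (hF : F.NormalForm) (h : Conf F s e) {i : Fin F.n} {c : Ctl N I}
    {l : List N} {K : I} {xs : List N} (hi : s i = ⟨c, l⟩) (hc : c.IsCallOf K xs) :
    (¬ c.IsStable ∧ F.confCls g s e = F.callCls g s e i K xs) ∨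
      Cls.React F.params F.body (F.confCls g s e) (F.callCls g s e i K xs) := by
  rcases hc with rfl | rfl
  · right
    have hg := h.good i
    rw [hi] at hg
    cases hg with
    | thread ho ht =>
      rw [confCls_eq _ _ i, callCls, ctlCls, hi]
      exact ((Cls.react_call (hF.fn_body_subset K) ht.arity _).add_right _).nu _
  · left
    refine ⟨id, ?_⟩
    rw [confCls_eq _ _ i, callCls, ctlCls, hi]
    rfl

theorem Conf.confCls_comm (hF : F.NormalForm) (h : Conf F s e) {i j : Fin F.n} (hij : i ≠ j)
    {m m' : ℕ} {act : Fin m → Act N} {cont : Fin m → Proc N I} {k : Fin m} {l l' : List N}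
    {act' : Fin m' → Act N} {cont' : Fin m' → Proc N I} {k' : Fin m'} {x y x' z : N}
    {b : Val N New} (hi : s i = ⟨.thread (.choice m act cont), l⟩)
    (hj : s j = ⟨.thread (.choice m' act' cont'), l'⟩) (ha : act k = .inp x y)
    (ha' : act' k' = .out x' z) (hz : e z = some b) :
    F.confCls g (Function.update (Function.update s i
          ⟨.thread (cont k), l ++ forget (.choice m act cont) (cont k)⟩) j
          ⟨.thread (cont' k'), l' ++ forget (.choice m' act' cont') (cont' k')⟩)
        (Function.update e y (some b)) =
      Cls.nu (Finset.univ.image g)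
        (cls ((cont k).subst (Function.update (valuation g e) y (valuation g e z))) +
          (cls ((cont' k').subst (valuation g e)) +
            ∑ p ∈ (Finset.univ.erase i).erase j, F.ctlCls g s e p)) := by
  obtain ⟨-, -, h3, -⟩ := h.inp_facts hF hi ha
  rw [confCls_eq _ _ i, ← Finset.add_sum_erase (Finset.univ.erase i) _
    (Finset.mem_erase.2 ⟨hij.symm, Finset.mem_univ j⟩)]
  congr 2
  · simp [ctlCls, hij, toProc, valuation_update_some, valuation_eq hz]
  congr 1
  · simp only [ctlCls, Function.update_self, toProc]
    congr 1
    refine Proc.subst_congr _ fun w hw => ?_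
    rw [valuation_update_some, Function.update_of_ne]
    rintro rfl
    refine h3 j hij.symm ?_
    rw [hj]
    exact Finset.mem_union_left _ ((fn_cont_subset (act := act') hw).resolve_right
      (by simp [ha', Act.binder]))
  · refine Finset.sum_congr rfl fun p hp => ?_
    simp only [Finset.mem_erase] at hp
    exact ctlCls_congr hF (by simp [hp]) (update_eq_of_notMem (h3 p hp.2.1))

end ConfCls

end FCPSpec

namespace FCPSpec

open Proc (cls Cls)

variable {N : Type u} {I : Type v} [DecidableEq N] [Infinite N] [Fintype I]
variable {F : FCPSpec N I} {New : Type w} [Fintype New] {g : New → N}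
variable {s s' s'' : Fin F.n → CState N I} {e e' e'' : N → Option (Val N New)}

/-- Every step is silent or a reaction; it is a reaction if all threads are stable. -/
theorem MStep.confCls (hF : F.NormalForm) (h : Conf F s e) (hgP : ∀ n, g n ∉ F.PUB)
    (hg : Function.Injective g) (hs : MStep F s e s' e') :
    (¬ (∀ i, (s i).ctl.IsStable) ∧ F.confCls g s e = F.confCls g s' e') ∨
      Cls.React F.params F.body (F.confCls g s e) (F.confCls g s' e') := by
  cases hs with
  | @nu i r S l n hi hn =>
    refine .inl ⟨fun hst => ?_, h.confCls_nu hF hgP hg hi hn⟩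
    have := hst i
    rw [hi] at this
    exact this.elim id id
  | @tau i m l act cont k hi ha =>
    right
    rw [Conf.confCls_tau hF, confCls_eq _ _ i, ctlCls, hi]
    exact ((Cls.react_tau ha _).add_right _).nu _
  | @pass i c l K xs x f a hi hc hf hx =>
    rw [h.confCls_pass hF hi hc hf hx]
    exact (h.callCls_cases hF hi hc).imp_left fun h => ⟨fun hst => h.1 (by simpa [hi] using hst i), h.2⟩
  | @unmap i c x l K a hi hc hx =>
    rw [h.confCls_unmap hF hi hc]
    exact (h.callCls_cases hF hi hc).imp_left fun h => ⟨fun hst => h.1 (by simpa [hi] using hst i), h.2⟩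
  | @start i c K hi hc =>
    rw [Conf.confCls_start hF]
    exact (h.callCls_cases hF hi hc).imp_left fun h => ⟨fun hst => h.1 (by simpa [hi] using hst i), h.2⟩
  | @comm i j m l m' l' act cont k act' cont' k' x y x' z a b hij hi hj ha ha' hx hx' hz =>
    right
    rw [h.confCls_comm hF hij hi hj ha ha' hz, confCls_eq _ _ i,
      ← Finset.add_sum_erase (Finset.univ.erase i) _
        (Finset.mem_erase.2 ⟨hij.symm, Finset.mem_univ j⟩), ctlCls, ctlCls, hi, hj,
      ← add_assoc, ← add_assoc]
    refine ((Cls.react_comm ha ha' ?_).add_right _).nu _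
    rw [valuation_eq hx, valuation_eq hx']

theorem Good.exists_thread {i : Fin F.n} {t : CState N I} (h : Good New F i t)
    (hst : t.ctl.IsStable) : ∃ b S l, t = ⟨.thread S, l⟩ ∧ (S.IsChoice ∨ S.IsCall) ∧
      F.Owns i b ∧ ThreadInv New F b S l := by
  cases h with
  | @thread b S l ho ht => exact ⟨b, S, l, rfl, hst, ho, ht⟩
  | passing => exact hst.elim

theorem valName_injOn (he : EnvInv F e) (hgP : ∀ n, g n ∉ F.PUB) (hg : Function.Injective g)
    {x x' : N} {a a' : Val N New} (hx : e x = some a) (hx' : e x' = some a')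
    (h : valName g a = valName g a') : a = a' := by
  cases a with
  | pub p =>
    cases a' with
    | pub p' => exact congrArg Val.pub h
    | new n => exact absurd (he.mem_PUB hx) (by rw [show p = g n from h]; exact hgP n)
  | new n =>
    cases a' with
    | pub p' => exact absurd (he.mem_PUB hx') (by rw [show p' = g n from h.symm]; exact hgP n)
    | new n' => exact congrArg Val.new (hg h)

theorem fn_subset_live {i : Fin F.n} {S : Proc N I} {l : List N} (hi : s i = ⟨.thread S, l⟩) {x : N}
    (hx : x ∈ S.fn) : x ∈ F.live (s i) := by
  rw [hi]; exact Finset.mem_union_left _ hx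

theorem inp_mem_fn {m : ℕ} {act : Fin m → Act N} {cont : Fin m → Proc N I} {k : Fin m} {x y : N}
    (h : act k = .inp x y) : x ∈ (Proc.choice m act cont).fn :=
  fnUnder_subset k (by simp [h, Act.fnUnder])

theorem out_mem_fn {m : ℕ} {act : Fin m → Act N} {cont : Fin m → Proc N I} {k : Fin m} {x y : N}
    (h : act k = .out x y) :
    x ∈ (Proc.choice m act cont).fn ∧ y ∈ (Proc.choice m act cont).fn :=
  ⟨fnUnder_subset k (by simp [h, Act.fnUnder]), fnUnder_subset k (by simp [h, Act.fnUnder])⟩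

/-- If all threads are stable, every reaction is mimicked by a step. -/
theorem Conf.exists_mstep_of_react (hF : F.NormalForm) (h : Conf F s e)
    (hgP : ∀ n, g n ∉ F.PUB) (hg : Function.Injective g) (hst : ∀ i, (s i).ctl.IsStable)
    {q : Cls N I} (hq : Cls.React F.params F.body (F.confCls g s e) q) :
    ∃ s' e', MStep F s e s' e' ∧ q = F.confCls g s' e' := by
  choose b S l hs hS ho ht using fun i => (h.good i).exists_thread (hst i)
  have hto : ∀ i, F.toProc (s i).ctl = S i := fun i => by rw [hs]; rfl
  have hcls : ∀ i, cls ((S i).subst (valuation g e)) = F.ctlCls g s e i := fun i => by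
    rw [ctlCls, hto]
  have hq' : Cls.React F.params F.body (Cls.nu (Finset.univ.image g)
      (∑ i, cls ((S i).subst (valuation g e)))) q := by
    simpa only [hcls, FCPSpec.confCls] using hq
  rcases Proc.react_nu_sum_cases hF.fn_body_subset (fun i => ⟨hS i, (ht i).stopFree⟩) hq' with
    ⟨i, m, act, cont, k, hi, ha, rfl⟩ | ⟨i, K, as, hi, hl, rfl⟩ |
    ⟨i, j, m, m', act, cont, act', cont', k, k', x, y, x', z, hij, hi, hj, ha, ha', hx, rfl⟩
  · have hsi := hs i
    rw [hi] at hsi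
    refine ⟨_, _, .tau hsi ha, ?_⟩
    rw [Conf.confCls_tau hF]
    simp only [hcls]
    rfl
  · have hsi := hs i
    rw [hi] at hsi
    have hc : (Ctl.thread (.call K as) : Ctl N I).IsCallOf K as := .inl rfl
    simp only [hcls]
    change ∃ s' e', MStep F s e s' e' ∧ F.callCls g s e i K as = F.confCls g s' e'
    rcases List.eq_nil_or_concat as with rfl | ⟨xs, x, rfl⟩
    · cases hli : l i with
      | nil =>
        rw [hli] at hsi
        exact ⟨_, _, .start hsi hc, (Conf.confCls_start hF).symm⟩
      | cons x l' =>
        rw [hli] at hsi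
        obtain ⟨a, hxa⟩ := h.exists_eq_some (i := i) (x := x) (by rw [hsi]; simp [live])
        exact ⟨_, _, .unmap hsi hc hxa, (h.confCls_unmap hF hsi hc).symm⟩
    · rw [List.concat_eq_append] at *
      obtain ⟨a, hxa⟩ := h.exists_eq_some (i := i) (x := x)
        (fn_subset_live hsi (by simp [Proc.fn]))
      have hf : (F.params K)[xs.length]? = some ((F.params K)[xs.length]'(by simp at hl; omega)) :=
        List.getElem?_eq_getElem _
      exact ⟨_, _, .pass hsi hc hf hxa, (h.confCls_pass hF hsi hc hf hxa).symm⟩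
  · have hsi := hs i
    have hsj := hs j
    rw [hi] at hsi
    rw [hj] at hsj
    obtain ⟨a, hxa⟩ := h.exists_eq_some (fn_subset_live hsi (inp_mem_fn ha))
    obtain ⟨a', hxa'⟩ := h.exists_eq_some (fn_subset_live hsj (out_mem_fn ha').1)
    obtain ⟨c, hzc⟩ := h.exists_eq_some (fn_subset_live hsj (out_mem_fn ha').2)
    rw [valuation_eq hxa, valuation_eq hxa'] at hx
    obtain rfl := valName_injOn h.env hgP hg hxa hxa' hx
    refine ⟨_, _, .comm hij hsi hsj ha ha' hxa hxa' hzc, ?_⟩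
    rw [h.confCls_comm hF hij hsi hsj ha ha' hzc]
    simp only [hcls]

section Stabilize

theorem Conf.exists_fresh (hNew : F.RESTR.card + F.INP.card + F.FRM.card ≤ Fintype.card New)
    (h : Conf F s e) {r : N} (hr : r ∈ F.RESTR) (her : e r = none) :
    ∃ n : New, ∀ y, e y ≠ some (.new n) := by
  classical
  by_contra! hcon
  choose f hf using hcon
  have hinj : Function.Injective f := fun n m hnm => by
    have := (hf n).symm.trans (hnm ▸ hf m)
    simpa using this
  have hsub : Finset.univ.image f ⊆ (F.INP ∪ F.FRM ∪ F.RESTR).erase r := by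
    intro y hy
    obtain ⟨n, -, rfl⟩ := Finset.mem_image.1 hy
    refine Finset.mem_erase.2 ⟨fun hr => ?_, h.env.inDom _ _ (hf n)⟩
    have := hf n
    rw [hr, her] at this
    cases this
  have h1 := Finset.card_le_card hsub
  rw [Finset.card_image_of_injective _ hinj, Finset.card_univ] at h1
  have h2 := Finset.card_erase_lt_of_mem
    (show r ∈ F.INP ∪ F.FRM ∪ F.RESTR from Finset.mem_union_right _ hr)
  have h3 := Finset.card_union_le (F.INP ∪ F.FRM) F.RESTR
  have h4 := Finset.card_union_le F.INP F.FRM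
  omega

/-- Silent steps from `s`, `e` lead to `s'`, `e'`. -/
structure Silent (F : FCPSpec N I) (M₀ : SPlace N New → ℕ) (g : New → N)
    (s : Fin F.n → CState N I) (e : N → Option (Val N New))
    (s' : Fin F.n → CState N I) (e' : N → Option (Val N New)) : Prop where
  conf : Conf F s' e'
  steps : ReflTransGen (F.net M₀).Step (F.marking s e) (F.marking s' e')
  cls_eq : F.confCls g s e = F.confCls g s' e'

variable {M₀ : SPlace N New → ℕ}

theorem Silent.refl (h : Conf F s e) : Silent F M₀ g s e s e := ⟨h, .refl, rfl⟩

theorem Silent.trans (h : Silent F M₀ g s e s' e') (h' : Silent F M₀ g s' e' s'' e'') :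
    Silent F M₀ g s e s'' e'' :=
  ⟨h'.conf, h.steps.trans h'.steps, h.cls_eq.trans h'.cls_eq⟩

theorem MStep.silent (hF : F.NormalForm) (h : Conf F s e) (hs : MStep F s e s' e')
    (hc : F.confCls g s e = F.confCls g s' e') : Silent F M₀ g s e s' e' :=
  ⟨hs.conf hF h, .single (hs.step hF h M₀), hc⟩

/-- The `i`-th thread can be made stable by silent steps that do not affect the other threads. -/
def Stabilizes (F : FCPSpec N I) (M₀ : SPlace N New → ℕ) (g : New → N) (i : Fin F.n)
    (s : Fin F.n → CState N I) (e : N → Option (Val N New)) : Prop :=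
  ∃ s' e', Silent F M₀ g s e s' e' ∧ (s' i).ctl.IsStable ∧ ∀ j, j ≠ i → s' j = s j

theorem Stabilizes.of_silent {i : Fin F.n} {t : CState N I}
    (h : Silent F M₀ g s e (Function.update s i t) e')
    (h' : Stabilizes F M₀ g i (Function.update s i t) e') : Stabilizes F M₀ g i s e := by
  obtain ⟨s'', e'', h1, h2, h3⟩ := h'
  exact ⟨s'', e'', h.trans h1, h2, fun j hj => by rw [h3 j hj, Function.update_of_ne hj]⟩

theorem stabilizes_thread (hF : F.NormalForm) (hgP : ∀ n, g n ∉ F.PUB) (hg : Function.Injective g)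
    (hNew : F.RESTR.card + F.INP.card + F.FRM.card ≤ Fintype.card New)
    {i : Fin F.n} (S : Proc N I) : ∀ {l s} {e : N → Option (Val N New)},
    Conf F s e → s i = ⟨.thread S, l⟩ → Stabilizes F M₀ g i s e := by
  induction S with
  | call K as =>
    intro l s e h hi
    exact ⟨s, e, .refl h, by rw [hi]; exact .inr trivial, fun _ _ => rfl⟩
  | choice n act cont =>
    intro l s e h hi
    exact ⟨s, e, .refl h, by rw [hi]; exact .inl trivial, fun _ _ => rfl⟩
  | res r S ih =>
    intro l s e h hi
    obtain ⟨h1, h2, -, -⟩ := h.res_facts hF hi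
    obtain ⟨n, hn⟩ := h.exists_fresh hNew h1 h2
    have hs := (MStep.nu hi hn).silent (M₀ := M₀) hF h (h.confCls_nu hF hgP hg hi hn)
    exact .of_silent hs (ih hs.conf (Function.update_self _ _ _))
  | par P Q =>
    intro l s e h hi
    have := h.good i
    rw [hi] at this
    cases this with
    | thread ho ht => exact ht.isThread.elim

theorem stabilizes_passing_nil (hF : F.NormalForm) (hgP : ∀ n, g n ∉ F.PUB) (hg : Function.Injective g)
    (hNew : F.RESTR.card + F.INP.card + F.FRM.card ≤ Fintype.card New)
    {i : Fin F.n} {K : I} (l : List N) :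
    ∀ {s} {e : N → Option (Val N New)},
    Conf F s e → s i = ⟨.passing K [], l⟩ → Stabilizes F M₀ g i s e := by
  have hc : (Ctl.passing K [] : Ctl N I).IsCallOf K [] := .inr rfl
  have hcls : ∀ {l s} {e : N → Option (Val N New)}, s i = ⟨.passing K [], l⟩ →
      F.confCls g s e = F.callCls g s e i K [] := by
    intro l s e hi
    rw [confCls_eq _ _ i, callCls, ctlCls, hi]
    rfl
  induction l with
  | nil =>
    intro s e h hi
    have hs := (MStep.start hi hc).silent (M₀ := M₀) hF h
      ((hcls hi).trans (Conf.confCls_start hF).symm)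
    exact .of_silent hs (stabilizes_thread hF hgP hg hNew _ hs.conf (Function.update_self _ _ _))
  | cons x l ih =>
    intro s e h hi
    obtain ⟨a, hx⟩ := h.exists_eq_some (i := i) (x := x) (by rw [hi]; simp [live])
    have hs := (MStep.unmap hi hc hx).silent (M₀ := M₀) hF h
      ((hcls hi).trans (h.confCls_unmap hF hi hc).symm)
    exact .of_silent hs (ih hs.conf (Function.update_self _ _ _))

theorem stabilizes_passing (hF : F.NormalForm) (hgP : ∀ n, g n ∉ F.PUB) (hg : Function.Injective g)
    (hNew : F.RESTR.card + F.INP.card + F.FRM.card ≤ Fintype.card New)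
    {i : Fin F.n} {K : I} (xs : List N) :
    ∀ {l s} {e : N → Option (Val N New)},
    Conf F s e → s i = ⟨.passing K xs, l⟩ → Stabilizes F M₀ g i s e := by
  induction xs using List.reverseRecOn with
  | nil => exact fun h hi => stabilizes_passing_nil hF hgP hg hNew _ h hi
  | append_singleton xs x ih =>
    intro l s e h hi
    have hc : (Ctl.passing K (xs ++ [x]) : Ctl N I).IsCallOf K (xs ++ [x]) := .inr rfl
    obtain ⟨a, hx⟩ := h.exists_eq_some (i := i) (x := x) (by rw [hi]; simp [live, ctlNames])
    have hgd := h.good i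
    rw [hi] at hgd
    obtain ⟨b, hb⟩ := hgd.callInv hc
    have hl := hb.length_le
    have hf : (F.params K)[xs.length]? = some ((F.params K)[xs.length]'(by simp at hl; omega)) :=
      List.getElem?_eq_getElem _
    have hs := (MStep.pass hi hc hf hx).silent (M₀ := M₀) (g := g) hF h (by
      rw [h.confCls_pass hF hi hc hf hx, confCls_eq _ _ i, callCls, ctlCls, hi]
      rfl)
    exact .of_silent hs (ih hs.conf (Function.update_self _ _ _))

theorem Conf.stabilizes (hF : F.NormalForm) (hgP : ∀ n, g n ∉ F.PUB) (hg : Function.Injective g)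
    (hNew : F.RESTR.card + F.INP.card + F.FRM.card ≤ Fintype.card New)
    (h : Conf F s e) (i : Fin F.n) : Stabilizes F M₀ g i s e := by
  rcases hi : s i with ⟨S | ⟨K, xs⟩, l⟩
  · exact stabilizes_thread hF hgP hg hNew S h hi
  · exact stabilizes_passing hF hgP hg hNew xs h hi

/-- A state in which all threads are stable can be reached by silent steps. -/
theorem Conf.exists_stable (hF : F.NormalForm) (hgP : ∀ n, g n ∉ F.PUB) (hg : Function.Injective g)
    (hNew : F.RESTR.card + F.INP.card + F.FRM.card ≤ Fintype.card New)
    (h : Conf F s e) :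
    ∃ s' e', Silent F M₀ g s e s' e' ∧ ∀ i, (s' i).ctl.IsStable := by
  classical
  suffices H : ∀ t : Finset (Fin F.n), ∃ s' e', Silent F M₀ g s e s' e' ∧
      ∀ i ∈ t, (s' i).ctl.IsStable by simpa using H Finset.univ
  intro t
  induction t using Finset.induction_on with
  | empty => exact ⟨s, e, .refl h, by simp⟩
  | insert i t hi ih =>
    obtain ⟨s₁, e₁, h₁, hst⟩ := ih
    obtain ⟨s₂, e₂, h₂, hi₂, hj⟩ := h₁.conf.stabilizes (M₀ := M₀) hF hgP hg hNew i
    refine ⟨s₂, e₂, h₁.trans h₂, fun j hjt => ?_⟩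
    by_cases hji : j = i
    · rwa [hji]
    · rw [hj j hji]
      exact hst j ((Finset.mem_insert.1 hjt).resolve_left hji)

end Stabilize

end FCPSpec

namespace FCPSpec

open Proc (cls Cls)

variable {N : Type u} {I : Type v} [DecidableEq N] [Infinite N] [Fintype I]
variable {F : FCPSpec N I} {New : Type w} [Fintype New] {g : New → N}
variable {s : Fin F.n → CState N I} {e : N → Option (Val N New)}

theorem isStableMarking_marking :
    F.IsStableMarking (F.marking s e) ↔ ∀ i, (s i).ctl.IsStable := by
  refine forall_congr' fun i => ?_
  constructor
  · rintro ⟨t, ht, h⟩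
    obtain rfl : s i = t := ctlMarking_pos.1 h
    exact ht
  · exact fun h => ⟨s i, h, ctlMarking_pos.2 rfl⟩

theorem mem_of_inDom {x : N} {a : Val N New} (h : F.InDom x a) : x ∈ F.INP ∪ F.FRM ∪ F.RESTR := by
  cases a with
  | pub p => exact Finset.mem_union_left _ h.2
  | new n => exact h

theorem EnvInv.isSubstMarking (he : EnvInv F e) : F.IsSubstMarking (F.envMarking e) where
  supp := by
    rintro (⟨x, a⟩ | ⟨x, n⟩ | n) hp
    · exact if_neg fun h => hp (he.inDom x a h)
    · exact if_neg fun h => hp h.1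
    · exact absurd trivial hp
  restr n := by
    simp only [envMarking]
    split_ifs with h
    · obtain ⟨r, hr, hrn⟩ := h
      rw [Finset.sum_eq_single_of_mem r hr, if_pos hrn]
      intro r' hr' hne
      exact if_neg fun h => hne (he.inj r' hr' r hr _ h hrn)
    · rw [Finset.sum_eq_zero fun r hr => if_neg fun h' => h ⟨r, hr, h'⟩, add_zero]
  bind x _ := by
    classical
    simp only [envMarking]
    cases e x with
    | none => simp
    | some a =>
      cases a with
      | pub p => simp [Finset.sum_ite_eq]; split_ifs <;> simp
      | new n => simp
  compl x hx n := by
    simp only [envMarking, hx, true_and]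
    split_ifs <;> simp_all

theorem envMarking_new_eq_iff {x y : N} {n n' : New} (hn : e x = some (.new n))
    (hn' : e y = some (.new n')) :
    (∀ m, F.envMarking e (.eq x (.new m)) = F.envMarking e (.eq y (.new m))) ↔ n = n' := by
  constructor
  · intro hm
    have : 0 < F.envMarking e (.eq y (.new n)) := hm n ▸ envMarking_eq_pos.2 hn
    rw [envMarking_eq_pos, hn'] at this
    simpa using this.symm
  · rintro rfl m
    simp only [envMarking]
    rw [hn.trans hn'.symm]

/-- The substitution given by an environment. -/
theorem EnvInv.corresponds (hF : F.NormalForm) (he : EnvInv F e) (hgP : ∀ n, g n ∉ F.PUB)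
    (hg : Function.Injective g) :
    F.Corresponds (Finset.univ.image g).toList (fun x => (e x).map (valName g))
      (F.envMarking e) := by
  have hmem : ∀ {r : N}, r ∈ (Finset.univ.image g).toList ↔ ∃ n, g n = r := by simp
  have hnew : ∀ {x r : N}, r ∈ (Finset.univ.image g).toList → (e x).map (valName g) = some r →
      ∃ n, e x = some (.new n) ∧ g n = r := by
    intro x r hr h
    obtain ⟨a, ha, rfl⟩ := Option.map_eq_some_iff.1 h
    cases a with
    | pub p =>
      obtain ⟨n, hn⟩ := hmem.1 hr
      exact absurd (he.mem_PUB ha) (by rw [← show g n = p from hn]; exact hgP n)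
    | new n => exact ⟨n, ha, rfl⟩
  refine ⟨he.isSubstMarking, fun x h => ?_, fun x y h => ?_, fun x hx y h => ?_,
    fun x hx x' hx' y h h' => ?_, fun x h a => ?_, fun x p hp h => ?_, fun x r hr h => ?_,
    fun x y r hr r' hr' h h' => ?_⟩
  · obtain ⟨a, ha⟩ := Option.isSome_iff_exists.1 (by simpa using h)
    exact mem_of_inDom (he.inDom x a ha)
  · obtain ⟨a, ha, rfl⟩ := Option.map_eq_some_iff.1 h
    cases a with
    | pub p => exact .inl (he.mem_PUB ha)
    | new n => exact .inr (hmem.2 ⟨n, rfl⟩)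
  · obtain ⟨a, ha, rfl⟩ := Option.map_eq_some_iff.1 h
    cases a with
    | pub p => exact absurd hx (hF.disjoint_RESTR x (he.inDom x _ ha).2)
    | new n => exact hmem.2 ⟨n, rfl⟩
  · obtain ⟨a, ha, hay⟩ := Option.map_eq_some_iff.1 h
    obtain ⟨a', ha', hay'⟩ := Option.map_eq_some_iff.1 h'
    obtain rfl := valName_injOn he hgP hg ha ha' (hay.trans hay'.symm)
    exact he.inj x hx x' hx' a ha ha'
  · rw [Option.map_eq_none_iff] at h
    simp [envMarking, h]
  · obtain ⟨a, ha, rfl⟩ := Option.map_eq_some_iff.1 h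
    cases a with
    | pub p => exact if_pos ha
    | new n => exact absurd hp (hgP n)
  · obtain ⟨n, hn, -⟩ := hnew hr h
    exact ⟨n, if_pos hn⟩
  · obtain ⟨n, hn, rfl⟩ := hnew hr h
    obtain ⟨n', hn', rfl⟩ := hnew hr' h'
    rw [hg.eq_iff, envMarking_new_eq_iff hn hn']

/-- Stable states are related to the processes that they represent. -/
theorem Conf.rel (hF : F.NormalForm) (h : Conf F s e) (hgP : ∀ n, g n ∉ F.PUB)
    (hg : Function.Injective g) (hst : ∀ i, (s i).ctl.IsStable) {M₀ : SPlace N New → ℕ}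
    {q : F.ts.State} {M : (F.net M₀).ts.State} (hq : q.1 = F.confCls g s e)
    (hM : M.1 = F.marking s e) : F.Rel M₀ q M := by
  choose b S l hs hS ho ht using fun i => (h.good i).exists_thread (hst i)
  have hlive : ∀ i x, x ∈ F.live (s i) ↔ x ∈ (S i).fn ∨ x ∈ l i := by
    intro i x
    rw [hs i]
    simp [live, ctlNames]
  refine ⟨hM ▸ isStableMarking_marking.2 hst, (Finset.univ.image g).toList, S, l,
    fun i x => if x ∈ F.live (s i) then (e x).map (valName g) else none,
    fun x => (e x).map (valName g), Finset.nodup_toList _, ?_, hS, fun i => ?_, fun i x => ?_,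
    fun i x hx => (ht i).disjoint x hx, fun i x y hy => ?_, ?_, fun x y => ?_, ?_, fun i => ?_⟩
  · simp only [Finset.mem_toList, Finset.mem_image, Finset.mem_univ, true_and]
    rintro _ ⟨n, rfl⟩
    exact hgP n
  · exact ⟨_, F.isBody_bodyAt (b i), (ht i).derived⟩
  · rw [← hlive]
    dsimp only
    split_ifs with hx
    · obtain ⟨a, ha⟩ := h.exists_eq_some hx
      simp [ha, hx]
    · simp [hx]
  · have := (h.env.corresponds hF hgP hg).cod x y
    dsimp only at hy
    split_ifs at hy
    exact (this hy).symm
  · change _ = cls _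
    rw [hq, confCls, Cls.cls_resList (Finset.nodup_toList _), Finset.toList_toFinset,
      Cls.cls_parList_ofFn]
    congr 1
    refine Finset.sum_congr rfl fun i _ => ?_
    rw [ctlCls, show F.toProc (s i).ctl = S i by rw [hs i]; rfl]
    congr 1
    refine Proc.subst_congr _ fun x hx => ?_
    have hx' := (hlive i x).2 (.inl hx)
    obtain ⟨a, ha⟩ := h.exists_eq_some hx'
    simp [PSub.app, hx', ha, valuation]
  · constructor
    · intro hxy
      obtain ⟨a, ha, -⟩ := Option.map_eq_some_iff.1 hxy
      obtain ⟨i, hi⟩ := (h.isSome x).1 (by simp [ha])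
      exact ⟨i, (if_pos hi).trans hxy⟩
    · rintro ⟨i, hi⟩
      dsimp only at hi
      split_ifs at hi
      exact hi
  · rw [hM]
    exact h.env.corresponds hF hgP hg
  · rw [hM, ← hs i]
    simp [marking, ctlMarking]

/-- Related states represent the same process. -/
theorem Rel.eq_confCls (hgP : ∀ n, g n ∉ F.PUB)
    (hg : Function.Injective g) {M₀ : SPlace N New → ℕ} {q : F.ts.State}
    {M : (F.net M₀).ts.State} (hR : F.Rel M₀ q M) (hM : M.1 = F.marking s e) :
    q.1 = F.confCls g s e := by
  obtain ⟨-, rs, S, lam, σs, σ, hrs, hrsP, -, -, hdom, -, hcod, hq, hun, hcor, hctl⟩ := hR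
  rw [hM] at hcor hctl
  change F.Corresponds rs σ (F.envMarking e) at hcor
  have hs : ∀ i, s i = ⟨.thread (S i), lam i⟩ := fun i =>
    ctlMarking_pos.1 (lt_of_lt_of_eq one_pos (hctl i).symm)
  have hpos : ∀ {x : N} {a : Val N New}, F.envMarking e (.eq x a) = 1 → e x = some a := fun h =>
    envMarking_eq_pos.1 (h ▸ one_pos)
  have hpub : ∀ {x p}, p ∈ F.PUB → σ x = some p → e x = some (.pub p) := fun hp h =>
    hpos (hcor.pub _ _ hp h)
  have hrest : ∀ {x r}, r ∈ rs → σ x = some r → ∃ n, e x = some (.new n) := fun hr h =>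
    (hcor.rest _ _ hr h).imp fun _ => hpos
  have heq : ∀ {x y r r' n n'}, r ∈ rs → r' ∈ rs → σ x = some r → σ y = some r' →
      e x = some (.new n) → e y = some (.new n') → (r = r' ↔ n = n') := by
    intro x y r r' n n' hr hr' hx hy hn hn'
    rw [hcor.eq x y r hr r' hr' hx hy]
    exact envMarking_new_eq_iff hn hn'
  have hσ : ∀ i, ∀ x ∈ (S i).fn, ∃ y, σ x = some y ∧ (σs i).app x = y := by
    intro i x hx
    obtain ⟨y, hy⟩ := Option.isSome_iff_exists.1 ((hdom i x).2 (.inl hx))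
    exact ⟨y, (hun x y).2 ⟨i, hy⟩, by simp [PSub.app, hy]⟩
  set X : Cls N I := ∑ i, cls ((S i).subst (σs i).app) with hX
  have hfnX : ∀ y, y ∈ Cls.fn X ↔ ∃ i, ∃ x ∈ (S i).fn, σ x = some y := by
    intro y
    rw [hX, Cls.fn_sum, Finset.mem_biUnion]
    refine exists_congr fun i => ?_
    rw [Cls.fn_cls, Proc.fn_subst, Finset.mem_image]
    constructor
    · rintro ⟨-, x, hx, rfl⟩
      obtain ⟨y, hy, rfl⟩ := hσ i x hx
      exact ⟨x, hx, hy⟩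
    · rintro ⟨x, hx, hy⟩
      obtain ⟨y', hy', h⟩ := hσ i x hx
      obtain rfl : y = y' := by rw [hy] at hy'; simpa using hy'
      exact ⟨Finset.mem_univ i, x, hx, h⟩
  set A := rs.toFinset ∩ Cls.fn X with hA
  have hmemA : ∀ {r}, r ∈ A ↔ r ∈ rs ∧ ∃ i, ∃ x ∈ (S i).fn, σ x = some r := by
    intro r
    rw [hA, Finset.mem_inter, List.mem_toFinset, hfnX]
  classical
  let π : N → N := fun r => if h : ∃ n : New, ∃ x, σ x = some r ∧ e x = some (.new n) then
    g h.choose else r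
  have hπ : ∀ {r x n}, r ∈ rs → σ x = some r → e x = some (.new n) → π r = g n := by
    intro r x n hr hx hn
    have h : ∃ n : New, ∃ x, σ x = some r ∧ e x = some (.new n) := ⟨n, x, hx, hn⟩
    obtain ⟨x', hx', hn'⟩ := h.choose_spec
    rw [show π r = g h.choose from dif_pos h, ← (heq hr hr hx hx' hn hn').1 rfl]
  have hinj : Set.InjOn π A := by
    intro r hr r' hr' hrr
    obtain ⟨hr, i, x, -, hx⟩ := hmemA.1 hr
    obtain ⟨hr', i', x', -, hx'⟩ := hmemA.1 hr'
    obtain ⟨n, hn⟩ := hrest hr hx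
    obtain ⟨n', hn'⟩ := hrest hr' hx'
    rw [hπ hr hx hn, hπ hr' hx' hn'] at hrr
    exact (heq hr hr' hx hx' hn hn').2 (hg hrr)
  have himg : ∀ {z}, z ∈ A.image π → ∃ n, g n = z := by
    intro z hz
    obtain ⟨r, hr, rfl⟩ := Finset.mem_image.1 hz
    obtain ⟨hr, i, x, -, hx⟩ := hmemA.1 hr
    obtain ⟨n, hn⟩ := hrest hr hx
    exact ⟨n, (hπ hr hx hn).symm⟩
  have hdisj : Disjoint (A.image π) (Cls.fn X \ A) := by
    rw [Finset.disjoint_left]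
    intro z hz hz'
    obtain ⟨n, rfl⟩ := himg hz
    rw [Finset.mem_sdiff] at hz'
    obtain ⟨i, x, hx, hxz⟩ := (hfnX _).1 hz'.1
    rcases hcor.cod x _ hxz with h | h
    · exact hgP n h
    · exact hz'.2 (hmemA.2 ⟨h, i, x, hx, hxz⟩)
  have hval : ∀ i, ∀ x ∈ (S i).fn,
      (if (σs i).app x ∈ A then π ((σs i).app x) else (σs i).app x) = valuation g e x := by
    intro i x hx
    obtain ⟨y, hy, h⟩ := hσ i x hx
    rw [h]
    rcases hcor.cod x y hy with hP | hr
    · have hyA : y ∉ A := fun hyA => hrsP y (hmemA.1 hyA).1 hP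
      rw [if_neg hyA, valuation_eq (hpub hP hy)]
      rfl
    · obtain ⟨n, hn⟩ := hrest hr hy
      rw [if_pos (hmemA.2 ⟨hr, i, x, hx, hy⟩), valuation_eq hn, hπ hr hy hn]
      rfl
  have hcls : Cls.subst (fun x => if x ∈ A then π x else x) X = ∑ i, F.ctlCls g s e i := by
    rw [hX, Cls.subst_sum]
    refine Finset.sum_congr rfl fun i _ => ?_
    rw [Cls.subst_cls, Proc.subst_subst_cls, ctlCls,
      show F.toProc (s i).ctl = S i by rw [hs i]; rfl]
    exact congrArg cls (Proc.subst_congr _ (hval i))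
  rw [hq]
  change cls _ = _
  rw [Cls.cls_resList hrs, Cls.cls_parList_ofFn, ← Cls.nu_inter, ← hX, ← hA,
    Cls.nu_rename hinj hdisj, hcls, confCls, ← Cls.nu_inter,
    ← Cls.nu_inter (Finset.univ.image g)]
  congr 1
  ext z
  rw [Finset.mem_inter, Finset.mem_inter]
  refine and_congr_left fun hz => ⟨fun h => ?_, fun h => ?_⟩
  · obtain ⟨n, rfl⟩ := himg h
    exact Finset.mem_image_of_mem _ (Finset.mem_univ n)
  · obtain ⟨n, -, rfl⟩ := Finset.mem_image.1 h
    rw [Cls.fn_sum, Finset.mem_biUnion] at hz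
    obtain ⟨i, -, hz⟩ := hz
    rw [ctlCls, show F.toProc (s i).ctl = S i by rw [hs i]; rfl, Cls.fn_cls, Proc.fn_subst,
      Finset.mem_image] at hz
    obtain ⟨x, hx, hxn⟩ := hz
    obtain ⟨y, hy, -⟩ := hσ i x hx
    rcases hcor.cod x y hy with hP | hr
    · rw [valuation_eq (hpub hP hy)] at hxn
      exact absurd hP (by rw [show y = g n from hxn]; exact hgP n)
    · obtain ⟨m, hm⟩ := hrest hr hy
      rw [valuation_eq hm] at hxn
      obtain rfl : m = n := hg hxn
      exact Finset.mem_image.2 ⟨y, hmemA.2 ⟨hr, i, x, hx, hy⟩, hπ hr hy hm⟩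

section Initial

variable {M₀ : SPlace N New → ℕ}

theorem eq_of_sum_le_one {ι : Type*} {t : Finset ι} {f : ι → ℕ} (h : ∑ i ∈ t, f i ≤ 1) {i j : ι}
    (hi : i ∈ t) (hj : j ∈ t) (hfi : 0 < f i) (hfj : 0 < f j) : i = j := by
  classical
  by_contra hij
  rw [← Finset.add_sum_erase t f hi] at h
  have := Finset.single_le_sum (f := f) (fun _ _ => Nat.zero_le _)
    (Finset.mem_erase.2 ⟨Ne.symm hij, hj⟩)
  omega

theorem IsSubstMarking.inDom (h : F.IsSubstMarking M₀) {x : N} {a : Val N New}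
    (hx : 0 < M₀ (.eq x a)) : F.InDom x a := by
  by_contra hd
  exact hx.ne' (h.supp _ hd)

theorem IsSubstMarking.unique (h : F.IsSubstMarking M₀) {x : N} {a b : Val N New}
    (ha : 0 < M₀ (.eq x a)) (hb : 0 < M₀ (.eq x b)) : a = b := by
  have hbind := h.bind x (mem_of_inDom (h.inDom ha))
  have hpub : ∀ {p}, 0 < M₀ (.eq x (.pub p)) →
      M₀ (.eq x (.pub p)) ≤ ∑ p ∈ F.PUB, M₀ (.eq x (.pub p)) := fun hp =>
    Finset.single_le_sum (f := fun p => M₀ (.eq x (.pub p))) (fun _ _ => Nat.zero_le _)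
      (h.inDom hp).1
  have hnew : ∀ n, M₀ (.eq x (.new n)) ≤ ∑ n, M₀ (.eq x (.new n)) := fun n =>
    Finset.single_le_sum (f := fun n => M₀ (.eq x (.new n))) (fun _ _ => Nat.zero_le _)
      (Finset.mem_univ n)
  cases a with
  | pub p =>
    cases b with
    | pub p' =>
      exact congrArg Val.pub (eq_of_sum_le_one (f := fun p => M₀ (.eq x (.pub p)))
        (by omega) (h.inDom ha).1 (h.inDom hb).1 ha hb)
    | new n => have := hpub ha; have := hnew n; omega
  | new n =>
    cases b with
    | pub p => have := hpub hb; have := hnew n; omega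
    | new n' =>
      exact congrArg Val.new (eq_of_sum_le_one (f := fun n => M₀ (.eq x (.new n)))
        (by omega) (Finset.mem_univ n) (Finset.mem_univ n') ha hb)

theorem IsSubstMarking.le_one (h : F.IsSubstMarking M₀) (x : N) (a : Val N New) :
    M₀ (.eq x a) ≤ 1 := by
  rcases Nat.eq_zero_or_pos (M₀ (.eq x a)) with h0 | hpos
  · omega
  have hbind := h.bind x (mem_of_inDom (h.inDom hpos))
  cases a with
  | pub p =>
    have := Finset.single_le_sum (f := fun p => M₀ (.eq x (.pub p))) (fun _ _ => Nat.zero_le _)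
      (h.inDom hpos).1
    omega
  | new n =>
    have := Finset.single_le_sum (f := fun n => M₀ (.eq x (.new n))) (fun _ _ => Nat.zero_le _)
      (Finset.mem_univ n)
    omega

/-- Every substitution marking represents an environment. -/
theorem IsSubstMarking.exists_env (hF : F.NormalForm) (h : F.IsSubstMarking M₀) :
    ∃ e : N → Option (Val N New), EnvInv F e ∧ M₀ = F.envMarking e := by
  classical
  let e : N → Option (Val N New) := fun x =>
    if hx : ∃ a, 0 < M₀ (.eq x a) then some hx.choose else none
  have he : ∀ {x a}, e x = some a ↔ 0 < M₀ (.eq x a) := by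
    intro x a
    by_cases hx : ∃ a, 0 < M₀ (.eq x a)
    · rw [show e x = some hx.choose from dif_pos hx, Option.some.injEq]
      exact ⟨fun ha => ha ▸ hx.choose_spec, fun ha => h.unique hx.choose_spec ha⟩
    · rw [show e x = none from dif_neg hx]
      exact ⟨fun h => (by cases h), fun ha => absurd ⟨a, ha⟩ hx⟩
  have heq : ∀ x a, M₀ (.eq x a) = if e x = some a then 1 else 0 := by
    intro x a
    have := h.le_one x a
    split_ifs with hx <;> rw [he] at hx <;> omega
  refine ⟨e, ⟨fun x a ha => h.inDom (he.1 ha), fun r hr r' hr' a ha ha' => ?_⟩, ?_⟩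
  · cases a with
    | pub p => exact absurd hr (hF.disjoint_RESTR r (h.inDom (he.1 ha)).2)
    | new n =>
      have := h.restr n
      exact eq_of_sum_le_one (f := fun r => M₀ (.eq r (.new n))) (by omega) hr hr'
        (he.1 ha) (he.1 ha')
  · funext p
    rcases p with ⟨x, a⟩ | ⟨x, n⟩ | n
    · rw [heq]; rfl
    · simp only [envMarking]
      by_cases hx : x ∈ F.INP ∪ F.FRM
      · have := h.compl x hx n
        rw [heq] at this
        simp only [hx, true_and]
        split_ifs at this ⊢ <;> first | omega | contradiction
      · rw [if_neg fun h' => hx h'.1]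
        exact h.supp _ hx
    · simp only [envMarking]
      have hr := h.restr n
      split_ifs with hex
      · obtain ⟨r, hrR, hrn⟩ := hex
        have := Finset.single_le_sum (f := fun r => M₀ (.eq r (.new n)))
          (fun _ _ => Nat.zero_le _) hrR
        have := he.1 hrn
        omega
      · rw [Finset.sum_eq_zero fun r hrR => ?_, add_zero] at hr
        · exact hr
        · rw [heq, if_neg fun h' => hex ⟨r, hrR, h'⟩]

/-- The initial control states. -/
def initCtl (F : FCPSpec N I) (i : Fin F.n) : CState N I := ⟨.thread (F.thread i), []⟩

theorem exists_conf_init (hF : F.NormalForm) (hM₀ : F.IsInitialMarking M₀) :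
    ∃ e : N → Option (Val N New), Conf F F.initCtl e ∧ M₀ = F.envMarking e := by
  obtain ⟨σ, hun, hcor⟩ := hM₀
  obtain ⟨e, he, rfl⟩ := hcor.isSubstMarking.exists_env hF
  refine ⟨e, ⟨fun i => Good.init hF i, fun _ => .refl, fun x => ?_, he⟩, rfl⟩
  have h1 : (∃ i, x ∈ F.live (F.initCtl i)) ↔ (σ x).isSome := by
    rw [Option.isSome_iff_exists]
    simp only [live, ctlNames, initCtl, List.toFinset_nil, Finset.union_empty,
      ← hF.sub_dom, Option.isSome_iff_exists]
    rw [exists_comm]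
    exact exists_congr fun y => (hun x y).symm
  have hpos : ∀ {a : Val N New}, F.envMarking e (.eq x a) = 1 → (e x).isSome := fun h =>
    Option.isSome_iff_exists.2 ⟨_, envMarking_eq_pos.1 (h ▸ one_pos)⟩
  rw [h1]
  constructor
  · intro hx
    by_contra hσ
    obtain ⟨a, ha⟩ := Option.isSome_iff_exists.1 hx
    exact (envMarking_eq_pos.2 ha).ne' (hcor.not_dom x (by simpa using hσ) a)
  · intro hx
    obtain ⟨y, hy⟩ := Option.isSome_iff_exists.1 hx
    rcases hcor.cod x y hy with hP | hr
    · exact hpos (hcor.pub x y hP hy)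
    · obtain ⟨n, hn⟩ := hcor.rest x y hr hy
      exact hpos hn

theorem net_M₀ (e : N → Option (Val N New)) :
    (F.net (F.envMarking e)).M₀ = F.marking F.initCtl e := by
  classical
  funext p
  rcases p with p | ⟨i, t⟩
  · rfl
  · change Set.indicator {F.initCtl i} 1 t = ctlMarking F.initCtl (i, t)
    simp [ctlMarking, Set.indicator_apply, eq_comm]

theorem NormalForm.rs_facts (hF : F.NormalForm) : F.rs.Nodup ∧ ∀ r ∈ F.rs, r ∉ F.PUB := by
  have hle : (F.rs : Multiset N) ≤ F.resOcc := by
    rw [resOcc, add_assoc]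
    exact le_add_of_nonneg_right (Multiset.zero_le _)
  refine ⟨Multiset.coe_nodup.1 (Multiset.nodup_of_le hle (Multiset.nodup_add.1 hF.bound_nodup).1),
    fun r hr => Finset.disjoint_left.1 hF.bound_free (Finset.mem_union_left _ ?_)⟩
  exact Multiset.mem_toFinset.2 (Multiset.mem_of_le hle hr)

theorem rel_init (hF : F.NormalForm) (hM₀ : F.IsInitialMarking M₀) :
    F.Rel M₀ F.ts.init (F.net M₀).ts.init := by
  classical
  obtain ⟨σ, hun, hcor⟩ := hM₀
  have hctl : ∀ i, (F.net M₀).M₀ (.inr (i, F.initCtl i)) = 1 := fun i => by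
    change Set.indicator {F.initCtl i} 1 (F.initCtl i) = 1
    simp
  refine ⟨fun i => ⟨F.initCtl i, hF.thread_stable i, ?_⟩, F.rs, F.thread, fun _ => [], F.sub, σ,
    hF.rs_facts.1, hF.rs_facts.2, hF.thread_stable, fun i => ⟨F.thread i, .inl ⟨i, rfl⟩, .refl⟩,
    fun i x => by simp [hF.sub_dom], by simp,
    fun i x y h => (hcor.cod x y ((hun x y).2 ⟨i, h⟩)).symm, rfl, hun, hcor, hctl⟩
  exact lt_of_lt_of_eq one_pos (hctl i).symm

end Initial

end FCPSpec

namespace PetriNet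

variable {X : Type u} {Y : Type v} {W : PetriNet X Y}

theorem ts_reflTransGen {M : W.ts.State} {M' : X → ℕ} (h : ReflTransGen W.Step M.1 M') :
    ∃ h', ReflTransGen W.ts.step M ⟨M', h'⟩ := by
  induction h with
  | refl => exact ⟨M.2, .refl⟩
  | tail _ hs ih =>
    obtain ⟨h', ih⟩ := ih
    exact ⟨h'.tail hs, ih.tail hs⟩

end PetriNet

namespace FCPSpec

open Proc (cls Cls)

variable {N : Type u} {I : Type v} [DecidableEq N] [Infinite N] [Fintype I]
variable {F : FCPSpec N I} {New : Type w}

theorem ts_step_iff {q q' : F.ts.State} :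
    F.ts.step q q' ↔ Cls.React F.params F.body q.1 q'.1 := Iff.rfl

theorem exists_ts_step {q : F.ts.State} {c : Cls N I} (h : Cls.React F.params F.body q.1 c) :
    ∃ q' : F.ts.State, q'.1 = c ∧ F.ts.step q q' := by
  obtain ⟨G, hG, hqG⟩ := q.2
  obtain ⟨c'⟩ := c
  have hr : Proc.React F.params F.body G c' := by
    rw [hqG] at h
    exact Cls.react_cls.1 h
  exact ⟨⟨_, c', hG.tail hr, rfl⟩, rfl, ts_step_iff.2 h⟩

theorem exists_fresh_names [Finite New] (A : Finset N) :
    ∃ g : New → N, Function.Injective g ∧ ∀ n, g n ∉ A := by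
  have : Infinite {x // x ∉ A} := A.finite_toSet.infinite_compl.to_subtype
  obtain ⟨k, ⟨f⟩⟩ := Finite.exists_equiv_fin New
  let φ := Infinite.natEmbedding {x // x ∉ A}
  exact ⟨fun n => φ (f n), fun n m h => f.injective (Fin.ext (φ.injective (Subtype.ext h))),
    fun n => (φ (f n)).2⟩

/-- All reachable markings represent control states and environments. -/
theorem exists_conf (hF : F.NormalForm) [Fintype New] {M₀ : SPlace N New → ℕ}
    (hM₀ : F.IsInitialMarking M₀) (M : (F.net M₀).ts.State) :
    ∃ s e, Conf F s e ∧ M.1 = F.marking s e := by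
  obtain ⟨M, hM⟩ := M
  obtain ⟨e, he, rfl⟩ := exists_conf_init hF hM₀
  dsimp only
  induction hM with
  | refl => exact ⟨_, e, he, net_M₀ e⟩
  | tail _ hs ih =>
    obtain ⟨s, e', h, rfl⟩ := ih
    obtain ⟨s', e'', hm, rfl⟩ := h.exists_mstep hF hs
    exact ⟨s', e'', hm.conf hF h, rfl⟩

end FCPSpec

/-- The transition systems of `F` and of its Petri net are weakly bisimilar, with `F.Rel M₀` as a
weak bisimulation. -/
theorem theorem6p3 {N I New : Type*} [DecidableEq N] [Infinite N] [Fintype I] [Fintype New]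
    (F : FCPSpec N I) (hF : F.NormalForm)
    (hNew : F.RESTR.card + F.INP.card + F.FRM.card ≤ Fintype.card New)
    (M₀ : SPlace N New → ℕ) (hM₀ : F.IsInitialMarking M₀) :
    IsWeakBisimulation F.ts (F.net M₀).ts (fun M => F.IsStableMarking M.1) (F.Rel M₀) := by
  obtain ⟨g, hg, hgP⟩ := FCPSpec.exists_fresh_names (New := New) F.PUB
  have hinv := FCPSpec.exists_conf hF hM₀
  refine ⟨FCPSpec.rel_init hF hM₀, fun q M h => h.1, ?_, ?_, ?_⟩
  · intro q M hR q' hq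
    obtain ⟨s, e, hc, hM⟩ := hinv M
    have hst := hR.1
    rw [hM, FCPSpec.isStableMarking_marking] at hst
    rw [FCPSpec.ts_step_iff, hR.eq_confCls hgP hg hM] at hq
    obtain ⟨s', e', hs, hq'⟩ := hc.exists_mstep_of_react hF hgP hg hst hq
    obtain ⟨s'', e'', hsil, hst'⟩ :=
      (hs.conf hF hc).exists_stable (M₀ := M₀) hF hgP hg hNew
    have hstep := hs.step hF hc M₀
    rw [← hM] at hstep
    have hts : (F.net M₀).ts.step M ⟨_, M.2.tail hstep⟩ := hstep
    obtain ⟨h', hrtg⟩ := PetriNet.ts_reflTransGen (M := ⟨_, M.2.tail hstep⟩) hsil.steps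
    exact ⟨_, .head' hts hrtg, hsil.conf.rel hF hgP hg hst' (hq'.trans hsil.cls_eq) rfl⟩
  · intro q M hR M' hMM' hst'
    obtain ⟨s, e, hc, hM⟩ := hinv M
    have hst := hR.1
    rw [hM, FCPSpec.isStableMarking_marking] at hst
    have hq := hR.eq_confCls hgP hg hM
    have key : ∃ q' s' e', TransGen F.ts.step q q' ∧ FCPSpec.Conf F s' e' ∧
        M'.1 = F.marking s' e' ∧ q'.1 = F.confCls g s' e' := by
      clear hst'
      induction hMM' with
      | single hs =>
        have hs' : (F.net M₀).Step M.1 _ := hs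
        rw [hM] at hs'
        obtain ⟨s', e', hm, hM'⟩ := hc.exists_mstep hF hs'
        rcases hm.confCls hF hc hgP hg with h | h
        · exact absurd hst h.1
        · rw [← hq] at h
          obtain ⟨q', hq', hqs⟩ := FCPSpec.exists_ts_step h
          exact ⟨q', s', e', .single hqs, hm.conf hF hc, hM', hq'⟩
      | tail _ hs ih =>
        obtain ⟨q₁, s₁, e₁, hq₁, hc₁, hM₁, hcl₁⟩ := ih
        have hs' : (F.net M₀).Step _ _ := hs
        rw [hM₁] at hs'
        obtain ⟨s', e', hm, hM'⟩ := hc₁.exists_mstep hF hs'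
        rcases hm.confCls hF hc₁ hgP hg with h | h
        · exact ⟨q₁, s', e', hq₁, hm.conf hF hc₁, hM', hcl₁.trans h.2⟩
        · rw [← hcl₁] at h
          obtain ⟨q', hq', hqs⟩ := FCPSpec.exists_ts_step h
          exact ⟨q', s', e', hq₁.tail hqs, hm.conf hF hc₁, hM', hq'⟩
    obtain ⟨q', s', e', hqq', hc', hM', hq'⟩ := key
    rw [hM', FCPSpec.isStableMarking_marking] at hst'
    exact ⟨q', hqq', hc'.rel hF hgP hg hst' hq' hM'⟩
  · intro q M _ M' _
    obtain ⟨s, e, hc, hM⟩ := hinv M'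
    obtain ⟨s', e', hsil, hst⟩ := hc.exists_stable (M₀ := M₀) hF hgP hg hNew
    have hsteps := hsil.steps
    rw [← hM] at hsteps
    obtain ⟨h', hrtg⟩ := PetriNet.ts_reflTransGen hsteps
    exact ⟨_, hrtg, FCPSpec.isStableMarking_marking.2 hst⟩
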